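/- **Model.** A dispatcher serves $N\ge 2$ queues in slotted time $t=0,1,2,\dots$. In slot $t$, $A_\Sigma(t)$ jobs arrive and are all sent to one queue; queue $n$ is offered service $S_n(t)$; and $Q_n(t+1)=\max(Q_n(t)+A_n(t)-S_n(t),0)$, where $A_n(t)=A_\Sigma(t)$ for the chosen queue and $0$ for the others. The $\mathbb N$-valued variables $A_\Sigma(t)$ are i.i.d. in $t$ and bounded, with mean $\lambda_\Sigma=\mu_\Sigma-\epsilon$, $\epsilon>0$. For each $n$ the $\mathbb N$-valued variables $S_n(t)$ are i.i.d. in $t$ and bounded, with mean $\mu_n>0$. Services are independent across queues and of the arrivals, and $\mu_\Sigma=\sum_n\mu_n$. Servers are homogeneous if all $\mu_n$ are equal. $Q(0)$ is arbitrary. The dispatcher has a memory $m(t)$, which is refreshed (reports from servers, sampling) at the end of each slot, and $Z(t)=(Q(t),m(t))$ (with the memory containing the current threshold and a clock where needed) is a Markov chain. **Optimality.** A policy is *throughput optimal* if for every $\epsilon>0$ and all such arrivals and services $\limsup_{C\to\infty}\limsup_{t\to\infty}\mathbb P(\sum_nQ_n(t)>C)=0$. It is *heavy-traffic delay optimal*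 if, for all such services and every family of arrival laws with mean $\mu_\Sigma-\epsilon$, bounded uniformly in $\epsilon$, with variance convergent as $\epsilon\downarrow0$, stationary laws of $Z^{(\epsilon)}$ and of the resource-pooled queue $q(t+1)=\max(q(t)+A_\Sigma(t)-\sum_nS_n(t),0)$ exist, and, for any choice of them, $\lim_{\epsilon\downarrow0}\epsilon\,\mathbb E\sum_n\overline Q{}_n^{(\epsilon)}=\lim_{\epsilon\downarrow0}\epsilon\,\mathbb E\,\overline q^{(\epsilon)}$, both limits existing and being finite. **Class $\Pi$.** Let $p$ be a dispatching distribution when the queue lengths are $Q$, let $\sigma$ be a permutation with $Q_{\sigma(1)}\le\dots\le Q_{\sigma(N)}$, and put $P_n=p_{\sigma(n)}$. Put $\Delta_n=P_n-\mu_{\sigma(n)}/\mu_\Sigma$. $P$ is *tilted* if for some $k\in\{2,\dots,N\}$, $\Delta_n\ge0$ for $n<k$ and $\Delta_n\le0$ for $n\ge k$; it is *$\delta$-tilted* ($\delta>0$) if moreover $\Delta_1\ge\delta$ and $\Delta_N\le-\delta$. A probability vector $\hat P$ is *equivalent in inner product* to $P$ if $\sum_nQ_{\sigma(n)}P_n=\sum_nQ_{\sigma(n)}\hat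 P_n$. A policy is in $\Pi$ if (i) for every $t$ and every possible state $Z(t)$, the dispatching distribution given $Z(t)$ is, up to equivalence in inner product, tilted; and (ii) for some finite $T'\ge 1$ and $\delta>0$ independent of $\epsilon$, each window $\{kT',\dots,(k+1)T'-1\}$, $k=0,1,\dots$, contains a slot $t_k$ such that for all possible values of $Q(t_k)$ and of the memory just before its last refreshing, the dispatching distribution in slot $t_k$, averaged over the random sampling in that refreshing, is, up to equivalence in inner product, $\delta$-tilted. Both have to hold for every ordering $\sigma$ as above. **Policies.** Let $T\ge1$ and $1\le d\le N$. JBT-$d$ keeps a threshold and a set of server IDs, empty in slot $0$. At the end of the slots $0,T,2T,\dots$ it samples $d$ distinct servers uniformly at random and takes the shortest queue length among them as the new threshold; the memory then holds the IDs of all servers whose queue is not larger than the new threshold. At the end of the other slots (once there is a threshold) every server that is not in memory and whose queue is not larger than the threshold adds its ID. In each slot, if the memory is non-empty, an ID is chosen uniformly from it and removed, and all arrivals go to that server; otherwise they go to a server chosen uniformly among all. JBTG-$d$ differs only in that both choices are made with probabilities proportional to the rates $\mu_n$. **Proposition.** For all $T\ge1$ and $1\le d\le N$: 1. For homogeneous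 servers, JBT-$d$ is in $\Pi$, and it is throughput optimal and heavy-traffic delay optimal. In the slots $rT+1$, $r=0,1,\dots$, right after the threshold updates, the dispatching distribution in the sense of (ii) is, up to equivalence in inner product, $\delta$-tilted with $\delta=\min\{\frac dN(1-\frac1N),\frac1N\}$. 2. For homogeneous and for heterogeneous servers, JBTG-$d$ is in $\Pi$, and it is throughput optimal and heavy-traffic delay optimal. In the slots $rT+1$ the dispatching distribution in the sense of (ii) is, up to equivalence in inner product, $\delta$-tilted with $\delta=\min\{1,d(1-\frac1N)\}\,\frac{\min_n\mu_n}{\mu_\Sigma}$. -/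

import Mathlib

open MeasureTheory Filter Topology
open scoped ENNReal

noncomputable section

namespace LoadBalancing

/-! ### Policies and the queueing dynamics -/

/-- A load balancing policy for `N` servers with queue lengths `q : Fin N → ℕ`.
In slot `t` the dispatcher sends all new arrivals to one server, drawn from `dispatch Q(t) m(t)`,
and its memory becomes `afterDispatch m(t) i` if server `i` was chosen. At the end of the slot, when
the new queue lengths `Q(t+1)` are known, the memory is refreshed (messages from the servers,
sampling of servers), which produces `m(t+1)`; the randomness drawn there is described by
`refresh`. The memory may hold any data, such as server IDs, a threshold and a clock. -/
structure Policy (N : ℕ) where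
  Mem : Type
  init : Mem
  refresh : (Fin N → ℕ) → Mem → PMF Mem
  dispatch : (Fin N → ℕ) → Mem → PMF (Fin N)
  afterDispatch : Mem → Fin N → Mem

variable {N : ℕ}

/-- Queue lengths together with the memory. -/
abbrev Policy.State (π : Policy N) : Type := (Fin N → ℕ) × π.Mem

/-- Total queue length. -/
def Policy.total (π : Policy N) (z : π.State) : ℕ := ∑ n, z.1 n

/-- Joint law of the services offered in one slot: independent across the servers. -/
def serviceLaw (s : Fin N → PMF ℕ) : PMF (Fin N → ℕ) :=
  (Measure.pi fun n => (s n).toMeasure).toPMF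

/-- One slot, up to the refreshing of the memory: from `(Q(t), m(t))` draw the chosen server, the
number of exogenous arrivals and the offered services; then
`Q_n(t+1) = max (Q_n(t) + A_n(t) - S_n(t)) 0` (subtraction in `ℕ` truncates at `0`). -/
def Policy.slot (π : Policy N) (a : PMF ℕ) (s : Fin N → PMF ℕ) (z : π.State) : PMF π.State :=
  (π.dispatch z.1 z.2).bind fun i =>
    a.bind fun A =>
      (serviceLaw s).bind fun S =>
        PMF.pure (fun n => z.1 n + (if n = i then A else 0) - S n, π.afterDispatch z.2 i)

/-- Refreshing of the memory at the end of a slot. -/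
def Policy.report (π : Policy N) (z : π.State) : PMF π.State :=
  (π.refresh z.1 z.2).map fun m => (z.1, m)

/-- Law of the queue lengths `Q(t)` together with the memory just before it is refreshed to `m(t)`,
for arrival law `a`, service laws `s` and initial queue lengths `q₀`. -/
def Policy.preLaw (π : Policy N) (a : PMF ℕ) (s : Fin N → PMF ℕ) (q₀ : Fin N → ℕ) :
    ℕ → PMF π.State
  | 0 => PMF.pure (q₀, π.init)
  | t + 1 => ((Policy.preLaw π a s q₀ t).bind π.report).bind (π.slot a s)

/-- Law of the state `Z(t) = (Q(t), m(t))` at the beginning of slot `t`. -/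
def Policy.law (π : Policy N) (a : PMF ℕ) (s : Fin N → PMF ℕ) (q₀ : Fin N → ℕ) (t : ℕ) :
    PMF π.State :=
  (π.preLaw a s q₀ t).bind π.report

/-- `ν` is a stationary law of the Markov chain `Z(t) = (Q(t), m(t))`. -/
def Policy.IsStationary (π : Policy N) (a : PMF ℕ) (s : Fin N → PMF ℕ) (ν : PMF π.State) : Prop :=
  (ν.bind fun z => (π.slot a s z).bind π.report) = ν

/-- One slot of the resource-pooled single-server system, with arrivals `A_Σ(t)` and offered
service `∑ n, S_n(t)`. -/
def pooledStep (a : PMF ℕ) (s : Fin N → PMF ℕ) (q : ℕ) : PMF ℕ :=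
  a.bind fun A => (serviceLaw s).bind fun S => PMF.pure (q + A - ∑ n, S n)

/-- `ρ` is a stationary law of the resource-pooled system. -/
def IsPooledStationary (a : PMF ℕ) (s : Fin N → PMF ℕ) (ρ : PMF ℕ) : Prop :=
  ρ.bind (pooledStep a s) = ρ

/-- Mean of a law on `ℕ`, with values in `[0, ∞]`. -/
def expect (ρ : PMF ℕ) : ℝ≥0∞ := ∫⁻ k, (k : ℝ≥0∞) ∂ρ.toMeasure

/-! ### Assumptions on arrivals and services -/

/-- The number of exogenous arrivals per slot has mean `lam` and is at most `Amax`. -/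
def ArrivalLaw (lam : ℝ) (Amax : ℕ) (a : PMF ℕ) : Prop :=
  (∀ k ∈ a.support, k ≤ Amax) ∧ ∫ k, (k : ℝ) ∂a.toMeasure = lam

/-- The service offered by server `n` per slot has mean `μ n` and is uniformly bounded. -/
def ServiceLaws (μ : Fin N → ℝ) (s : Fin N → PMF ℕ) : Prop :=
  (∃ Smax : ℕ, ∀ n, ∀ k ∈ (s n).support, k ≤ Smax) ∧
    ∀ n, ∫ k, (k : ℝ) ∂(s n).toMeasure = μ n

/-! ### Throughput optimality and heavy-traffic delay optimality -/

/-- `limsup_{C → ∞} limsup_{t → ∞} P(∑ Q_n(t) > C) = 0`. -/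
def Policy.Stable (π : Policy N) (a : PMF ℕ) (s : Fin N → PMF ℕ) (q₀ : Fin N → ℕ) : Prop :=
  limsup (fun C : ℕ =>
    limsup (fun t : ℕ => ((π.law a s q₀ t).map π.total).toMeasure (Set.Ioi C)) atTop) atTop = 0

/-- The policy stabilizes the system, for servers with rates `μ`, whenever the arrival rate is
`∑ n, μ n - ε` with `ε > 0`. -/
def Policy.ThroughputOptimal (π : Policy N) (μ : Fin N → ℝ) : Prop :=
  ∀ s, ServiceLaws μ s → ∀ ε : ℝ, 0 < ε → ∀ (Amax : ℕ) (a : PMF ℕ),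
    ArrivalLaw (∑ n, μ n - ε) Amax a → ∀ q₀, π.Stable a s q₀

/-- For all admissible services and all families `a ε` of arrival laws with mean `∑ n, μ n - ε`,
uniformly bounded, and with convergent variance as `ε ↓ 0`: steady states exist, for the load
balancing system and for the resource-pooled system, and `ε` times the mean steady-state workload
has, as `ε ↓ 0`, the same finite limit for both systems (whichever stationary laws are taken). -/
def Policy.HeavyTrafficDelayOptimal (π : Policy N) (μ : Fin N → ℝ) : Prop :=
  ∀ s, ServiceLaws μ s → ∀ (Amax : ℕ) (a : ℝ → PMF ℕ) (ε₀ : ℝ), 0 < ε₀ →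
    (∀ ε ∈ Set.Ioo 0 ε₀, ArrivalLaw (∑ n, μ n - ε) Amax (a ε)) →
    (∃ v : ℝ, Tendsto
      (fun ε => ProbabilityTheory.variance (fun k : ℕ => (k : ℝ)) (a ε).toMeasure)
      (𝓝[>] 0) (𝓝 v)) →
    (∀ ε ∈ Set.Ioo 0 ε₀, (∃ ν, π.IsStationary (a ε) s ν) ∧ ∃ ρ, IsPooledStationary (a ε) s ρ) ∧
    ∃ L : ℝ≥0∞, L ≠ ⊤ ∧
      (∀ ν : ℝ → PMF π.State, (∀ ε ∈ Set.Ioo 0 ε₀, π.IsStationary (a ε) s (ν ε)) →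
        Tendsto (fun ε => ENNReal.ofReal ε * expect ((ν ε).map π.total)) (𝓝[>] 0) (𝓝 L)) ∧
      (∀ ρ : ℝ → PMF ℕ, (∀ ε ∈ Set.Ioo 0 ε₀, IsPooledStationary (a ε) s (ρ ε)) →
        Tendsto (fun ε => ENNReal.ofReal ε * expect (ρ ε)) (𝓝[>] 0) (𝓝 L))

/-! ### Tilted distributions and the class `Π` -/

/-- `Δ_n = P_n - μ_{σ(n)} / μ_Σ`, where `P` is indexed by the position in the ordering `σ`. -/
def tilt (μ : Fin N → ℝ) (σ : Equiv.Perm (Fin N)) (P : Fin N → ℝ) (n : Fin N) : ℝ :=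
  P n - μ (σ n) / ∑ j, μ j

/-- Positions are counted from `1` on paper and from `0` in `Fin N`. -/
def IsTilted (μ : Fin N → ℝ) (σ : Equiv.Perm (Fin N)) (P : Fin N → ℝ) : Prop :=
  ∃ k : ℕ, 2 ≤ k ∧ k ≤ N ∧
    (∀ n : Fin N, (n : ℕ) + 1 < k → 0 ≤ tilt μ σ P n) ∧
    (∀ n : Fin N, k ≤ (n : ℕ) + 1 → tilt μ σ P n ≤ 0)

/-- Tilted, with `Δ_1 ≥ δ` and `Δ_N ≤ -δ`. -/
def IsDeltaTilted (δ : ℝ) (μ : Fin N → ℝ) (σ : Equiv.Perm (Fin N)) (P : Fin N → ℝ) : Prop :=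
  IsTilted μ σ P ∧ 0 < δ ∧
    (∀ n : Fin N, (n : ℕ) + 1 = 1 → δ ≤ tilt μ σ P n) ∧
    (∀ n : Fin N, (n : ℕ) + 1 = N → tilt μ σ P n ≤ -δ)

/-- The probability vector `P'` is equivalent in inner product to `P`, given the queue lengths `q`
and the ordering `σ`. -/
def InnerEquiv (q : Fin N → ℕ) (σ : Equiv.Perm (Fin N)) (P P' : Fin N → ℝ) : Prop :=
  P' ∈ stdSimplex ℝ (Fin N) ∧ ∑ n, (q (σ n) : ℝ) * P n = ∑ n, (q (σ n) : ℝ) * P' n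

/-- For every ordering `σ` of the queues by length (every way of breaking ties), the dispatching
distribution `p`, listed in this order, is equivalent in inner product to a tilted one (possibly to
itself). -/
def TiltedUpToEquiv (μ : Fin N → ℝ) (q : Fin N → ℕ) (p : PMF (Fin N)) : Prop :=
  ∀ σ : Equiv.Perm (Fin N), Monotone (q ∘ σ) →
    ∃ P', InnerEquiv q σ (fun n => (p (σ n)).toReal) P' ∧ IsTilted μ σ P'

/-- The same with a `δ`-tilted distribution. -/
def DeltaTiltedUpToEquiv (δ : ℝ) (μ : Fin N → ℝ) (q : Fin N → ℕ) (p : PMF (Fin N)) : Prop :=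
  ∀ σ : Equiv.Perm (Fin N), Monotone (q ∘ σ) →
    ∃ P', InnerEquiv q σ (fun n => (p (σ n)).toReal) P' ∧ IsDeltaTilted δ μ σ P'

/-- The states `(Q(t), m(t))` that occur with positive probability at the beginning of slot `t`,
under some admissible arrivals and services and some initial queue lengths. -/
def Policy.possible (π : Policy N) (μ : Fin N → ℝ) (t : ℕ) : Set π.State :=
  {z | ∃ (s : Fin N → PMF ℕ) (ε : ℝ) (Amax : ℕ) (a : PMF ℕ) (q₀ : Fin N → ℕ),
    ServiceLaws μ s ∧ 0 < ε ∧ ArrivalLaw (∑ n, μ n - ε) Amax a ∧ z ∈ (π.law a s q₀ t).support}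

/-- The same for `Q(t)` and the memory just before it is refreshed to `m(t)`. -/
def Policy.possiblePre (π : Policy N) (μ : Fin N → ℝ) (t : ℕ) : Set π.State :=
  {z | ∃ (s : Fin N → PMF ℕ) (ε : ℝ) (Amax : ℕ) (a : PMF ℕ) (q₀ : Fin N → ℕ),
    ServiceLaws μ s ∧ 0 < ε ∧ ArrivalLaw (∑ n, μ n - ε) Amax a ∧ z ∈ (π.preLaw a s q₀ t).support}

/-- The probabilities with which each server is chosen in a slot, given the queue lengths at its
beginning and the memory before the refreshing: the random outcome `m(t)` of the refreshing is
averaged out. -/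
def Policy.meanDispatch (π : Policy N) (z : π.State) : PMF (Fin N) :=
  (π.refresh z.1 z.2).bind fun m => π.dispatch z.1 m

/-- The class `Π`, for servers with rates `μ`: (i) in every slot and for every state
`Z(t) = (Q(t), m(t))` the dispatching distribution is tilted; (ii) in each of the consecutive
windows of some length `T` there is a slot whose dispatching distribution is `δ`-tilted, for all
queue lengths in that slot and the whole past; here the dispatching probabilities include the
randomness of the sampling by which the memory is refreshed immediately before that slot. Both up
to equivalence in inner product. `T` and `δ` do not depend on the arrivals (hence not on `ε`). -/
def Policy.InClassPi (π : Policy N) (μ : Fin N → ℝ) : Prop :=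
  (∀ t, ∀ z ∈ π.possible μ t, TiltedUpToEquiv μ z.1 (π.dispatch z.1 z.2)) ∧
  ∃ (T : ℕ) (δ : ℝ), 0 < T ∧ 0 < δ ∧ ∀ k : ℕ, ∃ t : ℕ, k * T ≤ t ∧ t ≤ (k + 1) * T - 1 ∧
    ∀ z ∈ π.possiblePre μ t, DeltaTiltedUpToEquiv δ μ z.1 (π.meanDispatch z)

/-! ### Join-below-threshold -/

/-- Memory of the join-below-threshold policies: the stored server IDs, the current threshold
(`⊥` before the first update: no server reports), and the number of ends of slots to go before the
one at which the threshold is updated. -/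
structure ThresholdMemory (N : ℕ) where
  ids : Finset (Fin N)
  threshold : WithBot ℕ
  countdown : ℕ

/-- `d` distinct servers, sampled uniformly at random. -/
def sampleServers (d : ℕ) (hd : d ≤ N) : PMF (Finset (Fin N)) :=
  PMF.uniformOfFinset (Finset.powersetCard d Finset.univ)
    (Finset.powersetCard_nonempty.2 (by simpa using hd))

/-- End of a slot. If the threshold is due for an update, the new threshold is the shortest queue
length among `d` sampled servers, and the memory holds the servers whose queue is not larger than
it (stored IDs with a longer queue are discarded). Otherwise every server that is not in the memory
and whose queue is not larger than the threshold adds its ID. -/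
def thresholdRefresh (d T : ℕ) (hd : d ≤ N) (q : Fin N → ℕ) (m : ThresholdMemory N) :
    PMF (ThresholdMemory N) :=
  if m.countdown = 0 then
    (sampleServers d hd).map fun D =>
      { ids := Finset.univ.filter fun n => q n ≤ sInf (q '' (D : Set (Fin N)))
        threshold := ((sInf (q '' (D : Set (Fin N))) : ℕ) : WithBot ℕ)
        countdown := T - 1 }
  else
    PMF.pure
      { ids := m.ids ∪ Finset.univ.filter fun n => (q n : WithBot ℕ) ≤ m.threshold
        threshold := m.threshold
        countdown := m.countdown - 1 }

/-- Join-below-threshold with `choose ids` the law of the chosen server when the memory holds `ids`.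
The ID of the chosen server is removed from the memory. The memory is empty in slot `0`, and the
threshold is updated at the end of the slots `0, T, 2T, …` (so that `1, T + 1, 2T + 1, …` are the
slots right after an update). -/
def thresholdPolicy (d T : ℕ) (hd : d ≤ N) (choose : Finset (Fin N) → PMF (Fin N)) : Policy N where
  Mem := ThresholdMemory N
  init := { ids := ∅, threshold := ⊥, countdown := 1 }
  refresh := thresholdRefresh d T hd
  dispatch := fun _ m => choose m.ids
  afterDispatch := fun m i => { m with ids := m.ids.erase i }

/-- Uniform choice among the stored IDs, or among all servers if there are none. -/
def uniformChoice [NeZero N] (ids : Finset (Fin N)) : PMF (Fin N) :=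
  if h : ids.Nonempty then PMF.uniformOfFinset ids h else PMF.uniformOfFintype (Fin N)

/-- Choice from a nonempty set of servers with probabilities proportional to the rates. -/
def rateWeighted (μ : Fin N → ℝ) (hμ : ∀ n, 0 < μ n) (ids : Finset (Fin N)) (h : ids.Nonempty) :
    PMF (Fin N) :=
  PMF.normalize (fun i => if i ∈ ids then ENNReal.ofReal (μ i) else 0)
    (by
      obtain ⟨i, hi⟩ := h
      intro h0
      have := ENNReal.tsum_eq_zero.1 h0 i
      rw [if_pos hi, ENNReal.ofReal_eq_zero] at this
      exact absurd (hμ i) (not_lt.2 this))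
    (by
      rw [tsum_fintype]
      refine ENNReal.sum_ne_top.2 fun i _ => ?_
      split_ifs
      · exact ENNReal.ofReal_ne_top
      · exact ENNReal.zero_ne_top)

/-- Rate-weighted choice among the stored IDs, or among all servers if there are none. -/
def weightedChoice [NeZero N] (μ : Fin N → ℝ) (hμ : ∀ n, 0 < μ n) (ids : Finset (Fin N)) :
    PMF (Fin N) :=
  if h : ids.Nonempty then rateWeighted μ hμ ids h
  else rateWeighted μ hμ Finset.univ Finset.univ_nonempty

/-- JBT-`d` with update period `T`. -/
def JBT [NeZero N] (d T : ℕ) (hd : d ≤ N) : Policy N :=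
  thresholdPolicy d T hd uniformChoice

/-- JBTG-`d` with update period `T`, for servers with rates `μ`. -/
def JBTG [NeZero N] (μ : Fin N → ℝ) (hμ : ∀ n, 0 < μ n) (d T : ℕ) (hd : d ≤ N) : Policy N :=
  thresholdPolicy d T hd (weightedChoice μ hμ)

end LoadBalancing

end

open MeasureTheory Filter Topology
open scoped ENNReal

noncomputable section

namespace LoadBalancing

/-! With equal rates the rate-weighted choice is the uniform one, so JBT is literally the same
policy as JBTG (`JBT_eq_JBTG`), and only JBTG needs an analysis. The chain is observed just before
the memory is refreshed (`Policy.preStep`): one step from there averages over the sampling, and this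
average is what is strictly tilted in an update slot.

Tilt. After a refreshing the stored IDs are exactly the servers whose queue does not exceed the
threshold, because a queue grows only if its server is chosen, and then its ID is removed. A
rate-weighted choice from such a lower level set favours short queues (`isTilted_weightedChoice`).
Up to equivalence in inner product, `δ`-tilt follows from one scalar inequality: the mean queue met
by an arrival lies below the rate-weighted average by `δ` times the difference of the longest and
the shortest queue (`deltaTiltedUpToEquiv_of_ev_le`). In update slots it is proved level by level
(`ev_update_layer_le`): an arrival joins a queue longer than `l` only if all `d` sampled queues are
longer than `l`, and `min_le_mul_one_sub_choose_div` bounds the gain.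

Stability. Weak tilt in every slot gives the norm of the queue vector a negative drift far from the
origin, for every `ε > 0` (`exists_drift_norm`). As increments are bounded, exponential moments are
bounded uniformly in time. This yields throughput optimality by Markov's inequality, and tightness,
hence a stationary law as a limit of time averages (`exists_stationary`). Uniqueness is not needed:
the drift conditions bound the moments of every stationary law (`mean_le_of_stationary`).

Heavy traffic. The strict tilt at updates contracts the imbalance of the queues at a rate that does
not vanish with `ε`, so the stationary imbalance has a second moment bounded uniformly in `ε`
(`exists_drift_imbalance`, `exists_mean_imbalance_le`). Stationarity of the square of the total
workload expresses `ε` times its mean by the second moments of the inputs, up to a term of order `ε`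
and the mean of workload after the slot times idle capacity (`mean_idle_and_balance`). Idle capacity
has mean `ε` and is bounded, and it occurs only at queues that end the slot empty, where the
workload is controlled by the imbalance; so the cross term is of order `√ε` (`jbtg_workload`). In
the pooled system it vanishes (`pooled_workload`). Both limits are therefore half the sum of the
limiting arrival variance and the variance of the total service. -/

/-! ### Expectations under a `PMF` -/

section Expectations

variable {α β : Type*}

/-- Expectation of a function with values in `[0, ∞]`. -/
def mean (p : PMF α) (f : α → ℝ≥0∞) : ℝ≥0∞ := ∑' z, p z * f z

/-- Expectation of a real function; used for laws with finite support. -/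
def ev (p : PMF α) (f : α → ℝ) : ℝ := ∑' z, (p z).toReal * f z

lemma mean_pure (x : α) (f : α → ℝ≥0∞) : mean (PMF.pure x) f = f x := by
  rw [mean, tsum_eq_single x]
  · simp
  · intro y hy
    simp [hy]

lemma mean_bind (p : PMF α) (k : α → PMF β) (f : β → ℝ≥0∞) :
    mean (p.bind k) f = mean p fun x => mean (k x) f := by
  simp only [mean, PMF.bind_apply, ← ENNReal.tsum_mul_right, ← ENNReal.tsum_mul_left]
  rw [ENNReal.tsum_comm]
  simp only [mul_assoc]

lemma mean_map (p : PMF α) (g : α → β) (f : β → ℝ≥0∞) :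
    mean (p.map g) f = mean p fun x => f (g x) := by
  rw [← PMF.bind_pure_comp, mean_bind]
  simp only [Function.comp, mean_pure]

lemma mean_add (p : PMF α) (f g : α → ℝ≥0∞) :
    mean p (fun z => f z + g z) = mean p f + mean p g := by
  simp only [mean, mul_add, ENNReal.tsum_add]

lemma mean_const_mul (p : PMF α) (c : ℝ≥0∞) (f : α → ℝ≥0∞) :
    mean p (fun z => c * f z) = c * mean p f := by
  simp only [mean, ← ENNReal.tsum_mul_left]
  exact tsum_congr fun _ => by ring

lemma mean_mul_const (p : PMF α) (c : ℝ≥0∞) (f : α → ℝ≥0∞) :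
    mean p (fun z => f z * c) = mean p f * c := by
  simp only [mul_comm _ c, mean_const_mul]

lemma mean_const (p : PMF α) (c : ℝ≥0∞) : mean p (fun _ => c) = c := by
  simp only [mean, ENNReal.tsum_mul_right, PMF.tsum_coe, one_mul]

lemma mean_mono {p : PMF α} {f g : α → ℝ≥0∞} (h : ∀ z ∈ p.support, f z ≤ g z) :
    mean p f ≤ mean p g := by
  refine ENNReal.tsum_le_tsum fun z => ?_
  by_cases hz : p z = 0
  · simp [hz]
  · exact mul_le_mul_right (h z hz) _

lemma mean_congr {p : PMF α} {f g : α → ℝ≥0∞} (h : ∀ z ∈ p.support, f z = g z) :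
    mean p f = mean p g :=
  le_antisymm (mean_mono fun z hz => (h z hz).le) (mean_mono fun z hz => (h z hz).ge)

lemma mean_le_const {p : PMF α} {f : α → ℝ≥0∞} {c : ℝ≥0∞} (h : ∀ z ∈ p.support, f z ≤ c) :
    mean p f ≤ c :=
  (mean_mono h).trans (mean_const p c).le

lemma lintegral_toMeasure_eq_mean [MeasurableSpace α] [Countable α] [MeasurableSingletonClass α]
    (p : PMF α) (f : α → ℝ≥0∞) : ∫⁻ x, f x ∂p.toMeasure = mean p f := by
  rw [lintegral_countable']
  refine tsum_congr fun z => ?_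
  rw [PMF.toMeasure_apply_singleton _ _ (measurableSet_singleton z), mul_comm]

lemma toMeasure_mul_le_mean [MeasurableSpace α] [Countable α] [MeasurableSingletonClass α]
    (p : PMF α) (f : α → ℝ≥0∞) (s : Set α) (c : ℝ≥0∞) (h : ∀ z ∈ s, c ≤ f z) :
    c * p.toMeasure s ≤ mean p f := by
  rw [← lintegral_toMeasure_eq_mean, ← setLIntegral_const]
  refine (setLIntegral_mono' (Set.to_countable s).measurableSet fun z hz => h z hz).trans ?_
  exact setLIntegral_le_lintegral _ _

lemma summable_ev {p : PMF α} (hp : p.support.Finite) (f : α → ℝ) :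
    Summable fun z => (p z).toReal * f z := by
  refine summable_of_hasFiniteSupport (hp.subset fun z hz => ?_)
  rw [Function.mem_support] at hz
  rw [PMF.mem_support_iff]
  rintro h
  simp [h] at hz

lemma ev_add {p : PMF α} (hp : p.support.Finite) (f g : α → ℝ) :
    ev p (fun z => f z + g z) = ev p f + ev p g := by
  simp only [ev, mul_add]
  exact (summable_ev hp f).tsum_add (summable_ev hp g)

lemma ev_sub {p : PMF α} (hp : p.support.Finite) (f g : α → ℝ) :
    ev p (fun z => f z - g z) = ev p f - ev p g := by
  simp only [ev, mul_sub]
  exact (summable_ev hp f).tsum_sub (summable_ev hp g)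

lemma ev_const_mul (p : PMF α) (c : ℝ) (f : α → ℝ) :
    ev p (fun z => c * f z) = c * ev p f := by
  simp only [ev, ← tsum_mul_left]
  exact tsum_congr fun _ => by ring

lemma ev_mul_const (p : PMF α) (c : ℝ) (f : α → ℝ) :
    ev p (fun z => f z * c) = ev p f * c := by
  simp only [mul_comm _ c, ev_const_mul]

lemma tsum_toReal_eq_one (p : PMF α) : ∑' z, (p z).toReal = 1 := by
  rw [← ENNReal.tsum_toReal_eq (fun z => p.apply_ne_top z), PMF.tsum_coe, ENNReal.toReal_one]

lemma ev_const (p : PMF α) (c : ℝ) : ev p (fun _ => c) = c := by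
  simp only [ev, tsum_mul_right, tsum_toReal_eq_one, one_mul]

lemma ev_mono {p : PMF α} (hp : p.support.Finite) {f g : α → ℝ}
    (h : ∀ z ∈ p.support, f z ≤ g z) : ev p f ≤ ev p g := by
  refine (summable_ev hp f).tsum_le_tsum (fun z => ?_) (summable_ev hp g)
  by_cases hz : p z = 0
  · simp [hz]
  · exact mul_le_mul_of_nonneg_left (h z hz) ENNReal.toReal_nonneg

lemma ev_congr {p : PMF α} {f g : α → ℝ} (h : ∀ z ∈ p.support, f z = g z) : ev p f = ev p g := by
  refine tsum_congr fun z => ?_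
  by_cases hz : p z = 0
  · simp [hz]
  · rw [h z hz]

lemma ev_sum {ι : Type*} {p : PMF α} (hp : p.support.Finite) (s : Finset ι) (f : ι → α → ℝ) :
    ev p (fun z => ∑ i ∈ s, f i z) = ∑ i ∈ s, ev p (f i) := by
  simp only [ev, Finset.mul_sum]
  exact Summable.tsum_finsetSum fun _ _ => summable_ev hp _

lemma ev_pure (x : α) (f : α → ℝ) : ev (PMF.pure x) f = f x := by
  rw [ev, tsum_eq_single x]
  · simp
  · intro y hy
    simp [hy]

lemma ev_eq_sum [Fintype α] (p : PMF α) (f : α → ℝ) : ev p f = ∑ z, (p z).toReal * f z :=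
  tsum_fintype _

lemma finite_support_bind {p : PMF α} {k : α → PMF β} (hp : p.support.Finite)
    (hk : ∀ x ∈ p.support, (k x).support.Finite) : (p.bind k).support.Finite := by
  rw [PMF.support_bind]
  exact hp.biUnion hk

lemma finite_support_pure (x : α) : (PMF.pure x).support.Finite := by
  rw [PMF.support_pure]
  exact Set.finite_singleton x

lemma finite_support_map {p : PMF α} (hp : p.support.Finite) (g : α → β) :
    (p.map g).support.Finite := by
  rw [PMF.support_map]
  exact hp.image g

lemma ev_bind {p : PMF α} {k : α → PMF β} (hp : p.support.Finite)
    (hk : ∀ x ∈ p.support, (k x).support.Finite) (f : β → ℝ) :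
    ev (p.bind k) f = ev p fun x => ev (k x) f := by
  have key : ∀ g : α → ℝ, ∑' x, (p x).toReal * g x = ∑ x ∈ hp.toFinset, (p x).toReal * g x := by
    intro g
    refine tsum_eq_sum fun x hx => ?_
    have : p x = 0 := by simpa [PMF.mem_support_iff] using hx
    simp [this]
  simp only [ev, PMF.bind_apply]
  rw [key]
  have h1 : ∀ z, (∑' x, p x * k x z).toReal * f z
      = ∑ x ∈ hp.toFinset, (p x).toReal * ((k x z).toReal * f z) := by
    intro z
    rw [ENNReal.tsum_toReal_eq
      (fun x => ENNReal.mul_ne_top (p.apply_ne_top x) ((k x).apply_ne_top z))]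
    simp only [ENNReal.toReal_mul]
    rw [key, Finset.sum_mul]
    exact Finset.sum_congr rfl fun x _ => by ring
  simp only [h1]
  rw [Summable.tsum_finsetSum]
  · exact Finset.sum_congr rfl fun x _ => tsum_mul_left
  · intro x hx
    exact (summable_ev (hk x (hp.mem_toFinset.1 hx)) f).mul_left _

lemma ev_map {p : PMF α} (hp : p.support.Finite) (g : α → β) (f : β → ℝ) :
    ev (p.map g) f = ev p fun x => f (g x) := by
  rw [← PMF.bind_pure_comp, ev_bind (k := PMF.pure ∘ g) hp fun x _ => finite_support_pure _]
  simp only [Function.comp, ev_pure]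

lemma ofReal_ev {p : PMF α} (hp : p.support.Finite) {f : α → ℝ} (hf : ∀ z, 0 ≤ f z) :
    ENNReal.ofReal (ev p f) = mean p fun z => ENNReal.ofReal (f z) := by
  rw [ev, ENNReal.ofReal_tsum_of_nonneg
    (fun z => mul_nonneg ENNReal.toReal_nonneg (hf z)) (summable_ev hp f)]
  refine tsum_congr fun z => ?_
  rw [ENNReal.ofReal_mul ENNReal.toReal_nonneg, ENNReal.ofReal_toReal (p.apply_ne_top z)]

lemma integral_toMeasure_eq_ev [MeasurableSpace α] [MeasurableSingletonClass α]
    {p : PMF α} (hp : p.support.Finite) (f : α → ℝ) : ∫ x, f x ∂p.toMeasure = ev p f := by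
  have hi : Integrable f p.toMeasure := by
    rw [← PMF.restrict_toMeasure_support p]
    exact IntegrableOn.of_finite hp
  rw [PMF.integral_eq_tsum p f hi]
  rfl

end Expectations

/-! ### Markov chains: drift conditions and stationary laws -/

section Chains

variable {α : Type*}

lemma support_subset_of_recursion {κ : α → PMF α} {p : ℕ → PMF α} {G : Set α}
    (hp : ∀ t, p (t + 1) = (p t).bind κ) (h0 : (p 0).support ⊆ G)
    (hG : ∀ z ∈ G, (κ z).support ⊆ G) (t : ℕ) : (p t).support ⊆ G := by
  induction t with
  | zero => exact h0
  | succ t ih =>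
    rw [hp, PMF.support_bind]
    exact Set.iUnion₂_subset fun z hz => hG z (ih hz)

lemma mean_le_of_recursion {κ : α → PMF α} {p : ℕ → PMF α} {G : Set α} {V : α → ℝ≥0∞}
    {r b M : ℝ≥0∞} (hp : ∀ t, p (t + 1) = (p t).bind κ) (h0 : (p 0).support ⊆ G)
    (hG : ∀ z ∈ G, (κ z).support ⊆ G) (hV : ∀ z ∈ G, mean (κ z) V ≤ r * V z + b)
    (hM : r * M + b ≤ M) (hM0 : mean (p 0) V ≤ M) (t : ℕ) : mean (p t) V ≤ M := by
  induction t with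
  | zero => exact hM0
  | succ t ih =>
    rw [hp, mean_bind]
    refine (mean_mono fun z hz => hV z (support_subset_of_recursion hp h0 hG t hz)).trans ?_
    rw [mean_add, mean_const_mul, mean_const]
    exact (by gcongr : r * mean (p t) V + b ≤ r * M + b).trans hM

/-- Dominated convergence with the constant `n` as majorant; truncating makes it independent of
whether `V` is integrable. -/
lemma tendsto_mean_min_zero (ν : PMF α) {V : α → ℝ≥0∞} (hV : ∀ z, V z ≠ ⊤) {r : ℝ≥0∞}
    (hr : r < 1) (n : ℕ) :
    Tendsto (fun m : ℕ => mean ν fun z => min (r ^ m * V z) n) atTop (𝓝 0) := by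
  let _ : MeasurableSpace α := ⊤
  have key : ∀ f : α → ℝ≥0∞, mean ν f = ∫⁻ z, ν z * f z ∂Measure.count := by
    intro f
    rw [lintegral_count, mean]
  simp only [key]
  have h0 : (∫⁻ _ : α, (0 : ℝ≥0∞) ∂Measure.count) = 0 := lintegral_zero
  rw [← h0]
  refine tendsto_lintegral_of_dominated_convergence (fun z => ν z * n)
    (fun m => measurable_from_top) (fun m => ae_of_all _ fun z => ?_) ?_
    (ae_of_all _ fun z => ?_)
  · exact mul_le_mul_right (min_le_right _ _) _
  · rw [lintegral_count, ENNReal.tsum_mul_right, PMF.tsum_coe]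
    simp
  · have h1 : Tendsto (fun m : ℕ => r ^ m * V z) atTop (𝓝 (0 * V z)) :=
      ENNReal.Tendsto.mul_const (ENNReal.tendsto_pow_atTop_nhds_zero_of_lt_one hr)
        (Or.inr (hV z))
    have h2 : Tendsto (fun m : ℕ => min (r ^ m * V z) n) atTop (𝓝 (min (0 * V z) n)) :=
      h1.min tendsto_const_nhds
    rw [zero_mul, min_eq_left zero_le] at h2
    have h3 := ENNReal.Tendsto.const_mul (a := ν z) h2 (Or.inr (ν.apply_ne_top z))
    rwa [mul_zero] at h3

/-- A stationary law integrates a Foster–Lyapunov function with geometric drift. -/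
lemma mean_le_of_stationary {κ : α → PMF α} {ν : PMF α} (hν : ν.bind κ = ν)
    {V : α → ℝ≥0∞} (hVtop : ∀ z, V z ≠ ⊤) {r b : ℝ≥0∞} (hr : r < 1)
    (hV : ∀ z ∈ ν.support, mean (κ z) V ≤ r * V z + b) : mean ν V ≤ (1 - r)⁻¹ * b := by
  set C := (1 - r)⁻¹ * b with hC
  have hstep : ∀ f : α → ℝ≥0∞, mean ν f = mean ν fun z => mean (κ z) f := by
    intro f
    conv_lhs => rw [← hν]
    rw [mean_bind]
  have hsum : ∀ m, (∑ i ∈ Finset.range m, r ^ i) * b ≤ C := by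
    intro m
    rw [hC, ← ENNReal.tsum_geometric]
    gcongr
    exact ENNReal.sum_le_tsum _
  -- `mean ν V` might be infinite and then could not be cancelled in `mean ν V ≤ r * mean ν V + b`.
  -- The drift is therefore iterated `m` times under the truncation at `n`; `m → ∞` removes the
  -- initial term, and `n` is sent to infinity last.
  have hmin : ∀ n m : ℕ, mean ν (fun z => min (V z) n) ≤
      mean ν fun z => min (r ^ m * V z + (∑ i ∈ Finset.range m, r ^ i) * b) n := by
    intro n m
    induction m with
    | zero => simp
    | succ m ih =>
      refine ih.trans ?_
      rw [hstep]
      refine mean_mono fun z hz => le_min ?_ (mean_le_const fun _ _ => min_le_right _ _)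
      refine (mean_mono fun _ _ => min_le_left _ _).trans ?_
      rw [mean_add, mean_const_mul, mean_const]
      refine (add_le_add_left (mul_le_mul_right (hV z hz) _) _).trans (le_of_eq ?_)
      rw [Finset.sum_range_succ]
      ring
  have hle : ∀ n : ℕ, mean ν (fun z => min (V z) n) ≤ C := by
    intro n
    have h1 : ∀ m : ℕ, mean ν (fun z => min (V z) n) ≤
        mean ν (fun z => min (r ^ m * V z) n) + C := by
      intro m
      refine (hmin n m).trans ?_
      rw [← mean_const ν C, ← mean_add]
      refine mean_mono fun z _ => ?_
      rw [min_le_iff]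
      rcases le_total (r ^ m * V z) n with h | h
      · left
        rw [min_eq_left h]
        exact add_le_add_right (hsum m) _
      · right
        rw [min_eq_right h]
        exact le_self_add
    have h2 := (tendsto_mean_min_zero ν hVtop hr n).add_const C
    rw [zero_add] at h2
    exact ge_of_tendsto' h2 h1
  rw [mean, ENNReal.tsum_eq_iSup_sum]
  refine iSup_le fun F => ?_
  obtain ⟨n, hn⟩ : ∃ n : ℕ, ∀ z ∈ F, V z ≤ n := by
    obtain ⟨n, hn⟩ := ENNReal.exists_nat_gt (ENNReal.sum_ne_top.2 fun z _ => hVtop z : ∑ z ∈ F, V z ≠ ⊤)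
    exact ⟨n, fun z hz => (Finset.single_le_sum (fun _ _ => zero_le) hz).trans hn.le⟩
  refine le_trans ?_ (hle n)
  rw [mean]
  refine le_trans (Finset.sum_le_sum fun z hz => ?_) (ENNReal.sum_le_tsum F)
  rw [min_eq_left (hn z hz)]

/-- A bounded function that does not increase in mean, and decreases strictly off `G`, forces every
stationary law to be supported in `G`. -/
lemma support_subset_of_stationary {κ : α → PMF α} {ν : PMF α} (hν : ν.bind κ = ν)
    {h : α → ℝ≥0∞} (hh : ∀ z, h z ≤ 1) {G : Set α} (hG : ∀ z ∈ G, mean (κ z) h ≤ h z)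
    (hG' : ∀ z ∉ G, mean (κ z) h < h z) : ν.support ⊆ G := by
  intro z hz
  by_contra hzG
  have hstep : mean ν h = mean ν fun z => mean (κ z) h := by
    conv_lhs => rw [← hν]
    rw [mean_bind]
  have hle : ∀ y, mean (κ y) h ≤ h y := fun y => by
    by_cases hy : y ∈ G
    · exact hG y hy
    · exact (hG' y hy).le
  have hfin : mean ν (fun z => mean (κ z) h) ≠ ⊤ := by
    rw [← hstep]
    exact ne_top_of_le_ne_top ENNReal.one_ne_top (mean_le_const fun y _ => hh y)
  refine absurd hstep (ne_of_gt ?_)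
  refine ENNReal.tsum_lt_tsum hfin (fun y => mul_le_mul_right (hle y) _) (i := z) ?_
  exact (ENNReal.mul_lt_mul_iff_right ((PMF.mem_support_iff _ _).1 hz) (ν.apply_ne_top z)).2
    (hG' z hzG)

/-! ### Exponential moments from bounded increments and negative drift. -/

/-- Bounded increments and a negative drift above a level give a geometric drift of an
exponential. -/
lemma mean_exp_drift {p : PMF α} (hp : p.support.Finite) {W : α → ℝ} {w K c B : ℝ} (hc : 0 < c)
    (hcK : c ≤ K) (hjump : ∀ z ∈ p.support, |W z - w| ≤ K) (hdrift : B ≤ w → ev p W ≤ w - c) :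
    mean p (fun z => ENNReal.ofReal (Real.exp (c / (2 * K ^ 2) * W z))) ≤
      ENNReal.ofReal (1 - c ^ 2 / (4 * K ^ 2)) *
        ENNReal.ofReal (Real.exp (c / (2 * K ^ 2) * w)) +
        ENNReal.ofReal (Real.exp (c / (2 * K ^ 2) * (B + K))) := by
  have hK : 0 < K := hc.trans_le hcK
  -- By `exp x ≤ 1 + x + x ^ 2` for `|x| ≤ 1`, the exponential contracts by the factor `1 - θ * c +
  -- θ ^ 2 * K ^ 2`; this `θ` minimizes it, and the minimum is `1 - c ^ 2 / (4 * K ^ 2)`.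
  set θ := c / (2 * K ^ 2) with hθ
  have hθ0 : 0 < θ := by positivity
  have hθK : θ * K ≤ 1 := by
    rw [hθ, div_mul_eq_mul_div, div_le_one (by positivity)]
    nlinarith
  have hr : 0 ≤ 1 - c ^ 2 / (4 * K ^ 2) := by
    rw [sub_nonneg, div_le_one (by positivity)]
    nlinarith
  have hrθ : 1 - c ^ 2 / (4 * K ^ 2) = 1 - θ * c + θ ^ 2 * K ^ 2 := by
    rw [hθ]
    field_simp
    ring
  rw [← ofReal_ev hp fun z => (Real.exp_pos _).le, ← ENNReal.ofReal_mul hr,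
    ← ENNReal.ofReal_add (by positivity) (by positivity)]
  refine ENNReal.ofReal_le_ofReal ?_
  by_cases hB : B ≤ w
  · have h1 : ∀ z ∈ p.support, Real.exp (θ * W z) ≤
        Real.exp (θ * w) * θ * W z + Real.exp (θ * w) * (1 - θ * w + θ ^ 2 * K ^ 2) := by
      intro z hz
      have hz' := hjump z hz
      have h2 : |θ * (W z - w)| ≤ 1 := by
        rw [abs_mul, abs_of_pos hθ0]
        exact (mul_le_mul_of_nonneg_left hz' hθ0.le).trans hθK
      have h3 := (abs_le.1 (Real.abs_exp_sub_one_sub_id_le h2)).2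
      have h4 : (θ * (W z - w)) ^ 2 ≤ θ ^ 2 * K ^ 2 := by
        rw [mul_pow]
        exact mul_le_mul_of_nonneg_left (sq_le_sq.2 (hz'.trans (le_abs_self K))) (sq_nonneg θ)
      have h5 : Real.exp (θ * W z) = Real.exp (θ * w) * Real.exp (θ * (W z - w)) := by
        rw [← Real.exp_add]
        ring_nf
      rw [h5]
      nlinarith [Real.exp_pos (θ * w)]
    have h2 := ev_mono hp h1
    rw [ev_add hp, ev_const_mul, ev_const] at h2
    refine h2.trans ?_
    rw [hrθ]
    have h3 := mul_le_mul_of_nonneg_left (hdrift hB)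
      (by positivity : 0 ≤ Real.exp (θ * w) * θ)
    have h4 := Real.exp_pos (θ * (B + K))
    nlinarith
  · have h1 : ∀ z ∈ p.support, Real.exp (θ * W z) ≤ Real.exp (θ * (B + K)) := by
      intro z hz
      have := (abs_le.1 (hjump z hz)).2
      refine Real.exp_le_exp.2 (mul_le_mul_of_nonneg_left ?_ hθ0.le)
      linarith [not_le.1 hB]
    have h2 := ev_mono hp h1
    rw [ev_const] at h2
    have : 0 ≤ (1 - c ^ 2 / (4 * K ^ 2)) * Real.exp (θ * w) := by positivity
    linarith

/-- Stationary exponential moment under the conditions of `mean_exp_drift`. -/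
lemma mean_exp_le_of_stationary {κ : α → PMF α} {ν : PMF α} (hν : ν.bind κ = ν) {W : α → ℝ}
    {K c B : ℝ} (hc : 0 < c) (hcK : c ≤ K) (hfin : ∀ z ∈ ν.support, (κ z).support.Finite)
    (hjump : ∀ z ∈ ν.support, ∀ z' ∈ (κ z).support, |W z' - W z| ≤ K)
    (hdrift : ∀ z ∈ ν.support, B ≤ W z → ev (κ z) W ≤ W z - c) :
    mean ν (fun z => ENNReal.ofReal (Real.exp (c / (2 * K ^ 2) * W z))) ≤
      (1 - ENNReal.ofReal (1 - c ^ 2 / (4 * K ^ 2)))⁻¹ *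
        ENNReal.ofReal (Real.exp (c / (2 * K ^ 2) * (B + K))) := by
  have hK : 0 < K := hc.trans_le hcK
  refine mean_le_of_stationary hν (fun z => ENNReal.ofReal_ne_top) ?_ fun z hz =>
    mean_exp_drift (hfin z hz) hc hcK (hjump z hz) (hdrift z hz)
  rw [← ENNReal.ofReal_one, ENNReal.ofReal_lt_ofReal_iff one_pos]
  have : 0 < c ^ 2 / (4 * K ^ 2) := by positivity
  linarith

lemma exp_bound_ne_top {c K : ℝ} (hc : 0 < c) (hcK : c ≤ K) (x : ℝ) :
    (1 - ENNReal.ofReal (1 - c ^ 2 / (4 * K ^ 2)))⁻¹ * ENNReal.ofReal x ≠ ⊤ := by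
  have hK : 0 < K := hc.trans_le hcK
  refine ENNReal.mul_ne_top (ENNReal.inv_ne_top.2 ?_) ENNReal.ofReal_ne_top
  rw [Ne, tsub_eq_zero_iff_le, not_le, ← ENNReal.ofReal_one, ENNReal.ofReal_lt_ofReal_iff one_pos]
  have : 0 < c ^ 2 / (4 * K ^ 2) := by positivity
  linarith

/-- Exponential moments of a chain, uniformly in time, under the conditions of `mean_exp_drift`. -/
lemma exists_mean_exp_le_of_recursion {κ : α → PMF α} {p : ℕ → PMF α} {G : Set α} {z₀ : α}
    (hp : ∀ t, p (t + 1) = (p t).bind κ) (h0 : p 0 = PMF.pure z₀) (hz₀ : z₀ ∈ G)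
    (hG : ∀ z ∈ G, (κ z).support ⊆ G) {W : α → ℝ}
    {K c B : ℝ} (hc : 0 < c) (hcK : c ≤ K) (hfin : ∀ z ∈ G, (κ z).support.Finite)
    (hjump : ∀ z ∈ G, ∀ z' ∈ (κ z).support, |W z' - W z| ≤ K)
    (hdrift : ∀ z ∈ G, B ≤ W z → ev (κ z) W ≤ W z - c) :
    ∃ M : ℝ≥0∞, M ≠ ⊤ ∧
      ∀ t, mean (p t) (fun z => ENNReal.ofReal (Real.exp (c / (2 * K ^ 2) * W z))) ≤ M := by
  have hK : 0 < K := hc.trans_le hcK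
  have hr : 0 ≤ 1 - c ^ 2 / (4 * K ^ 2) := by
    rw [sub_nonneg, div_le_one (by positivity)]
    nlinarith
  set b := Real.exp (c / (2 * K ^ 2) * (B + K))
  set v := Real.exp (c / (2 * K ^ 2) * W z₀)
  have hb : 0 < b := Real.exp_pos _
  have hv : 0 < v := Real.exp_pos _
  set x := c ^ 2 / (4 * K ^ 2)
  have hx : 0 < x := by positivity
  -- This level lies above the initial value `v` and above the fixed point `b / x` of `M ↦ (1 - x) *
  -- M + b`, so the recursion never exceeds it.
  refine ⟨ENNReal.ofReal (v + b / x), ENNReal.ofReal_ne_top, fun t => ?_⟩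
  refine mean_le_of_recursion hp (by rw [h0, PMF.support_pure]; simpa using hz₀) hG
    (fun z hz => mean_exp_drift (hfin z hz) hc hcK (hjump z hz) (hdrift z hz)) ?_ ?_ t
  · rw [← ENNReal.ofReal_mul hr, ← ENNReal.ofReal_add (by positivity) hb.le]
    refine ENNReal.ofReal_le_ofReal ?_
    have : x * (b / x) = b := by field_simp
    nlinarith [mul_pos hx hv]
  · rw [h0, mean_pure]
    refine ENNReal.ofReal_le_ofReal ?_
    have : 0 < b / x := by positivity
    linarith

/-! ### Existence of stationary laws. -/

/-- Existence of a stationary law for a chain whose laws keep a function with finite sublevel sets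
bounded in mean. -/
lemma exists_stationary {κ : α → PMF α} {p : ℕ → PMF α} (hp : ∀ t, p (t + 1) = (p t).bind κ)
    {V : α → ℝ≥0∞} {M : ℝ≥0∞} (hM : M ≠ ⊤) (hV : ∀ t, mean (p t) V ≤ M)
    (hfin : ∀ n : ℕ, {z | V z ≤ n}.Finite) : ∃ ν : PMF α, ν.bind κ = ν := by
  classical
  -- Krylov–Bogoliubov: time averages of the laws are passed to the limit along an ultrafilter,
  -- which gives pointwise limits at all states at once without choosing subsequences.
  let U : Ultrafilter ℕ := hyperfilter ℕ
  let P : ℕ → α → ℝ≥0∞ := fun n z => (n + 1 : ℝ≥0∞)⁻¹ * ∑ t ∈ Finset.range (n + 1), p t z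
  have hn0 : ∀ n : ℕ, (n + 1 : ℝ≥0∞) ≠ 0 := fun n => by simp
  have hnt : ∀ n : ℕ, (n + 1 : ℝ≥0∞) ≠ ⊤ := fun n => by finiteness
  have hlim : ∀ z, ∃ x, Tendsto (fun n => P n z) U (𝓝 x) := by
    intro z
    obtain ⟨x, -, hx⟩ := isCompact_univ.ultrafilter_le_nhds (U.map fun n => P n z) (by simp)
    exact ⟨x, hx⟩
  choose w hw using hlim
  have hinv : Tendsto (fun n : ℕ => (n + 1 : ℝ≥0∞)⁻¹) U (𝓝 0) := by
    have h1 : Tendsto (fun n : ℕ => ((n + 1 : ℕ) : ℝ≥0∞)⁻¹) atTop (𝓝 0) :=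
      ENNReal.tendsto_inv_nat_nhds_zero.comp (tendsto_add_atTop_nat 1)
    push_cast at h1
    exact h1.mono_left (Nat.hyperfilter_le_atTop)
  have hsumF : ∀ (F : Finset α) (f : α → ℝ≥0∞), (∀ z, f z ≠ ⊤) →
      Tendsto (fun n => ∑ z ∈ F, P n z * f z) U (𝓝 (∑ z ∈ F, w z * f z)) := fun F f hf =>
    tendsto_finsetSum F fun z _ => ENNReal.Tendsto.mul_const (hw z) (Or.inr (hf z))
  have hPtsum : ∀ (n : ℕ) (f : α → ℝ≥0∞), ∑' z, P n z * f z =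
      (n + 1 : ℝ≥0∞)⁻¹ * ∑ t ∈ Finset.range (n + 1), mean (p t) f := by
    intro n f
    simp only [P, mean, mul_assoc, Finset.sum_mul]
    rw [ENNReal.tsum_mul_left, Summable.tsum_finsetSum fun _ _ => ENNReal.summable]
  have hPavg : ∀ (n : ℕ) (f : α → ℝ≥0∞) (c : ℝ≥0∞), (∀ t, mean (p t) f ≤ c) →
      ∑' z, P n z * f z ≤ c := by
    intro n f c hc
    rw [hPtsum]
    calc _ ≤ (n + 1 : ℝ≥0∞)⁻¹ * ∑ t ∈ Finset.range (n + 1), c := by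
          gcongr with t _
          exact hc t
      _ = c := by
          rw [Finset.sum_const, Finset.card_range, nsmul_eq_mul, ← mul_assoc, Nat.cast_add,
            Nat.cast_one, ENNReal.inv_mul_cancel (hn0 n) (hnt n), one_mul]
  have hPone : ∀ n, ∑' z, P n z = 1 := by
    intro n
    have h1 := hPtsum n fun _ => 1
    simp only [mul_one, mean_const, Finset.sum_const, Finset.card_range, nsmul_eq_mul,
      Nat.cast_add, Nat.cast_one] at h1
    rw [h1, ENNReal.inv_mul_cancel (hn0 n) (hnt n)]
  have hle : ∑' z, w z ≤ 1 := by
    rw [ENNReal.tsum_eq_iSup_sum]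
    refine iSup_le fun F => ?_
    have h1 := hsumF F (fun _ => 1) fun _ => ENNReal.one_ne_top
    simp only [mul_one] at h1
    exact le_of_tendsto' h1 fun n => (ENNReal.sum_le_tsum F).trans (hPone n).le
  -- Tightness: by Markov's inequality each time average puts mass at most `M / (m + 1)` outside the
  -- finite set `{V ≤ m + 1}`, so no mass escapes in the limit.
  have hge : 1 ≤ ∑' z, w z := by
    have key : ∀ m : ℕ, 1 ≤ ∑' z, w z + M * (m + 1 : ℝ≥0∞)⁻¹ := by
      intro m
      have hF := hfin (m + 1)
      have h1 := hsumF hF.toFinset (fun _ => 1) fun _ => ENNReal.one_ne_top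
      simp only [mul_one] at h1
      have h2 : ∀ n, 1 ≤ ∑ z ∈ hF.toFinset, P n z + M * (m + 1 : ℝ≥0∞)⁻¹ := by
        intro n
        have h3 : ∀ z, P n z ≤ (if z ∈ hF.toFinset then P n z else 0) +
            P n z * V z * (m + 1 : ℝ≥0∞)⁻¹ := by
          intro z
          split_ifs with hz
          · exact le_self_add
          · rw [zero_add, mul_assoc]
            have h4 : ((m + 1 : ℕ) : ℝ≥0∞) ≤ V z := by
              have : ¬ V z ≤ ((m + 1 : ℕ) : ℝ≥0∞) := by simpa using hz
              exact (not_le.1 this).le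
            have h5 : 1 ≤ V z * (m + 1 : ℝ≥0∞)⁻¹ := by
              rw [← div_eq_mul_inv, ENNReal.le_div_iff_mul_le (Or.inl (hn0 m)) (Or.inl (hnt m)),
                one_mul]
              exact_mod_cast h4
            exact le_mul_of_one_le_right zero_le h5
        calc (1 : ℝ≥0∞) = ∑' z, P n z := (hPone n).symm
          _ ≤ _ := ENNReal.tsum_le_tsum h3
          _ ≤ _ := by
            rw [ENNReal.tsum_add, ENNReal.tsum_mul_right]
            refine add_le_add (le_of_eq ?_) (mul_le_mul_left (hPavg n V M hV) _)
            rw [tsum_eq_sum (s := hF.toFinset) fun z hz => by simp only [hz, if_false]]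
            exact Finset.sum_congr rfl fun z hz => by simp only [hz, if_true]
      refine (ge_of_tendsto' (h1.add_const _) h2).trans ?_
      gcongr
      exact ENNReal.sum_le_tsum _
    have h1 : Tendsto (fun m : ℕ => ∑' z, w z + M * (m + 1 : ℝ≥0∞)⁻¹) U
        (𝓝 (∑' z, w z + M * 0)) :=
      tendsto_const_nhds.add (ENNReal.Tendsto.const_mul hinv (Or.inr hM))
    rw [mul_zero, add_zero] at h1
    exact ge_of_tendsto' h1 key
  have hsum : ∑' z, w z = 1 := le_antisymm hle hge
  let ν : PMF α := ⟨w, hsum ▸ ENNReal.summable.hasSum⟩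
  -- Limits commute only with finite sums, so only subinvariance is obtained directly. Since both
  -- sides have total mass one, it forces equality.
  have hκle : ∀ y, (ν.bind κ) y ≤ ν y := by
    intro y
    rw [PMF.bind_apply, ENNReal.tsum_eq_iSup_sum]
    refine iSup_le fun F => ?_
    have h1 := hsumF F (fun z => κ z y) fun z => (κ z).apply_ne_top y
    have h2 : ∀ n, ∑ z ∈ F, P n z * κ z y ≤ P n y + (n + 1 : ℝ≥0∞)⁻¹ := by
      intro n
      refine (ENNReal.sum_le_tsum F).trans ?_
      rw [hPtsum]
      have h3 : ∀ t, mean (p t) (fun z => κ z y) = p (t + 1) y := by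
        intro t
        rw [hp, PMF.bind_apply, mean]
      simp only [h3, P]
      rw [← mul_add_one]
      gcongr
      rw [Finset.sum_range_succ]
      refine add_le_add ?_ (PMF.coe_le_one _ _)
      rw [Finset.sum_range_succ']
      exact le_self_add
    have h3 := (hw y).add hinv
    rw [add_zero] at h3
    exact le_of_tendsto_of_tendsto' h1 h3 h2
  refine ⟨ν, PMF.ext fun y => ?_⟩
  by_contra hne
  have hlt : (ν.bind κ) y < ν y := lt_of_le_of_ne (hκle y) hne
  have h1 : ∑' z, (ν.bind κ) z < ∑' z, ν z :=
    ENNReal.tsum_lt_tsum (by rw [PMF.tsum_coe]; exact ENNReal.one_ne_top) hκle hlt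
  rw [PMF.tsum_coe, PMF.tsum_coe] at h1
  exact lt_irrefl _ h1

end Chains

variable {N : ℕ}

/-! ### Arrivals and services -/

section Inputs

lemma ArrivalLaw.finite_support {lam : ℝ} {Amax : ℕ} {a : PMF ℕ} (ha : ArrivalLaw lam Amax a) :
    a.support.Finite :=
  (Set.finite_Iic Amax).subset fun k hk => ha.1 k hk

lemma ArrivalLaw.ev_eq {lam : ℝ} {Amax : ℕ} {a : PMF ℕ} (ha : ArrivalLaw lam Amax a) :
    ev a (fun k => (k : ℝ)) = lam := by
  rw [← integral_toMeasure_eq_ev ha.finite_support, ha.2]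

lemma ev_nonneg {α : Type*} (p : PMF α) {f : α → ℝ} (hf : ∀ z, 0 ≤ f z) : 0 ≤ ev p f :=
  tsum_nonneg fun z => mul_nonneg ENNReal.toReal_nonneg (hf z)

lemma ArrivalLaw.nonneg {lam : ℝ} {Amax : ℕ} {a : PMF ℕ} (ha : ArrivalLaw lam Amax a) :
    0 ≤ lam := by
  rw [← ha.ev_eq]
  exact ev_nonneg _ fun k => k.cast_nonneg

lemma ofReal_ev_natCast {α : Type*} {p : PMF α} (hp : p.support.Finite) (f : α → ℕ) :
    ENNReal.ofReal (ev p fun z => (f z : ℝ)) = mean p fun z => (f z : ℝ≥0∞) := by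
  rw [ofReal_ev hp fun z => (f z).cast_nonneg]
  simp only [ENNReal.ofReal_natCast]

lemma ArrivalLaw.mean_eq {lam : ℝ} {Amax : ℕ} {a : PMF ℕ} (ha : ArrivalLaw lam Amax a) :
    mean a (fun k => (k : ℝ≥0∞)) = ENNReal.ofReal lam := by
  rw [← ha.ev_eq, ofReal_ev_natCast ha.finite_support]

lemma ArrivalLaw.ev_sq_eq {lam : ℝ} {Amax : ℕ} {a : PMF ℕ} (ha : ArrivalLaw lam Amax a) :
    ev a (fun k => ((k ^ 2 : ℕ) : ℝ)) =
      ProbabilityTheory.variance (fun k : ℕ => (k : ℝ)) a.toMeasure + lam ^ 2 := by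
  rw [ProbabilityTheory.variance_eq_integral Measurable.of_discrete.aemeasurable, ha.2,
    integral_toMeasure_eq_ev ha.finite_support]
  have h : ∀ k : ℕ, ((k : ℝ) - lam) ^ 2 = ((k ^ 2 : ℕ) : ℝ) - (2 * lam * k - lam ^ 2) := by
    intro k
    push_cast
    ring
  simp only [h]
  rw [ev_sub ha.finite_support, ev_sub ha.finite_support, ev_const_mul, ev_const, ha.ev_eq]
  ring

lemma serviceLaw_apply (s : Fin N → PMF ℕ) (S : Fin N → ℕ) :
    serviceLaw s S = ∏ n, s n (S n) := by
  rw [serviceLaw, Measure.toPMF_apply, Measure.pi_singleton]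
  exact Finset.prod_congr rfl fun n _ =>
    PMF.toMeasure_apply_singleton _ _ (measurableSet_singleton _)

lemma mem_support_of_mem_support_serviceLaw {s : Fin N → PMF ℕ} {S : Fin N → ℕ}
    (hS : S ∈ (serviceLaw s).support) (n : Fin N) : S n ∈ (s n).support := by
  rw [PMF.mem_support_iff, serviceLaw_apply, Finset.prod_ne_zero_iff] at hS
  exact (PMF.mem_support_iff _ _).2 (hS n (Finset.mem_univ n))

lemma map_serviceLaw (s : Fin N → PMF ℕ) (n : Fin N) :
    (serviceLaw s).map (fun S => S n) = s n := by
  apply PMF.toMeasure_injective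
  rw [← PMF.toMeasure_map (fun S : Fin N → ℕ => S n) (serviceLaw s) (measurable_pi_apply n), serviceLaw, Measure.toPMF_toMeasure]
  exact (measurePreserving_eval (fun n => (s n).toMeasure) n).map_eq

variable {s : Fin N → PMF ℕ} {μ : Fin N → ℝ} {Smax : ℕ}

lemma finite_support_serviceLaw (hb : ∀ n, ∀ k ∈ (s n).support, k ≤ Smax) :
    (serviceLaw s).support.Finite := by
  refine (Set.finite_Iic fun _ : Fin N => Smax).subset fun S hS n => ?_
  exact hb n _ (mem_support_of_mem_support_serviceLaw hS n)

lemma ev_serviceLaw (hb : ∀ n, ∀ k ∈ (s n).support, k ≤ Smax) (hs : ServiceLaws μ s) (n : Fin N) :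
    ev (serviceLaw s) (fun S => (S n : ℝ)) = μ n := by
  have hfin : (s n).support.Finite := (Set.finite_Iic Smax).subset fun k hk => hb n k hk
  rw [← hs.2 n, integral_toMeasure_eq_ev hfin, ← map_serviceLaw s n,
    ev_map (finite_support_serviceLaw hb)]

lemma ev_sum_serviceLaw (hb : ∀ n, ∀ k ∈ (s n).support, k ≤ Smax) (hs : ServiceLaws μ s) :
    ev (serviceLaw s) (fun S => ((∑ n, S n : ℕ) : ℝ)) = ∑ n, μ n := by
  push_cast
  rw [ev_sum (finite_support_serviceLaw hb)]
  exact Finset.sum_congr rfl fun n _ => ev_serviceLaw hb hs n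

lemma sum_service_le (hb : ∀ n, ∀ k ∈ (s n).support, k ≤ Smax) {S : Fin N → ℕ}
    (hS : S ∈ (serviceLaw s).support) : ∑ n, S n ≤ N * Smax := by
  refine (Finset.sum_le_card_nsmul _ _ Smax fun n _ =>
    hb n _ (mem_support_of_mem_support_serviceLaw hS n)).trans ?_
  simp

end Inputs

/-! ### One slot -/

section Slot

variable {π : Policy N} {a : PMF ℕ} {s : Fin N → PMF ℕ} {μ : Fin N → ℝ} {lam : ℝ}
  {Amax Smax : ℕ}

/-- Queue lengths after a slot in which `A` jobs join queue `i` and the offered services are `S`. -/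
def nextQueue (q : Fin N → ℕ) (i : Fin N) (A : ℕ) (S : Fin N → ℕ) : Fin N → ℕ :=
  fun n => q n + (if n = i then A else 0) - S n

lemma mem_support_slot {z z' : π.State} (h : z' ∈ (π.slot a s z).support) :
    ∃ i ∈ (π.dispatch z.1 z.2).support, ∃ A ∈ a.support, ∃ S ∈ (serviceLaw s).support,
      z' = (nextQueue z.1 i A S, π.afterDispatch z.2 i) := by
  simp only [Policy.slot, PMF.mem_support_bind_iff, PMF.support_pure,
    Set.mem_singleton_iff] at h
  obtain ⟨i, hi, A, hA, S, hS, h⟩ := h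
  exact ⟨i, hi, A, hA, S, hS, h⟩

lemma finite_support_slot (ha : ArrivalLaw lam Amax a)
    (hb : ∀ n, ∀ k ∈ (s n).support, k ≤ Smax) (z : π.State) : (π.slot a s z).support.Finite :=
  finite_support_bind (Set.toFinite _) fun _ _ => finite_support_bind ha.finite_support
    fun _ _ => finite_support_bind (finite_support_serviceLaw hb) fun _ _ => finite_support_pure _

lemma ev_slot (ha : ArrivalLaw lam Amax a) (hb : ∀ n, ∀ k ∈ (s n).support, k ≤ Smax)
    (z : π.State) (f : π.State → ℝ) :
    ev (π.slot a s z) f = ev (π.dispatch z.1 z.2) fun i => ev a fun A => ev (serviceLaw s) fun S =>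
      f (nextQueue z.1 i A S, π.afterDispatch z.2 i) := by
  have h3 : ∀ (i : Fin N) (A : ℕ), ∀ S ∈ (serviceLaw s).support,
      (PMF.pure (nextQueue z.1 i A S, π.afterDispatch z.2 i) : PMF π.State).support.Finite :=
    fun _ _ _ _ => finite_support_pure _
  have h2 := fun (i : Fin N) (A : ℕ) => finite_support_bind (finite_support_serviceLaw hb) (h3 i A)
  have h1 := fun (i : Fin N) => finite_support_bind (p := a) (k := fun A => (serviceLaw s).bind
    fun S => PMF.pure (nextQueue z.1 i A S, π.afterDispatch z.2 i)) ha.finite_support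
    fun A _ => h2 i A
  have h0 : π.slot a s z = (π.dispatch z.1 z.2).bind fun i => a.bind fun A =>
      (serviceLaw s).bind fun S => PMF.pure (nextQueue z.1 i A S, π.afterDispatch z.2 i) := rfl
  rw [h0, ev_bind (Set.toFinite _) fun i _ => h1 i]
  refine ev_congr fun i _ => ?_
  rw [ev_bind ha.finite_support fun A _ => h2 i A]
  refine ev_congr fun A _ => ?_
  rw [ev_bind (finite_support_serviceLaw hb) (h3 i A)]
  simp only [ev_pure]

/-- Arrivals and services are drawn independently of the chosen server, so in a bound affine in `A`
and `S` they may be replaced by their means. All quadratic drifts pass through this estimate. -/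
lemma ev_slot_le (ha : ArrivalLaw lam Amax a) (hb : ∀ n, ∀ k ∈ (s n).support, k ≤ Smax)
    (hs : ServiceLaws μ s) (z : π.State) {f : π.State → ℝ} {C : ℝ} {u v : Fin N → ℝ}
    (hf : ∀ i, ∀ A ≤ Amax, ∀ S : Fin N → ℕ, (∀ n, S n ≤ Smax) →
      f (nextQueue z.1 i A S, π.afterDispatch z.2 i) ≤ C + u i * A - ∑ n, v n * S n) :
    ev (π.slot a s z) f ≤ C + lam * ev (π.dispatch z.1 z.2) u - ∑ n, v n * μ n := by
  have hS := finite_support_serviceLaw hb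
  have h1 : ev (π.slot a s z) f ≤ ev (π.dispatch z.1 z.2) fun i => ev a fun A =>
      ev (serviceLaw s) fun S => C + u i * A - ∑ n, v n * S n := by
    rw [ev_slot ha hb]
    exact ev_mono (Set.toFinite _) fun i _ => ev_mono ha.finite_support fun A hA =>
      ev_mono hS fun S hS => hf i A (ha.1 A hA) S fun n =>
        hb n _ (mem_support_of_mem_support_serviceLaw hS n)
  refine h1.trans (le_of_eq ?_)
  have h2 : ∀ (i : Fin N) (A : ℕ), ev (serviceLaw s) (fun S => C + u i * A - ∑ n, v n * S n) =
      C + u i * A - ∑ n, v n * μ n := by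
    intro i A
    rw [ev_sub hS, ev_const, ev_sum hS]
    simp only [ev_const_mul, ev_serviceLaw hb hs]
  have h3 : ∀ i : Fin N, ev a (fun A => C + u i * (A : ℝ) - ∑ n, v n * μ n) =
      C + u i * lam - ∑ n, v n * μ n := by
    intro i
    rw [ev_sub ha.finite_support, ev_add ha.finite_support, ev_const, ev_const, ev_const_mul,
      ha.ev_eq]
  simp only [h2, h3]
  rw [ev_sub (Set.toFinite _), ev_add (Set.toFinite _), ev_const, ev_const, ev_mul_const]
  ring

/-- From the state before a refreshing of the memory to the state before the next one. -/
def Policy.preStep (π : Policy N) (a : PMF ℕ) (s : Fin N → PMF ℕ) (z : π.State) : PMF π.State :=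
  (π.report z).bind (π.slot a s)

lemma preLaw_succ (π : Policy N) (a : PMF ℕ) (s : Fin N → PMF ℕ) (q₀ : Fin N → ℕ) (t : ℕ) :
    π.preLaw a s q₀ (t + 1) = (π.preLaw a s q₀ t).bind (π.preStep a s) := by
  rw [Policy.preLaw, PMF.bind_bind]
  rfl

lemma mem_support_report {z z' : π.State} (h : z' ∈ (π.report z).support) :
    z'.1 = z.1 ∧ z'.2 ∈ (π.refresh z.1 z.2).support := by
  rw [Policy.report, PMF.support_map] at h
  obtain ⟨m, hm, rfl⟩ := h
  exact ⟨rfl, hm⟩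

lemma mem_support_preStep {z z' : π.State} (h : z' ∈ (π.preStep a s z).support) :
    ∃ m ∈ (π.refresh z.1 z.2).support, ∃ i, ∃ A ∈ a.support,
      ∃ S ∈ (serviceLaw s).support, z' = (nextQueue z.1 i A S, π.afterDispatch m i) := by
  rw [Policy.preStep, PMF.mem_support_bind_iff] at h
  obtain ⟨y, hy, hz'⟩ := h
  obtain ⟨h1, h2⟩ := mem_support_report hy
  obtain ⟨i, -, A, hA, S, hS, h⟩ := mem_support_slot hz'
  exact ⟨y.2, h2, i, A, hA, S, hS, by rw [h, h1]⟩

lemma finite_support_preStep (ha : ArrivalLaw lam Amax a)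
    (hb : ∀ n, ∀ k ∈ (s n).support, k ≤ Smax) {z : π.State}
    (hz : (π.refresh z.1 z.2).support.Finite) : (π.preStep a s z).support.Finite :=
  finite_support_bind (finite_support_map hz _) fun y _ => finite_support_slot ha hb y

lemma ev_preStep_le (ha : ArrivalLaw lam Amax a) (hb : ∀ n, ∀ k ∈ (s n).support, k ≤ Smax)
    (hs : ServiceLaws μ s) {z : π.State} (hz : (π.refresh z.1 z.2).support.Finite)
    {f : π.State → ℝ} {C : ℝ} {u v : Fin N → ℝ}
    (hf : ∀ m ∈ (π.refresh z.1 z.2).support, ∀ i, ∀ A ≤ Amax, ∀ S : Fin N → ℕ,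
      (∀ n, S n ≤ Smax) →
      f (nextQueue z.1 i A S, π.afterDispatch m i) ≤ C + u i * A - ∑ n, v n * S n) :
    ev (π.preStep a s z) f ≤ C + lam * ev (π.meanDispatch z) u - ∑ n, v n * μ n := by
  have hr : (π.report z).support.Finite := finite_support_map hz _
  rw [Policy.preStep, ev_bind hr fun y _ => finite_support_slot ha hb y,
    Policy.report, ev_map hz, Policy.meanDispatch, ev_bind hz fun _ _ => Set.toFinite _]
  refine (ev_mono hz fun m hm => ev_slot_le ha hb hs (z.1, m) (hf m hm)).trans (le_of_eq ?_)
  rw [ev_sub hz, ev_add hz, ev_const, ev_const, ev_const_mul]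

lemma abs_nextQueue_sub_le {q : Fin N → ℕ} {i : Fin N} {A : ℕ} {S : Fin N → ℕ} (hA : A ≤ Amax)
    (hS : ∀ n, S n ≤ Smax) (n : Fin N) :
    |(nextQueue q i A S n : ℝ) - q n| ≤ Amax + Smax := by
  have h1 : nextQueue q i A S n ≤ q n + Amax := by
    unfold nextQueue
    split_ifs <;> omega
  have h2 : q n ≤ nextQueue q i A S n + Smax := by
    have := hS n
    unfold nextQueue
    split_ifs <;> omega
  have h1' : (nextQueue q i A S n : ℝ) ≤ q n + Amax := by exact_mod_cast h1
  have h2' : (q n : ℝ) ≤ nextQueue q i A S n + Smax := by exact_mod_cast h2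
  rw [abs_le]
  constructor <;> linarith [(Nat.cast_nonneg Amax : (0 : ℝ) ≤ Amax),
    (Nat.cast_nonneg Smax : (0 : ℝ) ≤ Smax)]

lemma sum_add_le_sum_nextQueue (q : Fin N → ℕ) (i : Fin N) (A : ℕ) (S : Fin N → ℕ) :
    ∑ n, q n + A ≤ ∑ n, nextQueue q i A S n + ∑ n, S n := by
  have h : ∑ n, (if n = i then A else 0) = A := by simp
  nth_rewrite 1 [← h]
  rw [← Finset.sum_add_distrib, ← Finset.sum_add_distrib]
  refine Finset.sum_le_sum fun n _ => ?_
  unfold nextQueue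
  omega

end Slot

/-! ### A family of quadratic functions -/

section Quadratic

variable {Amax Smax : ℕ}

/-- For `c = 0` this is `N ∑ q_n ^ 2`, for `c = 1` it measures the imbalance of the queues. -/
def quad (c : ℝ) (q : Fin N → ℕ) : ℝ := ∑ i, ∑ j, ((q i : ℝ) - c * q j) ^ 2

lemma quad_nonneg (c : ℝ) (q : Fin N → ℕ) : 0 ≤ quad c q :=
  Finset.sum_nonneg fun _ _ => Finset.sum_nonneg fun _ _ => sq_nonneg _

lemma quad_eq (c : ℝ) (q : Fin N → ℕ) :
    quad c q = N * (1 + c ^ 2) * ∑ n, (q n : ℝ) ^ 2 - 2 * c * (∑ n, (q n : ℝ)) ^ 2 := by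
  have h : ∀ i j : Fin N, ((q i : ℝ) - c * q j) ^ 2 =
      (q i : ℝ) ^ 2 + c ^ 2 * (q j : ℝ) ^ 2 - 2 * c * ((q i : ℝ) * q j) := fun i j => by ring
  simp only [quad, h, Finset.sum_sub_distrib, Finset.sum_add_distrib, ← Finset.mul_sum,
    ← Finset.sum_mul, Finset.sum_const, Finset.card_univ, Fintype.card_fin, nsmul_eq_mul]
  ring

/-- By `quad_eq` the function is a positive multiple of `∑ q_n ^ 2` minus a nonnegative multiple of
`(∑ q_n) ^ 2`. Truncation at zero helps in both terms: it can only lower the squares and only raise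
the total. -/
lemma quad_nextQueue_le {c : ℝ} (hc : 0 ≤ c) (hc1 : c ≤ 1) {q : Fin N → ℕ} {i : Fin N} {A : ℕ}
    {S : Fin N → ℕ} (hA : A ≤ Amax) (hS : ∀ n, S n ≤ Smax) :
    quad c (nextQueue q i A S) ≤ quad c q + 2 * N ^ 2 * ((Amax : ℝ) + Smax) ^ 2 +
      (2 * N * (1 + c ^ 2) * q i - 4 * c * ∑ n, (q n : ℝ)) * A -
      ∑ n, (2 * N * (1 + c ^ 2) * (q n : ℝ) - 4 * c * ∑ j, (q j : ℝ)) * S n := by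
  have h1 : ∑ n, (nextQueue q i A S n : ℝ) ^ 2 ≤ ∑ n, (q n : ℝ) ^ 2 +
      2 * (q i * A - ∑ n, (q n : ℝ) * S n) + N * ((Amax : ℝ) + Smax) ^ 2 := by
    have h : ∀ n, (nextQueue q i A S n : ℝ) ^ 2 ≤ (q n : ℝ) ^ 2 +
        2 * ((if n = i then (q n : ℝ) * A else 0) - q n * S n) + ((Amax : ℝ) + Smax) ^ 2 := by
      intro n
      have hS' : (S n : ℝ) ≤ Smax := by exact_mod_cast hS n
      have hA' : (A : ℝ) ≤ Amax := by exact_mod_cast hA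
      have hA0 : (0 : ℝ) ≤ A := A.cast_nonneg
      have hS0 : (0 : ℝ) ≤ S n := (S n).cast_nonneg
      set b : ℕ := if n = i then A else 0 with hb
      have hb1 : (b : ℝ) ≤ Amax := by
        rw [hb]
        split_ifs
        · exact hA'
        · simp
      have hb0 : (0 : ℝ) ≤ b := b.cast_nonneg
      have e1 : (if n = i then (q n : ℝ) * A else 0) = q n * b := by
        rw [hb]
        split_ifs <;> simp
      have e2 : (nextQueue q i A S n : ℝ) ^ 2 ≤ ((q n : ℝ) + b - S n) ^ 2 := by
        have : nextQueue q i A S n = q n + b - S n := rfl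
        rw [this]
        rcases le_total (S n) (q n + b) with h | h
        · rw [Nat.cast_sub h, Nat.cast_add]
        · rw [Nat.sub_eq_zero_of_le h]
          simpa using sq_nonneg ((q n : ℝ) + b - S n)
      rw [e1]
      have e3 : ((b : ℝ) - S n) ^ 2 ≤ ((Amax : ℝ) + Smax) ^ 2 := by
        apply sq_le_sq'  <;> linarith
      nlinarith
    refine (Finset.sum_le_sum fun n _ => h n).trans (le_of_eq ?_)
    rw [Finset.sum_add_distrib, Finset.sum_add_distrib, ← Finset.mul_sum, Finset.sum_sub_distrib]
    simp
  have h2 : (∑ n, (q n : ℝ)) ^ 2 + 2 * (∑ n, (q n : ℝ)) * (A - ∑ n, (S n : ℝ)) ≤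
      (∑ n, (nextQueue q i A S n : ℝ)) ^ 2 := by
    have h : (∑ n, (q n : ℝ)) + A ≤ ∑ n, (nextQueue q i A S n : ℝ) + ∑ n, (S n : ℝ) := by
      exact_mod_cast sum_add_le_sum_nextQueue q i A S
    have h0 : (0 : ℝ) ≤ ∑ n, (q n : ℝ) := Finset.sum_nonneg fun n _ => (q n).cast_nonneg
    nlinarith [sq_nonneg (∑ n, (nextQueue q i A S n : ℝ) - ∑ n, (q n : ℝ))]
  have h3 : ∑ n, (2 * N * (1 + c ^ 2) * (q n : ℝ) - 4 * c * ∑ j, (q j : ℝ)) * S n =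
      2 * N * (1 + c ^ 2) * ∑ n, (q n : ℝ) * S n - 4 * c * (∑ j, (q j : ℝ)) * ∑ n, (S n : ℝ) := by
    simp only [sub_mul, Finset.sum_sub_distrib, mul_assoc, ← Finset.mul_sum]
  have hc2 : c ^ 2 ≤ 1 := pow_le_one₀ hc hc1
  have h4 : (N : ℝ) * (1 + c ^ 2) * (N * ((Amax : ℝ) + Smax) ^ 2) ≤
      2 * N ^ 2 * ((Amax : ℝ) + Smax) ^ 2 := by
    have : 0 ≤ (N : ℝ) ^ 2 * ((Amax : ℝ) + Smax) ^ 2 := by positivity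
    nlinarith
  have h5 := mul_le_mul_of_nonneg_left h1 (by positivity : 0 ≤ (N : ℝ) * (1 + c ^ 2))
  have h6 := mul_le_mul_of_nonneg_left h2 (by positivity : 0 ≤ 2 * c)
  rw [quad_eq, quad_eq, h3]
  linarith

lemma sqrt_quad_eq_norm (c : ℝ) (q : Fin N → ℕ) :
    √(quad c q) = ‖(WithLp.toLp 2 fun ij : Fin N × Fin N => (q ij.1 : ℝ) - c * q ij.2 :
      EuclideanSpace ℝ (Fin N × Fin N))‖ := by
  rw [EuclideanSpace.norm_eq, quad, Fintype.sum_prod_type]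
  simp

/-- The square root is the Euclidean norm of a linear image of `q` with `N ^ 2` coordinates, each of
which moves by at most `2 * K`. -/
lemma abs_sqrt_quad_sub_le {c : ℝ} (hc : 0 ≤ c) (hc1 : c ≤ 1) {q q' : Fin N → ℕ} {K : ℝ}
    (h : ∀ n, |(q' n : ℝ) - q n| ≤ K) : |√(quad c q') - √(quad c q)| ≤ 2 * N * K := by
  rw [sqrt_quad_eq_norm, sqrt_quad_eq_norm]
  refine (abs_norm_sub_norm_le _ _).trans ?_
  rw [EuclideanSpace.norm_eq]
  rcases isEmpty_or_nonempty (Fin N) with hN | ⟨⟨n₀⟩⟩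
  · simp [Finset.univ_eq_empty]
    have : N = 0 := by
      rcases Nat.eq_zero_or_pos N with h | h
      · exact h
      · exact (hN.false ⟨0, h⟩).elim
    simp [this]
  have hK : 0 ≤ K := (abs_nonneg _).trans (h n₀)
  rw [Real.sqrt_le_left (by positivity)]
  have h1 : ∀ ij : Fin N × Fin N, ‖(WithLp.toLp 2 (fun ij : Fin N × Fin N => (q' ij.1 : ℝ) - c * q' ij.2) -
      WithLp.toLp 2 (fun ij : Fin N × Fin N => (q ij.1 : ℝ) - c * q ij.2) :
      EuclideanSpace ℝ (Fin N × Fin N)) ij‖ ^ 2 ≤ (2 * K) ^ 2 := by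
    intro ij
    rw [Real.norm_eq_abs, sq_abs]
    have e : (WithLp.toLp 2 (fun ij : Fin N × Fin N => (q' ij.1 : ℝ) - c * q' ij.2) -
      WithLp.toLp 2 (fun ij : Fin N × Fin N => (q ij.1 : ℝ) - c * q ij.2) :
      EuclideanSpace ℝ (Fin N × Fin N)) ij =
        ((q' ij.1 : ℝ) - q ij.1) - c * ((q' ij.2 : ℝ) - q ij.2) := by
      simp
      ring
    rw [e]
    have h1 := abs_le.1 (h ij.1)
    have h2 : |c * ((q' ij.2 : ℝ) - q ij.2)| ≤ K := by
      rw [abs_mul, abs_of_nonneg hc]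
      exact (mul_le_mul hc1 (h _) (abs_nonneg _) zero_le_one).trans (by rw [one_mul])
    have h2 := abs_le.1 h2
    apply sq_le_sq' <;> linarith [h1.1, h1.2, h2.1, h2.2]
  refine (Finset.sum_le_sum fun ij _ => h1 ij).trans (le_of_eq ?_)
  simp
  ring

end Quadratic

variable {N : ℕ}

/-! ### Tilted dispatching distributions -/

section Tilted

variable {μ : Fin N → ℝ} {q : Fin N → ℕ}

lemma sum_toReal_perm (p : PMF (Fin N)) (σ : Equiv.Perm (Fin N)) :
    ∑ n, (p (σ n)).toReal = 1 := by
  rw [Equiv.sum_comp σ fun n => (p n).toReal, ← tsum_fintype (L := .unconditional _), tsum_toReal_eq_one]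

/-- If the mean queue length seen by the arrivals is below that of a rate-weighted choice by `δ`
times the largest difference of queue lengths, the dispatching distribution is `δ`-tilted. -/
lemma deltaTiltedUpToEquiv_of_ev_le (hN : 2 ≤ N) (hμ : ∀ n, 0 < μ n) {δ : ℝ} (hδ : 0 < δ)
    (hδμ : ∀ n, δ ≤ μ n / ∑ j, μ j) {p : PMF (Fin N)}
    (hp : ∀ i j, ev p (fun n => (q n : ℝ)) ≤
      ∑ n, μ n / (∑ j, μ j) * q n - δ * ((q j : ℝ) - q i)) :
    DeltaTiltedUpToEquiv δ μ q p := by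
  intro σ hσ
  have : NeZero N := ⟨by omega⟩
  set M := ∑ j, μ j with hM
  have hM0 : 0 < M := Finset.sum_pos (fun n _ => hμ n) Finset.univ_nonempty
  set m : Fin N → ℝ := fun n => μ (σ n) / M with hm
  have hm1 : ∑ n, m n = 1 := by
    rw [hm, ← Finset.sum_div, Equiv.sum_comp σ μ, ← hM, div_self hM0.ne']
  have hm0 : ∀ n, δ ≤ m n := fun n => hδμ (σ n)
  let f : Fin N := ⟨0, by omega⟩
  let l : Fin N := ⟨N - 1, by omega⟩
  have hfl : f ≠ l := by
    rw [Ne, Fin.ext_iff]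
    change ¬ (0 = N - 1)
    omega
  -- Ensures `1 - m f ≥ m l ≥ δ`, so that the point mass at the shortest queue is itself `δ`-tilted
  -- at both ends.
  have hml : m f + m l ≤ 1 := by
    rw [← hm1, ← Finset.sum_pair hfl]
    exact Finset.sum_le_sum_of_subset_of_nonneg (Finset.subset_univ _)
      fun n _ _ => hδ.le.trans (hm0 n)
  set v := ev p (fun n => (q n : ℝ)) with hv
  set A := ∑ n, (q (σ n) : ℝ) * m n - δ * ((q (σ l) : ℝ) - q (σ f)) with hA
  have hvsum : v = ∑ n, (q (σ n) : ℝ) * (p (σ n)).toReal := by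
    rw [hv, ev_eq_sum, ← Equiv.sum_comp σ]
    exact Finset.sum_congr rfl fun n _ => mul_comm _ _
  have hvA : v ≤ A := by
    have h := hp (σ f) (σ l)
    rw [← Equiv.sum_comp σ] at h
    refine h.trans (le_of_eq ?_)
    rw [hA]
    congr 1
    exact Finset.sum_congr rfl fun n _ => mul_comm _ _
  have hfv : (q (σ f) : ℝ) ≤ v := by
    rw [hvsum, ← mul_one (q (σ f) : ℝ), ← sum_toReal_perm p σ, Finset.mul_sum]
    refine Finset.sum_le_sum fun n _ => mul_le_mul_of_nonneg_right ?_ ENNReal.toReal_nonneg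
    have : (q ∘ σ) f ≤ (q ∘ σ) n := hσ (Fin.mk_le_of_le_val (Nat.zero_le _))
    exact_mod_cast this
  -- The rates with mass `δ` moved from the last to the first position have inner product `A`, the
  -- point mass at the first position has `q (σ f)`, and `v` lies in between. The mixture with
  -- weight `θ` on the point mass has inner product `v`. If `A = q (σ f)`, then `θ = 0` by division
  -- by zero, which is right since `v = A`.
  set θ := (A - v) / (A - q (σ f)) with hθ
  have hθ0 : 0 ≤ θ := div_nonneg (by linarith) (by linarith)
  have hθ1 : θ ≤ 1 := div_le_one_of_le₀ (by linarith) (by linarith)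
  have hθA : θ * (A - q (σ f)) = A - v := by
    rcases eq_or_ne (A - (q (σ f) : ℝ)) 0 with h | h
    · have : A - v = 0 := by linarith
      rw [h, this, mul_zero]
    · rw [hθ, div_mul_cancel₀ _ h]
  let ef : Fin N → ℝ := fun n => if n = f then 1 else 0
  let el : Fin N → ℝ := fun n => if n = l then 1 else 0
  have hef : ∀ g : Fin N → ℝ, ∑ n, g n * ef n = g f := fun g => by simp [ef]
  have hel : ∀ g : Fin N → ℝ, ∑ n, g n * el n = g l := fun g => by simp [el]
  let P' : Fin N → ℝ := fun n => (1 - θ) * (m n + δ * (ef n - el n)) + θ * ef n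
  have hP' : ∀ g : Fin N → ℝ, ∑ n, g n * P' n =
      (1 - θ) * (∑ n, g n * m n + δ * (g f - g l)) + θ * g f := by
    intro g
    rw [← hef g, ← hel g]
    simp only [P', mul_add, mul_sub, Finset.mul_sum, ← Finset.sum_add_distrib,
      ← Finset.sum_sub_distrib]
    exact Finset.sum_congr rfl fun n _ => by ring
  have htilt : ∀ n, tilt μ σ P' n = P' n - m n := fun n => rfl
  have htf : tilt μ σ P' f = (1 - θ) * δ + θ * (1 - m f) := by
    rw [htilt]
    simp only [P', ef, el, if_true, if_neg hfl]
    ring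
  have htl : tilt μ σ P' l = -((1 - θ) * δ + θ * m l) := by
    rw [htilt]
    simp only [P', ef, el, if_true, if_neg hfl.symm]
    ring
  have hto : ∀ n, n ≠ f → n ≠ l → tilt μ σ P' n = -(θ * m n) := by
    intro n h1 h2
    rw [htilt]
    simp only [P', ef, el, if_neg h1, if_neg h2]
    ring
  have htf' : δ ≤ tilt μ σ P' f := by
    rw [htf]
    nlinarith [hm0 l]
  have htl' : tilt μ σ P' l ≤ -δ := by
    rw [htl]
    nlinarith [hm0 l]
  refine ⟨P', ⟨⟨fun n => ?_, ?_⟩, ?_⟩, ⟨2, le_rfl, hN, fun n hn => ?_, fun n hn => ?_⟩, hδ,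
    fun n hn => ?_, fun n hn => ?_⟩
  · have h1 : 0 ≤ ef n := by
      simp only [ef]
      split_ifs <;> norm_num
    have h2 : el n ≤ 1 := by
      simp only [el]
      split_ifs <;> norm_num
    have h3 : 0 ≤ m n + δ * (ef n - el n) := by nlinarith [hm0 n]
    exact add_nonneg (mul_nonneg (by linarith) h3) (mul_nonneg hθ0 h1)
  · have := hP' fun _ => 1
    simp only [one_mul, hm1] at this
    rw [this]
    ring
  · rw [← hvsum, hP' fun n => (q (σ n) : ℝ)]
    linear_combination hθA + (1 - θ) * hA
  · have : n = f := Fin.ext (by change (n : ℕ) = 0; omega)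
    rw [this]
    linarith
  · have hnf : n ≠ f := by
      rintro rfl
      exact absurd hn (by change ¬ (2 ≤ 0 + 1); omega)
    by_cases hnl : n = l
    · rw [hnl]
      linarith
    · rw [hto n hnf hnl, neg_nonpos]
      exact mul_nonneg hθ0 (hδ.le.trans (hm0 n))
  · have : n = f := Fin.ext (by change (n : ℕ) = 0; omega)
    rwa [this]
  · have : n = l := Fin.ext (by change (n : ℕ) = N - 1; omega)
    rwa [this]

lemma toReal_rateWeighted (hμ : ∀ n, 0 < μ n) (I : Finset (Fin N)) (hI : I.Nonempty)
    (i : Fin N) :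
    (rateWeighted μ hμ I hI i).toReal = if i ∈ I then μ i / ∑ j ∈ I, μ j else 0 := by
  rw [rateWeighted, PMF.normalize_apply, tsum_fintype, Finset.sum_ite_mem, Finset.univ_inter,
    ← ENNReal.ofReal_sum_of_nonneg fun j _ => (hμ j).le, ENNReal.toReal_mul, ENNReal.toReal_inv,
    ENNReal.toReal_ofReal (Finset.sum_nonneg fun j _ => (hμ j).le)]
  split_ifs with h
  · rw [ENNReal.toReal_ofReal (hμ i).le]
    rfl
  · simp

lemma toReal_weightedChoice_of_nonempty [NeZero N] (hμ : ∀ n, 0 < μ n) {I : Finset (Fin N)}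
    (hI : I.Nonempty) (i : Fin N) :
    (weightedChoice μ hμ I i).toReal = if i ∈ I then μ i / ∑ j ∈ I, μ j else 0 := by
  rw [weightedChoice, dif_pos hI, toReal_rateWeighted]

lemma toReal_weightedChoice_empty [NeZero N] (hμ : ∀ n, 0 < μ n) (i : Fin N) :
    (weightedChoice μ hμ ∅ i).toReal = μ i / ∑ j, μ j := by
  rw [weightedChoice, dif_neg Finset.not_nonempty_empty, toReal_rateWeighted,
    if_pos (Finset.mem_univ i)]

/-- `I` contains with a server all servers with queues that are not longer. -/
def IsShortest (q : Fin N → ℕ) (I : Finset (Fin N)) : Prop := ∀ i ∈ I, ∀ j, q j ≤ q i → j ∈ I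

/-- Conditioning the rate-weighted choice on `I` raises the probabilities inside `I` and annuls
those outside, and `I` is an initial segment of every ordering by length. If `I` is empty or
everything, all `Δ_n` vanish and `k = 2` serves. -/
lemma isTilted_weightedChoice [NeZero N] (hN : 2 ≤ N) (hμ : ∀ n, 0 < μ n) {I : Finset (Fin N)}
    (hI : IsShortest q I) : TiltedUpToEquiv μ q (weightedChoice μ hμ I) := by
  intro σ hσ
  refine ⟨fun n => (weightedChoice μ hμ I (σ n)).toReal,
    ⟨⟨fun n => ENNReal.toReal_nonneg, sum_toReal_perm _ σ⟩, rfl⟩, ?_⟩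
  unfold IsTilted tilt
  have hM0 : 0 < ∑ j, μ j := Finset.sum_pos (fun n _ => hμ n) Finset.univ_nonempty
  rcases I.eq_empty_or_nonempty with rfl | hne
  · refine ⟨2, le_rfl, hN, fun n _ => ?_, fun n _ => ?_⟩ <;>
      simp [toReal_weightedChoice_empty]
  have hin : ∀ n, σ n ∈ I → 0 ≤ (weightedChoice μ hμ I (σ n)).toReal - μ (σ n) / ∑ j, μ j := by
    intro n hn
    rw [toReal_weightedChoice_of_nonempty hμ hne, if_pos hn, sub_nonneg]
    refine div_le_div_of_nonneg_left (hμ _).le (Finset.sum_pos (fun n _ => hμ n) hne) ?_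
    exact Finset.sum_le_sum_of_subset_of_nonneg (Finset.subset_univ _) fun n _ _ => (hμ n).le
  have hout : ∀ n, σ n ∉ I → (weightedChoice μ hμ I (σ n)).toReal - μ (σ n) / ∑ j, μ j ≤ 0 := by
    intro n hn
    rw [toReal_weightedChoice_of_nonempty hμ hne, if_neg hn, zero_sub, neg_nonpos]
    exact div_nonneg (hμ _).le hM0.le
  by_cases hall : ∀ n, σ n ∈ I
  · have hIu : I = Finset.univ := Finset.eq_univ_iff_forall.2 fun n => by
      simpa using hall (σ.symm n)
    refine ⟨2, le_rfl, hN, fun n _ => hin n (hall n), fun n _ => le_of_eq ?_⟩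
    beta_reduce
    rw [toReal_weightedChoice_of_nonempty hμ hne, if_pos (hall n), hIu, sub_self]
  · push Not at hall
    have hex : ∃ k : ℕ, ∃ h : k < N, σ ⟨k, h⟩ ∉ I := by
      obtain ⟨n, hn⟩ := hall
      exact ⟨n, n.2, hn⟩
    classical
    obtain ⟨hk, hkI⟩ := Nat.find_spec hex
    set k := Nat.find hex with hkdef
    have hlt : ∀ n : Fin N, (n : ℕ) < k → σ n ∈ I := by
      intro n hn
      by_contra h
      exact Nat.find_min hex hn ⟨n.2, h⟩
    have hge : ∀ n : Fin N, k ≤ n → σ n ∉ I := by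
      intro n hn h
      exact hkI (hI _ h _ (hσ (Fin.le_def.2 hn)))
    have hk1 : 1 ≤ k := by
      by_contra h0
      obtain ⟨i, hi⟩ := hne
      exact hge (σ.symm i) (by omega) (by simpa using hi)
    -- Here `k` is the first position outside `I` counted from `0`, whereas `IsTilted` counts from
    -- `1`.
    exact ⟨k + 1, by omega, hk, fun n hn => hin n (hlt n (by omega)),
      fun n hn => hout n (hge n (by omega))⟩

/-! ### Mean queue length met by arrivals, by level sets. -/

lemma ev_eq_sum_layers (p : PMF (Fin N)) {L : ℕ} (hL : ∀ n, q n ≤ L) :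
    ev p (fun n => (q n : ℝ)) =
      ∑ l ∈ Finset.range L, ev p (fun n => if l < q n then 1 else 0) := by
  rw [← ev_sum (Set.toFinite _)]
  refine ev_congr fun n _ => ?_
  rw [Finset.sum_boole]
  congr 1
  have : (Finset.range L).filter (fun l => l < q n) = Finset.range (q n) := by
    ext l
    have := hL n
    simp only [Finset.mem_filter, Finset.mem_range]
    omega
  rw [this, Finset.card_range]

/-- If `I` contains a queue longer than `l`, then every server outside `I` has one too, so
conditioning on `I` discards only mass above the level. Otherwise the left side is zero. -/
lemma ev_layer_weightedChoice_le [NeZero N] (hμ : ∀ n, 0 < μ n) {I : Finset (Fin N)} (hI : IsShortest q I)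
    (l : ℕ) : ev (weightedChoice μ hμ I) (fun n => if l < q n then 1 else 0) ≤
      ∑ n, μ n / (∑ j, μ j) * if l < q n then 1 else 0 := by
  rw [ev_eq_sum]
  rcases I.eq_empty_or_nonempty with rfl | hne
  · simp only [toReal_weightedChoice_empty, le_refl]
  simp only [toReal_weightedChoice_of_nonempty hμ hne, ite_mul, zero_mul, Finset.sum_ite_mem,
    Finset.univ_inter]
  simp only [mul_ite, mul_one, mul_zero]
  have hM0 : 0 < ∑ j, μ j := Finset.sum_pos (fun n _ => hμ n) Finset.univ_nonempty
  have hMI : 0 < ∑ j ∈ I, μ j := Finset.sum_pos (fun n _ => hμ n) hne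
  by_cases h : ∃ i ∈ I, l < q i
  · obtain ⟨i, hi, hli⟩ := h
    have h1 : ∀ (s : Finset (Fin N)) (c : ℝ), ∑ n ∈ s, (if l < q n then μ n / c else 0) =
        (∑ n ∈ s, if l < q n then μ n else 0) / c := by
      intro s c
      rw [Finset.sum_div]
      exact Finset.sum_congr rfl fun n _ => by split_ifs <;> simp
    rw [h1, h1, div_le_div_iff₀ hMI hM0, ← Finset.sum_add_sum_compl I μ,
      ← Finset.sum_add_sum_compl I fun n => if l < q n then μ n else 0]
    have h2 : ∑ n ∈ Iᶜ, (if l < q n then μ n else 0) = ∑ n ∈ Iᶜ, μ n := by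
      refine Finset.sum_congr rfl fun n hn => if_pos ?_
      by_contra hn'
      exact Finset.mem_compl.1 hn (hI i hi n (by omega))
    have h3 : ∑ n ∈ I, (if l < q n then μ n else 0) ≤ ∑ n ∈ I, μ n := by
      refine Finset.sum_le_sum fun n _ => ?_
      split_ifs
      · exact le_rfl
      · exact (hμ n).le
    have h4 : 0 ≤ ∑ n ∈ Iᶜ, μ n := Finset.sum_nonneg fun n _ => (hμ n).le
    rw [h2]
    nlinarith
  · push Not at h
    rw [Finset.sum_eq_zero fun n hn => if_neg (not_lt.2 (h n hn))]
    refine Finset.sum_nonneg fun n _ => ?_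
    split_ifs
    · exact div_nonneg (hμ n).le hM0.le
    · exact le_rfl

lemma ev_weightedChoice_le [NeZero N] (hμ : ∀ n, 0 < μ n) {I : Finset (Fin N)} (hI : IsShortest q I) :
    ev (weightedChoice μ hμ I) (fun n => (q n : ℝ)) ≤ ∑ n, μ n / (∑ j, μ j) * q n := by
  have hL : ∀ n, q n ≤ ∑ j, q j := fun n => Finset.single_le_sum (fun _ _ => Nat.zero_le _) (Finset.mem_univ n)
  rw [ev_eq_sum_layers _ hL]
  refine (Finset.sum_le_sum fun l _ => ev_layer_weightedChoice_le hμ hI l).trans (le_of_eq ?_)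
  rw [Finset.sum_comm]
  refine Finset.sum_congr rfl fun n _ => ?_
  rw [← Finset.mul_sum, Finset.sum_boole]
  congr 2
  have : (Finset.range (∑ j, q j)).filter (fun l => l < q n) = Finset.range (q n) := by
    ext l
    have := hL n
    simp only [Finset.mem_filter, Finset.mem_range]
    omega
  rw [this, Finset.card_range]

/-! ### Sampling -/

lemma ev_uniformOfFinset {α : Type*} (F : Finset α) (hF : F.Nonempty)
    (f : α → ℝ) : ev (PMF.uniformOfFinset F hF) f = (∑ x ∈ F, f x) / F.card := by
  rw [ev, tsum_eq_sum (s := F) fun x hx => by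
    rw [PMF.uniformOfFinset_apply_of_notMem hF hx]; simp]
  rw [Finset.sum_div]
  refine Finset.sum_congr rfl fun x hx => ?_
  rw [PMF.uniformOfFinset_apply_of_mem hF hx, ENNReal.toReal_inv, ENNReal.toReal_natCast,
    div_eq_inv_mul]

lemma ev_sampleServers_subset {d : ℕ} (hd : d ≤ N) (U : Finset (Fin N)) :
    ev (sampleServers d hd) (fun D => if D ⊆ U then 1 else 0) =
      (U.card.choose d : ℝ) / N.choose d := by
  rw [sampleServers, ev_uniformOfFinset, Finset.card_powersetCard, Finset.card_univ,
    Fintype.card_fin, Finset.sum_boole]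
  congr 2
  rw [← Finset.card_powersetCard]
  congr 1
  ext D
  simp [Finset.mem_powersetCard, and_comm]

/-- Here `x` stands for the number of queues above a level, and the quotient for the probability
that the sample falls among them. For `d = 1` the claim reduces to `x * (N - x) ≥ N - 1`. For `d = e
+ 1 ≥ 2` the product is at least `1`, by Pascal's rule for `x + 1 ≤ N` and `x.choose (e + 1) ≤ (x -
1) * x.choose e`. -/
lemma min_le_mul_one_sub_choose_div {d x : ℕ} (hd : 1 ≤ d) (hdN : d ≤ N) (hx : 1 ≤ x)
    (hxN : x < N) :
    min 1 ((d : ℝ) * (1 - 1 / N)) ≤ x * (1 - (x.choose d : ℝ) / N.choose d) := by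
  have hN0 : (0 : ℝ) < N := by exact_mod_cast hx.trans hxN.le
  have hx1 : (1 : ℝ) ≤ x := by exact_mod_cast hx
  have hxN' : (x : ℝ) + 1 ≤ N := by exact_mod_cast hxN
  rcases Nat.eq_or_lt_of_le hd with rfl | hd2
  · refine (min_le_right _ _).trans ?_
    rw [Nat.choose_one_right, Nat.choose_one_right]
    rw [Nat.cast_one, one_mul, one_sub_div hN0.ne', one_sub_div hN0.ne', ← mul_div_assoc]
    gcongr
    nlinarith
  · refine (min_le_left _ _).trans ?_
    have hC : (0 : ℝ) < N.choose d := by exact_mod_cast Nat.choose_pos hdN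
    obtain ⟨e, rfl⟩ : ∃ e, d = e + 1 := ⟨d - 1, by omega⟩
    have h1 : x.choose (e + 1) ≤ (x - 1) * x.choose e := by
      have h := Nat.choose_succ_right_eq x e
      have h2 : x.choose (e + 1) ≤ x.choose (e + 1) * (e + 1) :=
        Nat.le_mul_of_pos_right _ (by omega)
      rw [h, mul_comm] at h2
      exact h2.trans (Nat.mul_le_mul_right _ (by omega))
    have h2 : x.choose e + x.choose (e + 1) ≤ N.choose (e + 1) := by
      rw [← Nat.choose_succ_succ]
      exact Nat.choose_le_choose _ hxN
    have h1' : (x.choose (e + 1) : ℝ) ≤ (x - 1) * x.choose e := by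
      have h3 : ((x - 1 : ℕ) : ℝ) = x - 1 := by rw [Nat.cast_sub hx, Nat.cast_one]
      rw [← h3]
      exact_mod_cast h1
    have h2' : (x.choose e : ℝ) + x.choose (e + 1) ≤ N.choose (e + 1) := by exact_mod_cast h2
    rw [one_sub_div hC.ne', ← mul_div_assoc, one_le_div hC]
    nlinarith

end Tilted

variable {N : ℕ}

/-! ### Join-below-threshold: reachable states -/

section Threshold

variable {d T : ℕ} {hd : d ≤ N} {ch : Finset (Fin N) → PMF (Fin N)} {a : PMF ℕ}
  {s : Fin N → PMF ℕ} {q : Fin N → ℕ} {m m' : ThresholdMemory N}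

/-- Successive values of the countdown. -/
def nextCountdown (T c : ℕ) : ℕ := if c = 0 then T - 1 else c - 1

/-- Regularity of the memory before it is refreshed: either the next refreshing updates the
threshold, or all stored IDs belong to servers below the threshold. -/
def RegularPre (T : ℕ) (z : (Fin N → ℕ) × ThresholdMemory N) : Prop :=
  z.2.countdown ≤ T ∧
    (z.2.countdown = 0 ∨ ∀ i ∈ z.2.ids, (z.1 i : WithBot ℕ) ≤ z.2.threshold)

lemma thresholdRefresh_update (h : m.countdown = 0) :
    thresholdRefresh d T hd q m = (sampleServers d hd).map fun D : Finset (Fin N) =>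
      { ids := Finset.univ.filter fun n => q n ≤ sInf (q '' (D : Set (Fin N)))
        threshold := ((sInf (q '' (D : Set (Fin N))) : ℕ) : WithBot ℕ)
        countdown := T - 1 } := by
  rw [thresholdRefresh, if_pos h]
  -- In `thresholdRefresh` the map acts on the law of the sample coerced to `Set (Fin N)`; composing
  -- the two maps gives a map on finsets.
  change ((sampleServers d hd).bind (PMF.pure ∘ fun D : Finset (Fin N) => (D : Set (Fin N)))).map _
    = _
  rw [PMF.bind_pure_comp, PMF.map_comp]
  rfl

lemma finite_support_thresholdRefresh : (thresholdRefresh d T hd q m).support.Finite := by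
  unfold thresholdRefresh
  split_ifs
  · exact finite_support_map (Set.toFinite _) _
  · exact finite_support_pure _

lemma countdown_of_mem_support_refresh (h : m' ∈ (thresholdRefresh d T hd q m).support) :
    m'.countdown = nextCountdown T m.countdown := by
  unfold thresholdRefresh at h
  unfold nextCountdown
  split_ifs at h ⊢ with hc
  · rw [PMF.support_map] at h
    obtain ⟨D, -, rfl⟩ := h
    rfl
  · rw [PMF.support_pure, Set.mem_singleton_iff] at h
    rw [h]

/-- An update resets the IDs to a level set. Otherwise regularity says that the stored IDs already
satisfy the condition under which new ones are added. -/
lemma mem_ids_iff_of_mem_support_refresh (hz : RegularPre T (q, m))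
    (h : m' ∈ (thresholdRefresh d T hd q m).support) (i : Fin N) :
    i ∈ m'.ids ↔ (q i : WithBot ℕ) ≤ m'.threshold := by
  unfold thresholdRefresh at h
  split_ifs at h with hc
  · rw [PMF.support_map] at h
    obtain ⟨D, -, rfl⟩ := h
    simp
  · rw [PMF.support_pure, Set.mem_singleton_iff] at h
    rw [h]
    have := hz.2.resolve_left hc
    simp only [Finset.mem_union, Finset.mem_filter, Finset.mem_univ, true_and, or_iff_right_iff_imp]
    exact this i

lemma isShortest_of_mem_support_refresh (hz : RegularPre T (q, m))
    (h : m' ∈ (thresholdRefresh d T hd q m).support) : IsShortest q m'.ids := by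
  intro i hi j hj
  rw [mem_ids_iff_of_mem_support_refresh hz h] at hi ⊢
  exact le_trans (by exact_mod_cast hj) hi

lemma nextQueue_le_of_ne {i n : Fin N} (hn : n ≠ i) (A : ℕ) (S : Fin N → ℕ) :
    nextQueue q i A S n ≤ q n := by
  unfold nextQueue
  rw [if_neg hn]
  omega

lemma exists_of_mem_support_preStep_threshold {z' : (Fin N → ℕ) × ThresholdMemory N}
    (h : z' ∈ ((thresholdPolicy d T hd ch).preStep a s (q, m)).support) :
    ∃ m' ∈ (thresholdRefresh d T hd q m).support, ∃ i, ∃ A ∈ a.support,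
      ∃ S ∈ (serviceLaw s).support,
        z' = (nextQueue q i A S, { m' with ids := m'.ids.erase i }) :=
  mem_support_preStep h

lemma countdown_of_mem_support_preStep {z' : (Fin N → ℕ) × ThresholdMemory N}
    (h : z' ∈ ((thresholdPolicy d T hd ch).preStep a s (q, m)).support) :
    z'.2.countdown = nextCountdown T m.countdown := by
  obtain ⟨m', hm', i, A, -, S, -, rfl⟩ := exists_of_mem_support_preStep_threshold h
  exact countdown_of_mem_support_refresh (m' := m') hm'

lemma nextCountdown_le {c : ℕ} (hc : c ≤ T) : nextCountdown T c ≤ T := by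
  unfold nextCountdown
  split_ifs <;> omega

/-- A queue can grow only at the chosen server, whose ID is erased in the same slot; the IDs that
remain stay below the threshold. -/
lemma regularPre_of_mem_support_preStep (hz : RegularPre T (q, m))
    {z' : (Fin N → ℕ) × ThresholdMemory N}
    (h : z' ∈ ((thresholdPolicy d T hd ch).preStep a s (q, m)).support) : RegularPre T z' := by
  refine ⟨by
    rw [countdown_of_mem_support_preStep h]
    exact nextCountdown_le hz.1, Or.inr ?_⟩
  obtain ⟨m', hm', i, A, -, S, -, rfl⟩ := exists_of_mem_support_preStep_threshold h
  intro n hn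
  obtain ⟨hni, hn⟩ := Finset.mem_erase.1 hn
  refine le_trans ?_ ((mem_ids_iff_of_mem_support_refresh hz hm' n).1 hn)
  exact_mod_cast nextQueue_le_of_ne hni A S

lemma regularPre_preLaw (hT : 1 ≤ T) (q₀ : Fin N → ℕ) (t : ℕ) :
    ((thresholdPolicy d T hd ch).preLaw a s q₀ t).support ⊆ {z | RegularPre T z} := by
  refine support_subset_of_recursion (preLaw_succ _ a s q₀) ?_ ?_ t
  · rw [Policy.preLaw, PMF.support_pure, Set.singleton_subset_iff]
    exact ⟨hT, Or.inr fun i hi => absurd hi (Finset.notMem_empty i)⟩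
  · exact fun z hz z' hz' => regularPre_of_mem_support_preStep hz hz'

lemma countdown_preLaw (q₀ : Fin N → ℕ) (t : ℕ) {z : (Fin N → ℕ) × ThresholdMemory N}
    (hz : z ∈ ((thresholdPolicy d T hd ch).preLaw a s q₀ t).support) :
    z.2.countdown = (nextCountdown T)^[t] 1 := by
  induction t generalizing z with
  | zero =>
    rw [Policy.preLaw, PMF.support_pure] at hz
    rw [show z = _ from hz]
    rfl
  | succ t ih =>
    rw [preLaw_succ] at hz
    obtain ⟨y, hy, hz⟩ := (PMF.mem_support_bind_iff _ _ z).1 hz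
    rw [Function.iterate_succ_apply', ← ih hy]
    exact countdown_of_mem_support_preStep hz

lemma iterate_nextCountdown_le {c j : ℕ} (hj : j ≤ c) : (nextCountdown T)^[j] c = c - j := by
  induction j with
  | zero => rfl
  | succ j ih =>
    rw [Function.iterate_succ_apply', ih (by omega), nextCountdown, if_neg (by omega)]
    omega

/-- The countdown starts at `1`, so it first reaches `0` after one slot, and then again every `T`
slots: one step resets it to `T - 1`, and `T - 1` steps exhaust it. -/
lemma iterate_nextCountdown_update (hT : 1 ≤ T) (r : ℕ) :
    (nextCountdown T)^[r * T + 1] 1 = 0 := by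
  induction r with
  | zero => simp [nextCountdown]
  | succ r ih =>
    have h : (r + 1) * T + 1 = (T - 1) + (1 + (r * T + 1)) := by
      rw [Nat.succ_mul]
      omega
    rw [h, Function.iterate_add_apply, Function.iterate_add_apply, ih, Function.iterate_one]
    have h2 : nextCountdown T 0 = T - 1 := if_pos rfl
    rw [h2, iterate_nextCountdown_le le_rfl, Nat.sub_self]

/-- Every stationary law (before refreshing) is supported on regular states. -/
lemma regularPre_of_stationary
    {ν : PMF ((Fin N → ℕ) × ThresholdMemory N)}
    (hν : ν.bind ((thresholdPolicy d T hd ch).preStep a s) = ν) :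
    ν.support ⊆ {z | RegularPre T z} := by
  classical
  -- Regular states are absorbing. An irregular state has a positive countdown, possibly larger than
  -- `T`, which decreases by one in each slot, so a bounded strictly increasing function of it
  -- decreases strictly.
  let h : (Fin N → ℕ) × ThresholdMemory N → ℝ≥0∞ := fun z =>
    if RegularPre T z then 0 else 1 - (z.2.countdown + 2 : ℝ≥0∞)⁻¹
  refine support_subset_of_stationary hν (h := h) (fun z => ?_) (fun z hz => ?_) fun z hz => ?_
  · simp only [h]
    split_ifs
    · exact zero_le_one
    · exact tsub_le_self
  · refine le_trans (mean_le_const fun z' hz' => ?_) zero_le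
    simp only [h]
    rw [if_pos (regularPre_of_mem_support_preStep hz hz')]
  · have hc : z.2.countdown ≠ 0 := by
      intro h0
      exact hz ⟨by omega, Or.inl h0⟩
    obtain ⟨c, hc⟩ := Nat.exists_eq_succ_of_ne_zero hc
    have h1 : h z = 1 - (z.2.countdown + 2 : ℝ≥0∞)⁻¹ := if_neg hz
    have h2 : mean ((thresholdPolicy d T hd ch).preStep a s z) h ≤ 1 - (c + 2 : ℝ≥0∞)⁻¹ := by
      refine mean_le_const fun z' hz' => ?_
      simp only [h]
      split_ifs
      · exact zero_le
      · rw [countdown_of_mem_support_preStep hz', nextCountdown, if_neg (by omega), hc]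
        simp
    refine lt_of_le_of_lt h2 ?_
    rw [h1, hc]
    have h3 : ((c.succ : ℕ) + 2 : ℝ≥0∞)⁻¹ < (c + 2 : ℝ≥0∞)⁻¹ := by
      rw [ENNReal.inv_lt_inv]
      push_cast
      exact_mod_cast (by omega : c + 2 < c + 1 + 2)
    refine AddLECancellable.tsub_lt_tsub_left_of_le
      (ENNReal.cancel_of_ne (ne_top_of_le_ne_top ENNReal.one_ne_top tsub_le_self)) ?_ h3
    rw [ENNReal.inv_le_one]
    exact_mod_cast (by omega : 1 ≤ c + 2)

/-- Nonemptiness matters: for an empty sample `sInf` would be `0`. -/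
lemma sInf_image_le_iff {D : Finset (Fin N)} (hD : D.Nonempty) (l : ℕ) :
    sInf (q '' (D : Set (Fin N))) ≤ l ↔ ¬ D ⊆ Finset.univ.filter fun n => l < q n := by
  have hne : (q '' (D : Set (Fin N))).Nonempty := (Finset.coe_nonempty.2 hD).image q
  constructor
  · intro h hsub
    obtain ⟨n, hn, hq⟩ := Nat.sInf_mem hne
    have := (Finset.mem_filter.1 (hsub hn)).2
    omega
  · intro h
    obtain ⟨n, hn, hq⟩ := Finset.not_subset.1 h
    refine (Nat.sInf_le (Set.mem_image_of_mem q (Finset.mem_coe.2 hn))).trans ?_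
    simpa using hq

lemma threshold_le_of_mem_support_refresh (hd1 : 1 ≤ d) {B : ℕ} (hB : ∀ n, q n ≤ B)
    (h : m' ∈ (thresholdRefresh d T hd q m).support) :
    if m.countdown = 0 then m'.threshold ≤ (B : WithBot ℕ) else m'.threshold = m.threshold := by
  split_ifs with hc
  · rw [thresholdRefresh_update hc, PMF.support_map] at h
    obtain ⟨D, hD, rfl⟩ := h
    rw [sampleServers, PMF.mem_support_uniformOfFinset_iff, Finset.mem_powersetCard] at hD
    obtain ⟨n, hn⟩ := Finset.card_pos.1 (by omega : 0 < D.card)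
    have h1 : sInf (q '' (D : Set (Fin N))) ≤ B := (Nat.sInf_le (Set.mem_image_of_mem q (Finset.mem_coe.2 hn))).trans (hB n)
    change ((sInf (q '' (D : Set (Fin N))) : ℕ) : WithBot ℕ) ≤ B
    exact_mod_cast h1
  · rw [thresholdRefresh, if_neg hc, PMF.support_pure, Set.mem_singleton_iff] at h
    rw [h]

end Threshold

/-! ### Join-below-threshold with rate-weighted choice: mean queue length seen by arrivals -/

section Weighted

variable {μ : Fin N → ℝ} {hμ : ∀ n, 0 < μ n} {d T : ℕ} {hd : d ≤ N}
  {q : Fin N → ℕ} {m : ThresholdMemory N}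

lemma ev_meanDispatch [NeZero N] (f : Fin N → ℝ) :
    ev ((JBTG μ hμ d T hd).meanDispatch (q, m)) f =
      ev (thresholdRefresh d T hd q m) fun m' => ev (weightedChoice μ hμ m'.ids) f :=
  ev_bind (p := thresholdRefresh d T hd q m) (k := fun m' => weightedChoice μ hμ m'.ids)
    finite_support_thresholdRefresh (fun _ _ => Set.toFinite _) f

lemma ev_meanDispatch_le [NeZero N] (hz : RegularPre T (q, m)) :
    ev ((JBTG μ hμ d T hd).meanDispatch (q, m)) (fun n => (q n : ℝ)) ≤
      ∑ n, μ n / (∑ j, μ j) * q n := by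
  rw [ev_meanDispatch, ← ev_const (thresholdRefresh d T hd q m) (∑ n, μ n / (∑ j, μ j) * q n)]
  exact ev_mono finite_support_thresholdRefresh fun m' hm' =>
    ev_weightedChoice_le hμ (isShortest_of_mem_support_refresh hz hm')

/-- The tilt right after an update of the threshold. -/
def updateTilt (μ : Fin N → ℝ) (d : ℕ) : ℝ :=
  min 1 ((d : ℝ) * (1 - 1 / N)) * ((⨅ n, μ n) / ∑ n, μ n)

lemma iInf_rate_le (μ : Fin N → ℝ) (n : Fin N) : ⨅ n, μ n ≤ μ n :=
  ciInf_le (Set.finite_range μ).bddBelow n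

lemma iInf_rate_pos [NeZero N] (hμ : ∀ n, 0 < μ n) : 0 < ⨅ n, μ n := by
  obtain ⟨n, hn⟩ := exists_eq_ciInf_of_finite (f := μ)
  rw [← hn]
  exact hμ n

lemma sum_rate_pos [NeZero N] (hμ : ∀ n, 0 < μ n) : 0 < ∑ j, μ j :=
  Finset.sum_pos (fun n _ => hμ n) Finset.univ_nonempty

lemma updateTilt_pos [NeZero N] (hN : 2 ≤ N) (hμ : ∀ n, 0 < μ n) (hd1 : 1 ≤ d) : 0 < updateTilt μ d := by
  have hN' : (2 : ℝ) ≤ N := by exact_mod_cast hN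
  have hd' : (1 : ℝ) ≤ d := by exact_mod_cast hd1
  have h1 : (1 : ℝ) / N < 1 := by
    rw [div_lt_one (by linarith)]
    linarith
  refine mul_pos (lt_min one_pos (mul_pos (by linarith) (by linarith))) ?_
  exact div_pos (iInf_rate_pos hμ) (sum_rate_pos hμ)

lemma updateTilt_le [NeZero N] (hμ : ∀ n, 0 < μ n) (n : Fin N) : updateTilt μ d ≤ μ n / ∑ j, μ j := by
  have h1 : (⨅ n, μ n) / ∑ n, μ n ≤ μ n / ∑ j, μ j :=
    div_le_div_of_nonneg_right (iInf_rate_le μ n) (sum_rate_pos hμ).le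
  have h2 : 0 ≤ (⨅ n, μ n) / ∑ n, μ n := (div_pos (iInf_rate_pos hμ) (sum_rate_pos hμ)).le
  refine (mul_le_of_le_one_left h2 (min_le_left _ _)).trans h1

/-- Let `U` be the set of queues above `l`. If the sample meets its complement, the threshold is at
most `l` and no arrival joins `U`; if not, `U` gets at most its share `w` of the rates. The gain
over `w` is thus `w` times the probability that the sample is not inside `U`, and `w` is at least
`U.card` times the smallest relative rate. -/
lemma ev_update_layer_le [NeZero N] (hμ : ∀ n, 0 < μ n) (hd1 : 1 ≤ d) (hd : d ≤ N) (i j : Fin N) (l : ℕ) :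
    ev (sampleServers d hd) (fun D => ev (weightedChoice μ hμ
        (Finset.univ.filter fun n => q n ≤ sInf (q '' (D : Set (Fin N)))))
        fun n => if l < q n then 1 else 0) ≤
      ∑ n, μ n / (∑ j, μ j) * (if l < q n then 1 else 0) -
        updateTilt μ d * if q i ≤ l ∧ l < q j then 1 else 0 := by
  have hfin : (sampleServers d hd).support.Finite := Set.toFinite _
  have hsh : ∀ τ : ℕ, IsShortest q (Finset.univ.filter fun n => q n ≤ τ) := by
    intro τ i hi j hj
    simp only [Finset.mem_filter, Finset.mem_univ, true_and] at hi ⊢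
    omega
  split_ifs with hij
  · obtain ⟨hi, hj⟩ := hij
    set U : Finset (Fin N) := Finset.univ.filter fun n => l < q n with hU
    set w := ∑ n, μ n / (∑ j, μ j) * (if l < q n then 1 else 0) with hw
    have hwU : U.card * ((⨅ n, μ n) / ∑ n, μ n) ≤ w := by
      have h1 : w = ∑ n ∈ U, μ n / ∑ j, μ j := by
        rw [hw, hU, Finset.sum_filter]
        exact Finset.sum_congr rfl fun n _ => by rw [mul_ite, mul_one, mul_zero]
      rw [h1, ← nsmul_eq_mul]
      exact Finset.card_nsmul_le_sum _ _ _ fun n _ =>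
        div_le_div_of_nonneg_right (iInf_rate_le μ n) (sum_rate_pos hμ).le
    have h1 : ∀ D ∈ (sampleServers d hd).support, ev (weightedChoice μ hμ
        (Finset.univ.filter fun n => q n ≤ sInf (q '' (D : Set (Fin N)))))
        (fun n => if l < q n then 1 else 0) ≤ w * if D ⊆ U then 1 else 0 := by
      intro D hD
      rw [sampleServers, PMF.mem_support_uniformOfFinset_iff, Finset.mem_powersetCard] at hD
      have hDne : D.Nonempty := Finset.card_pos.1 (by omega)
      split_ifs with hDU
      · rw [mul_one]
        exact ev_layer_weightedChoice_le hμ (hsh _) l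
      · rw [mul_zero]
        have hle := (sInf_image_le_iff hDne l).2 hDU
        have hne : (Finset.univ.filter fun n => q n ≤ sInf (q '' (D : Set (Fin N)))).Nonempty := by
          obtain ⟨n, -, hn⟩ := Nat.sInf_mem ((Finset.coe_nonempty.2 hDne).image q)
          exact ⟨n, by simp [hn]⟩
        rw [ev_eq_sum]
        refine (Finset.sum_eq_zero fun n _ => ?_).le
        rw [toReal_weightedChoice_of_nonempty hμ hne]
        by_cases hn : q n ≤ sInf (q '' (D : Set (Fin N)))
        · rw [if_neg (not_lt.2 (hn.trans hle)), mul_zero]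
        · rw [if_neg (by simpa using hn), zero_mul]
    refine (ev_mono hfin h1).trans ?_
    rw [ev_const_mul, ev_sampleServers_subset, mul_one]
    have hx1 : 1 ≤ U.card := Finset.card_pos.2 ⟨j, by simpa [hU] using hj⟩
    have hxN : U.card < N := by
      have : U.card < (Finset.univ : Finset (Fin N)).card :=
        Finset.card_lt_card (Finset.ssubset_univ_iff.2 fun h => by
          have : i ∈ U := h ▸ Finset.mem_univ i
          rw [hU, Finset.mem_filter] at this
          omega)
      simpa using this
    have hcomb := min_le_mul_one_sub_choose_div hd1 hd hx1 hxN
    have hm : 0 < (⨅ n, μ n) / ∑ n, μ n := div_pos (iInf_rate_pos hμ) (sum_rate_pos hμ)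
    have hprob : (U.card.choose d : ℝ) / N.choose d ≤ 1 := by
      refine div_le_one_of_le₀ ?_ (Nat.cast_nonneg _)
      exact_mod_cast Nat.choose_le_choose d hxN.le
    have h2 := mul_le_mul_of_nonneg_right hwU (sub_nonneg.2 hprob)
    have h3 := mul_le_mul_of_nonneg_right hcomb hm.le
    unfold updateTilt
    linarith
  · rw [mul_zero, sub_zero]
    refine (ev_mono hfin fun D _ => ev_layer_weightedChoice_le hμ (hsh _) l).trans ?_
    rw [ev_const]

lemma sum_layers {L n : ℕ} (h : n ≤ L) :
    ∑ l ∈ Finset.range L, (if l < n then (1 : ℝ) else 0) = n := by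
  rw [Finset.sum_boole]
  congr 1
  have : (Finset.range L).filter (fun l => l < n) = Finset.range n := by
    ext l
    simp only [Finset.mem_filter, Finset.mem_range]
    omega
  rw [this, Finset.card_range]

/-- Every level between `q i` and `q j` contributes a gain `updateTilt μ d`, and there are at least
`q j - q i` such levels. -/
lemma ev_meanDispatch_update_le [NeZero N] (hN : 2 ≤ N) (hd1 : 1 ≤ d) (hm : m.countdown = 0) (i j : Fin N) :
    ev ((JBTG μ hμ d T hd).meanDispatch (q, m)) (fun n => (q n : ℝ)) ≤
      ∑ n, μ n / (∑ j, μ j) * q n - updateTilt μ d * ((q j : ℝ) - q i) := by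
  have hL : ∀ n, q n ≤ ∑ j, q j := fun n =>
    Finset.single_le_sum (fun _ _ => Nat.zero_le _) (Finset.mem_univ n)
  set L := ∑ j, q j
  have hfin : (sampleServers d hd).support.Finite := Set.toFinite _
  have h1 : ∀ l : ℕ, ev ((JBTG μ hμ d T hd).meanDispatch (q, m)) (fun n => if l < q n then 1 else 0)
      ≤ ∑ n, μ n / (∑ j, μ j) * (if l < q n then 1 else 0) -
        updateTilt μ d * if q i ≤ l ∧ l < q j then 1 else 0 := by
    intro l
    rw [ev_meanDispatch, thresholdRefresh_update hm, ev_map hfin]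
    exact ev_update_layer_le hμ hd1 hd i j l
  rw [ev_eq_sum_layers _ hL]
  refine (Finset.sum_le_sum fun l _ => h1 l).trans ?_
  rw [Finset.sum_sub_distrib, Finset.sum_comm]
  refine sub_le_sub (le_of_eq ?_) ?_
  · refine Finset.sum_congr rfl fun n _ => ?_
    rw [← Finset.mul_sum, sum_layers (hL n)]
  · rw [← Finset.mul_sum]
    refine mul_le_mul_of_nonneg_left ?_ (updateTilt_pos hN hμ hd1).le
    rw [← sum_layers (hL i), ← sum_layers (hL j), ← Finset.sum_sub_distrib]
    refine Finset.sum_le_sum fun l _ => ?_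
    split_ifs <;> first | omega | norm_num

/-! ### The class `Π` -/

lemma deltaTilted_meanDispatch [NeZero N] (hN : 2 ≤ N) (hd1 : 1 ≤ d) (hT : 1 ≤ T) (r : ℕ) :
    ∀ z ∈ (JBTG μ hμ d T hd).possiblePre μ (r * T + 1),
      DeltaTiltedUpToEquiv (updateTilt μ d) μ z.1 ((JBTG μ hμ d T hd).meanDispatch z) := by
  rintro ⟨q, m⟩ ⟨s, ε, Amax, a, q₀, -, -, -, hz⟩
  have hm := countdown_preLaw q₀ (r * T + 1) hz
  rw [iterate_nextCountdown_update hT] at hm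
  exact deltaTiltedUpToEquiv_of_ev_le hN hμ (updateTilt_pos hN hμ hd1) (updateTilt_le hμ)
    fun i j => ev_meanDispatch_update_le hN hd1 hm i j

lemma inClassPi_JBTG [NeZero N] (hN : 2 ≤ N) (hd1 : 1 ≤ d) (hT : 1 ≤ T) :
    (JBTG μ hμ d T hd).InClassPi μ := by
  -- Windows of length `T` would fail for `T = 1`: the first of them is slot `0`, before any update.
  refine ⟨?_, T + 1, updateTilt μ d, Nat.succ_pos T, updateTilt_pos hN hμ hd1, fun k => ?_⟩
  · rintro t ⟨q, m⟩ ⟨s, ε, Amax, a, q₀, -, -, -, hz⟩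
    rw [Policy.law, PMF.mem_support_bind_iff] at hz
    obtain ⟨⟨q', m'⟩, hy, hz⟩ := hz
    obtain ⟨h1, h2⟩ := mem_support_report hz
    have hreg : RegularPre T (q', m') := regularPre_preLaw hT q₀ t hy
    obtain rfl : q = q' := h1
    exact isTilted_weightedChoice hN hμ (isShortest_of_mem_support_refresh hreg h2)
  · have hk : k * (T + 1) = k * T + k := by ring
    have hk2 : (k + 1) * (T + 1) = k * T + k + T + 1 := by ring
    -- The slot after the largest multiple of `T` not exceeding `k * (T + 1) + T - 1`.
    refine ⟨(k * T + k + T - 1) / T * T + 1, ?_, ?_, deltaTilted_meanDispatch hN hd1 hT _⟩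
    · have h := Nat.lt_div_mul_add (a := k * T + k + T - 1) (b := T) (by omega)
      omega
    · have := Nat.div_mul_le_self (k * T + k + T - 1) T
      omega

end Weighted

variable {N : ℕ}

/-! ### Drift of the Lyapunov functions -/

section Drift

/-- Concavity: the square root lies below its tangent at `w ^ 2`. This turns a quadratic drift
proportional to `w` into a constant drift of the norm. -/
lemma ev_sqrt_le {α : Type*} {p : PMF α} (hp : p.support.Finite) {V : α → ℝ} (hV : ∀ z, 0 ≤ V z)
    {w : ℝ} (hw : 0 < w) : ev p (fun z => √(V z)) ≤ w + (ev p V - w ^ 2) / (2 * w) := by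
  have h : ∀ z ∈ p.support, √(V z) ≤ (2 * w)⁻¹ * V z + w / 2 := by
    intro z _
    have h1 := Real.sq_sqrt (hV z)
    have h2 : √(V z) * (2 * w) ≤ V z + w ^ 2 := by nlinarith [sq_nonneg (√(V z) - w)]
    have h3 : (2 * w)⁻¹ * V z + w / 2 = (V z + w ^ 2) / (2 * w) := by
      field_simp
    rw [h3, le_div_iff₀ (by positivity)]
    exact h2
  refine (ev_mono hp h).trans (le_of_eq ?_)
  rw [ev_add hp, ev_const_mul, ev_const]
  field_simp
  ring

variable {π : Policy N} {a : PMF ℕ} {s : Fin N → PMF ℕ} {μ : Fin N → ℝ} {lam : ℝ}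
  {Amax Smax : ℕ}

lemma ev_quad_preStep_le (ha : ArrivalLaw lam Amax a)
    (hb : ∀ n, ∀ k ∈ (s n).support, k ≤ Smax) (hs : ServiceLaws μ s) {z : π.State}
    (hz : (π.refresh z.1 z.2).support.Finite) {c : ℝ} (hc : 0 ≤ c) (hc1 : c ≤ 1) :
    ev (π.preStep a s z) (fun y => quad c y.1) ≤ quad c z.1 +
      2 * N ^ 2 * ((Amax : ℝ) + Smax) ^ 2 +
      2 * N * (1 + c ^ 2) * (lam * ev (π.meanDispatch z) (fun n => (z.1 n : ℝ)) -
        ∑ n, (z.1 n : ℝ) * μ n) +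
      4 * c * (∑ n, (z.1 n : ℝ)) * (∑ n, μ n - lam) := by
  refine (ev_preStep_le ha hb hs hz fun m _ i A hA S hS =>
    quad_nextQueue_le hc hc1 hA hS).trans (le_of_eq ?_)
  rw [ev_sub (Set.toFinite _), ev_const, ev_const_mul]
  simp only [sub_mul, Finset.sum_sub_distrib, mul_assoc, ← Finset.mul_sum]
  ring

lemma abs_sqrt_quad_preStep_le (ha : ArrivalLaw lam Amax a)
    (hb : ∀ n, ∀ k ∈ (s n).support, k ≤ Smax) {z z' : π.State}
    (h : z' ∈ (π.preStep a s z).support) {c : ℝ} (hc : 0 ≤ c) (hc1 : c ≤ 1) :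
    |√(quad c z'.1) - √(quad c z.1)| ≤ 2 * N * ((Amax : ℝ) + Smax) := by
  obtain ⟨m, -, i, A, hA, S, hS, rfl⟩ := mem_support_preStep h
  exact abs_sqrt_quad_sub_le hc hc1 fun n => abs_nextQueue_sub_le (ha.1 A hA)
    (fun n => hb n _ (mem_support_of_mem_support_serviceLaw hS n)) n

lemma sqrt_quad_zero_le (q : Fin N → ℕ) : √(quad 0 q) ≤ N * ∑ n, (q n : ℝ) := by
  have h0 : (0 : ℝ) ≤ ∑ n, (q n : ℝ) := Finset.sum_nonneg fun n _ => (q n).cast_nonneg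
  rw [Real.sqrt_le_left (by positivity), quad_eq]
  have h1 : ∑ n, (q n : ℝ) ^ 2 ≤ (∑ n, (q n : ℝ)) ^ 2 :=
    Finset.sum_sq_le_sq_sum_of_nonneg fun n _ => (q n).cast_nonneg
  rcases Nat.eq_zero_or_pos N with h | h
  · subst h
    simp
  have h2 : (1 : ℝ) ≤ N := by exact_mod_cast h
  have h3 : (N : ℝ) * (∑ n, (q n : ℝ)) ^ 2 ≤ N ^ 2 * (∑ n, (q n : ℝ)) ^ 2 := by
    refine mul_le_mul_of_nonneg_right ?_ (sq_nonneg _)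
    nlinarith
  nlinarith

lemma le_sqrt_quad_zero (q : Fin N → ℕ) (n : Fin N) : (q n : ℝ) ≤ √(quad 0 q) := by
  refine Real.le_sqrt_of_sq_le ?_
  have h1 : ((q n : ℝ) - 0 * q n) ^ 2 ≤ ∑ j, ((q n : ℝ) - 0 * q j) ^ 2 :=
    Finset.single_le_sum (f := fun j => ((q n : ℝ) - 0 * q j) ^ 2) (fun _ _ => sq_nonneg _)
      (Finset.mem_univ n)
  have h2 : ∑ j, ((q n : ℝ) - 0 * q j) ^ 2 ≤ quad 0 q :=
    Finset.single_le_sum (f := fun i => ∑ j, ((q i : ℝ) - 0 * q j) ^ 2)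
      (fun _ _ => Finset.sum_nonneg fun _ _ => sq_nonneg _) (Finset.mem_univ n)
  rw [zero_mul, sub_zero] at h1
  exact h1.trans h2

lemma abs_sub_le_sqrt_quad_one (q : Fin N → ℕ) (i j : Fin N) :
    |(q i : ℝ) - q j| ≤ √(quad 1 q) := by
  refine Real.le_sqrt_of_sq_le ?_
  rw [sq_abs]
  have h1 : ((q i : ℝ) - 1 * q j) ^ 2 ≤ ∑ j, ((q i : ℝ) - 1 * q j) ^ 2 :=
    Finset.single_le_sum (f := fun j => ((q i : ℝ) - 1 * q j) ^ 2) (fun _ _ => sq_nonneg _)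
      (Finset.mem_univ j)
  have h2 : ∑ j, ((q i : ℝ) - 1 * q j) ^ 2 ≤ quad 1 q :=
    Finset.single_le_sum (f := fun i => ∑ j, ((q i : ℝ) - 1 * q j) ^ 2)
      (fun _ _ => Finset.sum_nonneg fun _ _ => sq_nonneg _) (Finset.mem_univ i)
  rw [one_mul] at h1
  exact h1.trans h2

lemma sqrt_quad_one_le {q : Fin N → ℕ} {D : ℝ} (hD : 0 ≤ D) (h : ∀ i j, |(q i : ℝ) - q j| ≤ D) :
    √(quad 1 q) ≤ N * D := by
  rw [Real.sqrt_le_left (by positivity)]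
  have h1 : ∀ i j : Fin N, ((q i : ℝ) - 1 * q j) ^ 2 ≤ D ^ 2 := by
    intro i j
    rw [one_mul, ← sq_abs]
    exact pow_le_pow_left₀ (abs_nonneg _) (h i j) 2
  refine (Finset.sum_le_sum fun i _ => Finset.sum_le_sum fun j _ => h1 i j).trans (le_of_eq ?_)
  simp
  ring

variable [NeZero N] {hμ : ∀ n, 0 < μ n} {d T : ℕ} {hd : d ≤ N}

/-- The chain of the states before refreshing under JBTG. -/
def jbtgStep (μ : Fin N → ℝ) (hμ : ∀ n, 0 < μ n) (d T : ℕ) (hd : d ≤ N) (a : PMF ℕ)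
    (s : Fin N → PMF ℕ) :
    (Fin N → ℕ) × ThresholdMemory N → PMF ((Fin N → ℕ) × ThresholdMemory N) :=
  (JBTG μ hμ d T hd).preStep a s

lemma finite_support_jbtgStep (ha : ArrivalLaw lam Amax a)
    (hb : ∀ n, ∀ k ∈ (s n).support, k ≤ Smax) (z : (Fin N → ℕ) × ThresholdMemory N) :
    (jbtgStep μ hμ d T hd a s z).support.Finite :=
  finite_support_preStep (π := JBTG μ hμ d T hd) ha hb (finite_support_thresholdRefresh)

lemma abs_sqrt_quad_jbtgStep_le (ha : ArrivalLaw lam Amax a)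
    (hb : ∀ n, ∀ k ∈ (s n).support, k ≤ Smax) {z z' : (Fin N → ℕ) × ThresholdMemory N}
    (h : z' ∈ (jbtgStep μ hμ d T hd a s z).support) {c : ℝ} (hc : 0 ≤ c) (hc1 : c ≤ 1) :
    |√(quad c z'.1) - √(quad c z.1)| ≤ 2 * N * ((Amax : ℝ) + Smax) :=
  abs_sqrt_quad_preStep_le (π := JBTG μ hμ d T hd) ha hb h hc hc1

lemma ev_quad_jbtgStep_le (ha : ArrivalLaw lam Amax a)
    (hb : ∀ n, ∀ k ∈ (s n).support, k ≤ Smax) (hs : ServiceLaws μ s) (q : Fin N → ℕ)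
    (m : ThresholdMemory N) {c : ℝ} (hc : 0 ≤ c) (hc1 : c ≤ 1) :
    ev (jbtgStep μ hμ d T hd a s (q, m)) (fun y => quad c y.1) ≤ quad c q +
      2 * N ^ 2 * ((Amax : ℝ) + Smax) ^ 2 +
      2 * N * (1 + c ^ 2) *
        (lam * ev ((JBTG μ hμ d T hd).meanDispatch (q, m)) (fun n => (q n : ℝ)) -
          ∑ n, (q n : ℝ) * μ n) +
      4 * c * (∑ n, (q n : ℝ)) * (∑ n, μ n - lam) :=
  ev_quad_preStep_le (π := JBTG μ hμ d T hd) (z := (q, m)) ha hb hs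
    (finite_support_thresholdRefresh) hc hc1

lemma countdown_of_mem_support_jbtgStep {z z' : (Fin N → ℕ) × ThresholdMemory N}
    (h : z' ∈ (jbtgStep μ hμ d T hd a s z).support) :
    z'.2.countdown = nextCountdown T z.2.countdown :=
  countdown_of_mem_support_preStep h

lemma regularPre_of_mem_support_jbtgStep {z z' : (Fin N → ℕ) × ThresholdMemory N}
    (hz : RegularPre T z) (h : z' ∈ (jbtgStep μ hμ d T hd a s z).support) : RegularPre T z' :=
  regularPre_of_mem_support_preStep hz h

lemma sum_rate_div_mul (hμ : ∀ n, 0 < μ n) (q : Fin N → ℕ) :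
    ∑ n, (q n : ℝ) * μ n = (∑ j, μ j) * ∑ n, μ n / (∑ j, μ j) * q n := by
  rw [Finset.mul_sum]
  refine Finset.sum_congr rfl fun n _ => ?_
  have := (sum_rate_pos hμ).ne'
  field_simp

/-- Negative drift of the norm of the queue lengths. -/
lemma exists_drift_norm (hμ : ∀ n, 0 < μ n) (hd : d ≤ N) (T : ℕ) {ε : ℝ} (hε : 0 < ε)
    (ha : ArrivalLaw (∑ n, μ n - ε) Amax a) (hb : ∀ n, ∀ k ∈ (s n).support, k ≤ Smax)
    (hs : ServiceLaws μ s) : ∃ c K B : ℝ, 0 < c ∧ c ≤ K ∧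
      ∀ z : (Fin N → ℕ) × ThresholdMemory N, RegularPre T z →
        (∀ z' ∈ (jbtgStep μ hμ d T hd a s z).support,
          |√(quad 0 z'.1) - √(quad 0 z.1)| ≤ K) ∧
        (B ≤ √(quad 0 z.1) →
          ev (jbtgStep μ hμ d T hd a s z) (fun z' => √(quad 0 z'.1)) ≤
            √(quad 0 z.1) - c) := by
  set M := ∑ n, μ n with hM
  have hM0 : 0 < M := sum_rate_pos hμ
  set k := (⨅ n, μ n) / M with hk
  have hk0 : 0 < k := div_pos (iInf_rate_pos hμ) hM0
  set C : ℝ := 2 * N ^ 2 * ((Amax : ℝ) + Smax) ^ 2 with hC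
  have hC0 : 0 ≤ C := by positivity
  have hN0 : (0 : ℝ) < N := by exact_mod_cast Nat.pos_of_ne_zero (NeZero.ne N)
  -- The drift of `quad 0` is at most `C - 2 * ε * k * w`. Above the level `C / (ε * k)` half of the
  -- negative part absorbs `C`, and division by `2 * w` leaves `-(ε * k / 2)`.
  refine ⟨ε * k / 2, 2 * N * ((Amax : ℝ) + Smax) + ε * k / 2, C / (ε * k) + 1, by positivity,
    le_add_of_nonneg_left (by positivity), ?_⟩
  rintro ⟨q, m⟩ hz
  refine ⟨fun z' hz' => (abs_sqrt_quad_jbtgStep_le ha hb hz' le_rfl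
    zero_le_one).trans (le_add_of_nonneg_right (by positivity)), fun hB => ?_⟩
  change C / (ε * k) + 1 ≤ √(quad 0 q) at hB
  change _ ≤ √(quad 0 q) - _
  set w := √(quad 0 q) with hw
  have hCk : 0 ≤ C / (ε * k) := by positivity
  have hw0 : 0 < w := by linarith
  have hwsq : w ^ 2 = quad 0 q := Real.sq_sqrt (quad_nonneg 0 q)
  have hfin := finite_support_jbtgStep (hμ := hμ) (d := d) (T := T) (hd := hd) ha hb (q, m)
  have h1 := ev_sqrt_le hfin (V := fun z' => quad 0 z'.1) (fun z' => quad_nonneg 0 z'.1) hw0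
  refine h1.trans ?_
  have h2 := ev_quad_jbtgStep_le (hμ := hμ) (d := d) (T := T) (hd := hd) ha hb hs q m
    le_rfl zero_le_one
  have h3 := ev_meanDispatch_le (hμ := hμ) (hd := hd) hz
  have h4 := mul_le_mul_of_nonneg_left h3 ha.nonneg
  have h5 := sum_rate_div_mul hμ q
  have h6 : k * ∑ n, (q n : ℝ) ≤ ∑ n, μ n / M * q n := by
    rw [Finset.mul_sum]
    exact Finset.sum_le_sum fun n _ => mul_le_mul_of_nonneg_right
      (div_le_div_of_nonneg_right (iInf_rate_le μ n) hM0.le) (Nat.cast_nonneg _)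
  have h7 := sqrt_quad_zero_le q
  simp only [← hM] at h2 h4 h5
  set e := ev ((JBTG μ hμ d T hd).meanDispatch (q, m)) (fun n => (q n : ℝ))
  set qb := ∑ n, μ n / M * q n
  set x := ∑ n, (q n : ℝ)
  set E := ev (jbtgStep μ hμ d T hd a s (q, m)) (fun y => quad 0 y.1)
  have h8 : E ≤ w ^ 2 + C - 2 * ε * k * w := by
    have h9 : N * ((M - ε) * e - ∑ n, (q n : ℝ) * μ n) ≤ N * (-(ε * qb)) := by
      refine mul_le_mul_of_nonneg_left ?_ hN0.le
      rw [h5]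
      linarith
    have h10 : ε * k * w ≤ ε * (N * qb) := by
      rw [mul_assoc]
      refine mul_le_mul_of_nonneg_left ?_ hε.le
      have h9' := mul_le_mul_of_nonneg_left h6 hN0.le
      have h10' := mul_le_mul_of_nonneg_left h7 hk0.le
      linarith
    rw [hwsq]
    simp only [zero_pow two_ne_zero, add_zero, mul_zero, zero_mul, mul_one] at h2
    linarith
  have h11 : C ≤ ε * k * w := by
    have : C / (ε * k) ≤ w := by linarith
    rwa [div_le_iff₀ (by positivity), mul_comm] at this
  have h12 : (E - w ^ 2) / (2 * w) ≤ -(ε * k / 2) := by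
    rw [div_le_iff₀ (by positivity)]
    linarith
  linarith

/-- Update slots: the tilt contributes `-(M * δ / 2) * D` or less, and `ε * D` spoils at most half
of it. With `w ≤ n * D` this becomes a drift proportional to `w`. -/
lemma quad_drift_update_le {E w C n M ε δ D e qb : ℝ} (hn : 0 ≤ n) (hM : 0 ≤ M) (hδ : 0 ≤ δ)
    (hD : 0 ≤ D) (hw : w ≤ n * D) (hεM : ε ≤ M / 2) (hεδ : ε ≤ M * δ / 4)
    (he : e ≤ qb - δ * D) (h : E ≤ w ^ 2 + C + 4 * n * ((M - ε) * (e - qb) + ε * D)) :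
    E - w ^ 2 ≤ C + 2 * (-(M * δ / 2)) * w := by
  have h1 : (M - ε) * (e - qb) ≤ (M - ε) * (-(δ * D)) :=
    mul_le_mul_of_nonneg_left (by linarith) (by linarith)
  have h2 : M / 2 * (δ * D) ≤ (M - ε) * (δ * D) :=
    mul_le_mul_of_nonneg_right (by linarith) (by positivity)
  have h3 : ε * D ≤ M * δ / 4 * D := mul_le_mul_of_nonneg_right hεδ hD
  have h4 : (M - ε) * (e - qb) + ε * D ≤ -(M * δ / 4 * D) := by linarith
  have h5 := mul_le_mul_of_nonneg_left h4 (by positivity : (0 : ℝ) ≤ 4 * n)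
  have h6 := mul_le_mul_of_nonneg_left hw (by positivity : (0 : ℝ) ≤ M * δ)
  linarith

/-- Other slots: weak tilt gives no contraction, and near capacity the growth caused by `ε * D` is
small compared with `η`. -/
lemma quad_drift_le {E w C n M ε η D e qb : ℝ} (hn : 0 ≤ n) (hε : 0 ≤ ε) (hw0 : 0 ≤ w)
    (hw : D ≤ w) (hεM : ε ≤ M) (hεη : ε * (8 * n) ≤ η) (he : e ≤ qb)
    (h : E ≤ w ^ 2 + C + 4 * n * ((M - ε) * (e - qb) + ε * D)) :
    E - w ^ 2 ≤ C + 2 * (η / 4) * w := by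
  have h1 : (M - ε) * (e - qb) ≤ 0 :=
    mul_nonpos_of_nonneg_of_nonpos (by linarith) (by linarith)
  have h2 : ε * D ≤ ε * w := mul_le_mul_of_nonneg_left hw hε
  have h3 : 4 * n * ((M - ε) * (e - qb) + ε * D) ≤ 4 * n * (ε * w) :=
    mul_le_mul_of_nonneg_left (by linarith) (by positivity)
  have h4 := mul_le_mul_of_nonneg_right hεη hw0
  linarith

/-- Negative drift of the imbalance of the queues, uniformly for arrival rates close to capacity. A
multiple of the time until the next update of the threshold is added to make the drift negative in
every slot. -/
lemma exists_drift_imbalance (hN : 2 ≤ N) (hμ : ∀ n, 0 < μ n) (hd1 : 1 ≤ d) (hd : d ≤ N)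
    (hT : 1 ≤ T) (hb : ∀ n, ∀ k ∈ (s n).support, k ≤ Smax)
    (hs : ServiceLaws μ s) (Amax : ℕ) : ∃ ε₁ η c K B : ℝ, 0 < ε₁ ∧ 0 < η ∧ 0 < c ∧ c ≤ K ∧
      ∀ ε ∈ Set.Ioo 0 ε₁, ∀ a : PMF ℕ, ArrivalLaw (∑ n, μ n - ε) Amax a →
      ∀ z : (Fin N → ℕ) × ThresholdMemory N, RegularPre T z →
        (∀ z' ∈ (jbtgStep μ hμ d T hd a s z).support,
          |(√(quad 1 z'.1) + η * z'.2.countdown) - (√(quad 1 z.1) + η * z.2.countdown)| ≤ K) ∧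
        (B ≤ √(quad 1 z.1) + η * z.2.countdown →
          ev (jbtgStep μ hμ d T hd a s z) (fun z' => √(quad 1 z'.1) + η * z'.2.countdown) ≤
            √(quad 1 z.1) + η * z.2.countdown - c) := by
  set M := ∑ n, μ n with hM
  have hM0 : 0 < M := sum_rate_pos hμ
  set δ := updateTilt μ d with hδ
  have hδ0 : 0 < δ := updateTilt_pos hN hμ hd1
  set C : ℝ := 2 * N ^ 2 * ((Amax : ℝ) + Smax) ^ 2 with hC
  have hC0 : 0 ≤ C := by positivity
  have hN0 : (0 : ℝ) < N := by exact_mod_cast Nat.pos_of_ne_zero (NeZero.ne N)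
  have hT0 : (1 : ℝ) ≤ T := by exact_mod_cast hT
  -- An update changes the norm by at most `-M * δ / 2 + η / 4` and raises the countdown term by at
  -- most `η * T = M * δ / 4`. In another slot the norm grows by at most `η / 4 + η / 4` while the
  -- countdown term falls by `η`. In both cases the drift is at most `-η / 2`.
  set η := M * δ / (4 * T) with hη
  have hη0 : 0 < η := by positivity
  have hηT : η * T = M * δ / 4 := by
    rw [hη]
    field_simp
  refine ⟨min (M / 2) (min (M * δ / 4) (η / (8 * N))), η, η / 2,
    2 * N * ((Amax : ℝ) + Smax) + η * T + η / 2, η * T + 2 * C / η + 1, ?_, hη0, by positivity,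
    le_add_of_nonneg_left (by positivity), ?_⟩
  · exact lt_min (by positivity) (lt_min (by positivity) (by positivity))
  rintro ε ⟨hε, hε1⟩ a ha ⟨q, m⟩ hz
  obtain ⟨hεM, hε2⟩ := lt_min_iff.1 hε1
  obtain ⟨hεδ, hεη⟩ := lt_min_iff.1 hε2
  have hcd : (m.countdown : ℝ) ≤ T := by exact_mod_cast hz.1
  have hcd0 : (0 : ℝ) ≤ m.countdown := Nat.cast_nonneg _
  have hncd : (nextCountdown T m.countdown : ℝ) ≤ T := by exact_mod_cast nextCountdown_le hz.1
  have hncd0 : (0 : ℝ) ≤ nextCountdown T m.countdown := Nat.cast_nonneg _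
  refine ⟨fun z' hz' => ?_, fun hB => ?_⟩
  · have h1 := abs_sqrt_quad_jbtgStep_le ha hb hz' zero_le_one le_rfl
    rw [countdown_of_mem_support_jbtgStep hz']
    have h2 : |η * (nextCountdown T m.countdown : ℝ) - η * m.countdown| ≤ η * T := by
      rw [← mul_sub, abs_mul, abs_of_pos hη0]
      refine mul_le_mul_of_nonneg_left ?_ hη0.le
      rw [abs_le]
      constructor <;> linarith
    have h3 := abs_le.1 h1
    have h4 := abs_le.1 h2
    simp only [] at h3 h4 ⊢
    rw [abs_le]
    constructor <;> linarith [h3.1, h3.2, h4.1, h4.2]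
  change _ ≤ √(quad 1 q) + η * m.countdown at hB
  change _ ≤ √(quad 1 q) + η * m.countdown - _
  have hfin := finite_support_jbtgStep (hμ := hμ) (d := d) (T := T) (hd := hd) ha hb (q, m)
  have hsplit : ev (jbtgStep μ hμ d T hd a s (q, m))
      (fun z' => √(quad 1 z'.1) + η * z'.2.countdown) =
      ev (jbtgStep μ hμ d T hd a s (q, m)) (fun z' => √(quad 1 z'.1)) +
        η * nextCountdown T m.countdown := by
    rw [← ev_const (jbtgStep μ hμ d T hd a s (q, m)) (η * nextCountdown T m.countdown),
      ← ev_add hfin]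
    exact ev_congr fun z' hz' => by rw [countdown_of_mem_support_jbtgStep hz']
  rw [hsplit]
  set w := √(quad 1 q) with hw
  have hηcd : η * m.countdown ≤ η * T := mul_le_mul_of_nonneg_left hcd hη0.le
  have hCη : 0 ≤ 2 * C / η := by positivity
  have hw0 : 0 < w := by linarith
  have hCw : 2 * C ≤ η * w := by
    have : 2 * C / η ≤ w := by linarith
    rwa [div_le_iff₀ hη0, mul_comm w] at this
  have hwsq : w ^ 2 = quad 1 q := Real.sq_sqrt (quad_nonneg 1 q)
  have h1 := ev_sqrt_le hfin (V := fun z' => quad 1 z'.1) (fun z' => quad_nonneg 1 z'.1) hw0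
  obtain ⟨i, -, hi⟩ := Finset.exists_min_image Finset.univ q Finset.univ_nonempty
  obtain ⟨j, -, hj⟩ := Finset.exists_max_image Finset.univ q Finset.univ_nonempty
  have hi' : ∀ n, (q i : ℝ) ≤ q n := fun n => by exact_mod_cast hi n (Finset.mem_univ n)
  have hj' : ∀ n, (q n : ℝ) ≤ q j := fun n => by exact_mod_cast hj n (Finset.mem_univ n)
  set D : ℝ := (q j : ℝ) - q i with hD
  have hD0 : 0 ≤ D := sub_nonneg.2 (hi' j)
  have hDw : D ≤ w := (le_abs_self _).trans (abs_sub_le_sqrt_quad_one q j i)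
  have hwD : w ≤ N * D := sqrt_quad_one_le hD0 fun a b => by
    rw [abs_le]
    constructor <;> linarith [hi' a, hi' b, hj' a, hj' b]
  have h2 := ev_quad_jbtgStep_le (hμ := hμ) (d := d) (T := T) (hd := hd) ha hb hs q m
    zero_le_one le_rfl
  have h5 := sum_rate_div_mul hμ q
  have h3 := ev_meanDispatch_le (hμ := hμ) (hd := hd) hz
  have h3u := fun hm : m.countdown = 0 =>
    ev_meanDispatch_update_le (hμ := hμ) (hd := hd) (q := q) (T := T) hN hd1 hm i j
  simp only [← hM] at h2 h3 h3u h5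
  have hqb : (q i : ℝ) ≤ ∑ n, μ n / M * q n := by
    have : ∑ n, μ n / M * (q i : ℝ) = q i := by
      rw [← Finset.sum_mul, ← Finset.sum_div, ← hM, div_self hM0.ne', one_mul]
    rw [← this]
    exact Finset.sum_le_sum fun n _ => mul_le_mul_of_nonneg_left (hi' n)
      (div_nonneg (hμ n).le hM0.le)
  have hx : ∑ n, (q n : ℝ) ≤ N * q j := by
    have := Finset.sum_le_card_nsmul Finset.univ (fun n => (q n : ℝ)) (q j) fun n _ => hj' n
    simpa using this
  set e := ev ((JBTG μ hμ d T hd).meanDispatch (q, m)) (fun n => (q n : ℝ))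
  set qb := ∑ n, μ n / M * q n
  set x := ∑ n, (q n : ℝ)
  set E := ev (jbtgStep μ hμ d T hd a s (q, m)) (fun y => quad 1 y.1)
  -- The spare capacity enters with `-ε * qb` from the squares and `ε` times the total from the
  -- cross terms; these cancel up to `ε * D`, as the total is at most `N * (qb + D)`.
  have h6 : E ≤ w ^ 2 + C + 4 * N * ((M - ε) * (e - qb) + ε * D) := by
    have h7 : x * ε ≤ N * (ε * (qb + D)) := by
      have : x ≤ N * (qb + D) := hx.trans (mul_le_mul_of_nonneg_left (by linarith) hN0.le)
      linarith [mul_le_mul_of_nonneg_right this hε.le]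
    rw [h5] at h2
    rw [hwsq]
    linarith
  have hlam : M / 2 ≤ M - ε := by linarith
  have hdrift : ∀ g : ℝ, E - w ^ 2 ≤ C + 2 * g * w →
      ev (jbtgStep μ hμ d T hd a s (q, m)) (fun z' => √(quad 1 z'.1)) ≤ w + η / 4 + g := by
    intro g hg
    refine h1.trans ?_
    rw [add_assoc]
    refine add_le_add_right ?_ _
    rw [div_le_iff₀ (by positivity)]
    linarith
  by_cases hm : m.countdown = 0
  · have h15 := hdrift _ (quad_drift_update_le hN0.le hM0.le hδ0.le hD0 hwD hεM.le hεδ.le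
      (h3u hm) h6)
    have h17 : η * nextCountdown T m.countdown ≤ η * T := mul_le_mul_of_nonneg_left hncd hη0.le
    have h18 : η ≤ η * T := le_mul_of_one_le_right hη0.le hT0
    have hm0 : η * (m.countdown : ℝ) = 0 := by rw [hm, Nat.cast_zero, mul_zero]
    rw [hm0]
    linarith
  · have h15 := hdrift _ (quad_drift_le hN0.le hε.le hw0.le hDw (by linarith)
      ((lt_div_iff₀ (by positivity)).1 hεη).le h3 h6)
    have h16 : (nextCountdown T m.countdown : ℝ) = m.countdown - 1 := by
      rw [nextCountdown, if_neg hm, Nat.cast_sub (Nat.pos_of_ne_zero hm), Nat.cast_one]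
    rw [h16]
    linarith

end Drift

variable {N : ℕ}

/-! ### Stationary laws before and after the refreshing -/

section Stationary

variable {π : Policy N} {a : PMF ℕ} {s : Fin N → PMF ℕ}

lemma isStationary_bind_report {ν : PMF π.State} (h : ν.bind (π.preStep a s) = ν) :
    π.IsStationary a s (ν.bind π.report) := by
  have h1 : ((ν.bind π.report).bind (π.slot a s)) = ν := by
    rw [PMF.bind_bind]
    exact h
  rw [Policy.IsStationary, ← PMF.bind_bind, h1]

lemma Policy.IsStationary.bind_slot_bind_report {ν : PMF π.State} (h : π.IsStationary a s ν) :
    (ν.bind (π.slot a s)).bind π.report = ν := by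
  rw [PMF.bind_bind]
  exact h

lemma Policy.IsStationary.bind_slot {ν : PMF π.State} (h : π.IsStationary a s ν) :
    (ν.bind (π.slot a s)).bind (π.preStep a s) = ν.bind (π.slot a s) := by
  change (ν.bind (π.slot a s)).bind (fun z => (π.report z).bind (π.slot a s)) = _
  rw [← PMF.bind_bind, h.bind_slot_bind_report]

lemma mean_bind_report (p : PMF π.State) (f : (Fin N → ℕ) → ℝ≥0∞) :
    mean (p.bind π.report) (fun z => f z.1) = mean p fun z => f z.1 := by
  rw [mean_bind]
  refine mean_congr fun z _ => ?_
  rw [Policy.report, mean_map]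
  exact mean_const (π.refresh z.1 z.2) (f z.1)

end Stationary

/-! ### Throughput optimality -/

section Throughput

variable {μ : Fin N → ℝ} {hμ : ∀ n, 0 < μ n} {d T : ℕ} {hd : d ≤ N} {a : PMF ℕ}
  {s : Fin N → PMF ℕ} {Amax Smax : ℕ}

/-- The laws before refreshing under JBTG. -/
def jbtgPre [NeZero N] (μ : Fin N → ℝ) (hμ : ∀ n, 0 < μ n) (d T : ℕ) (hd : d ≤ N) (a : PMF ℕ)
    (s : Fin N → PMF ℕ) (q₀ : Fin N → ℕ) (t : ℕ) : PMF ((Fin N → ℕ) × ThresholdMemory N) :=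
  (JBTG μ hμ d T hd).preLaw a s q₀ t

lemma jbtgPre_zero [NeZero N] (q₀ : Fin N → ℕ) : jbtgPre μ hμ d T hd a s q₀ 0 = PMF.pure (q₀, ⟨∅, ⊥, 1⟩) :=
  rfl

lemma jbtgPre_succ [NeZero N] (q₀ : Fin N → ℕ) (t : ℕ) : jbtgPre μ hμ d T hd a s q₀ (t + 1) =
    (jbtgPre μ hμ d T hd a s q₀ t).bind (jbtgStep μ hμ d T hd a s) :=
  preLaw_succ _ a s q₀ t

lemma regularPre_init (hT : 1 ≤ T) (q₀ : Fin N → ℕ) : RegularPre T (q₀, ⟨∅, ⊥, 1⟩) :=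
  ⟨hT, Or.inr fun i hi => absurd hi (Finset.notMem_empty i)⟩

lemma exists_mean_exp_norm_le [NeZero N] (hμ : ∀ n, 0 < μ n) (d : ℕ) (hd : d ≤ N) (hT : 1 ≤ T) {ε : ℝ}
    (hε : 0 < ε) (ha : ArrivalLaw (∑ n, μ n - ε) Amax a) (hs : ServiceLaws μ s) (q₀ : Fin N → ℕ) :
    ∃ (θ : ℝ) (M : ℝ≥0∞), 0 < θ ∧ M ≠ ⊤ ∧ ∀ t, mean (jbtgPre μ hμ d T hd a s q₀ t)
      (fun z => ENNReal.ofReal (Real.exp (θ * √(quad 0 z.1)))) ≤ M := by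
  obtain ⟨Smax, hb⟩ := hs.1
  obtain ⟨c, K, B, hc, hcK, h⟩ := exists_drift_norm hμ (d := d) hd T hε ha hb hs
  have hK := hc.trans_le hcK
  obtain ⟨M, hM, hmean⟩ := exists_mean_exp_le_of_recursion (G := {z | RegularPre T z})
    (jbtgPre_succ (μ := μ) (hμ := hμ) (d := d) (T := T) (hd := hd) (a := a) (s := s) q₀)
    (jbtgPre_zero q₀) (regularPre_init hT q₀)
    (fun z hz z' hz' => regularPre_of_mem_support_jbtgStep hz hz') hc hcK
    (fun z _ => finite_support_jbtgStep ha hb z) (fun z hz => (h z hz).1) (fun z hz => (h z hz).2)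
  exact ⟨_, M, by positivity, hM, hmean⟩

lemma sum_le_mul_sqrt_quad_zero (q : Fin N → ℕ) : ((∑ n, q n : ℕ) : ℝ) ≤ N * √(quad 0 q) := by
  push_cast
  have := Finset.sum_le_card_nsmul Finset.univ (fun n => (q n : ℝ)) _
    fun n _ => le_sqrt_quad_zero q n
  simpa using this

/-- Markov's inequality for the exponential moment, which is bounded uniformly in time, gives a tail
exponentially small in `C`. -/
lemma throughputOptimal_JBTG [NeZero N] (hT : 1 ≤ T) : (JBTG μ hμ d T hd).ThroughputOptimal μ := by
  intro s hs ε hε Amax a ha q₀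
  obtain ⟨θ, M, hθ, hM, hmean⟩ := exists_mean_exp_norm_le hμ d hd hT hε ha hs q₀
  have hN0 : (0 : ℝ) < N := by exact_mod_cast Nat.pos_of_ne_zero (NeZero.ne N)
  have hbound : ∀ C t : ℕ, (((JBTG μ hμ d T hd).law a s q₀ t).map
      (JBTG μ hμ d T hd).total).toMeasure (Set.Ioi C) ≤
      M * ENNReal.ofReal (Real.exp (-(θ / N * C))) := by
    intro C t
    have h1 := toMeasure_mul_le_mean (((JBTG μ hμ d T hd).law a s q₀ t).map
      (JBTG μ hμ d T hd).total) (fun k => ENNReal.ofReal (Real.exp (θ / N * k))) (Set.Ioi C)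
      (ENNReal.ofReal (Real.exp (θ / N * C))) fun k hk => by
        refine ENNReal.ofReal_le_ofReal (Real.exp_le_exp.2 ?_)
        have : (C : ℝ) ≤ k := by exact_mod_cast (Set.mem_Ioi.1 hk).le
        gcongr
    rw [mean_map, Policy.law] at h1
    have h2 := mean_bind_report ((JBTG μ hμ d T hd).preLaw a s q₀ t)
      fun q => ENNReal.ofReal (Real.exp (θ / N * ((∑ n, q n : ℕ) : ℝ)))
    have h3 : mean (jbtgPre μ hμ d T hd a s q₀ t)
        (fun z => ENNReal.ofReal (Real.exp (θ / N * ((∑ n, z.1 n : ℕ) : ℝ)))) ≤ M := by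
      refine le_trans (mean_mono fun z _ => ENNReal.ofReal_le_ofReal (Real.exp_le_exp.2 ?_))
        (hmean t)
      rw [div_mul_eq_mul_div, div_le_iff₀ hN0]
      have := mul_le_mul_of_nonneg_left (sum_le_mul_sqrt_quad_zero z.1) hθ.le
      linarith
    have h4 := (h1.trans (le_of_eq h2)).trans h3
    rw [mul_comm, ← ENNReal.le_div_iff_mul_le (Or.inl (by simp [Real.exp_pos]))
      (Or.inl ENNReal.ofReal_ne_top)] at h4
    refine h4.trans (le_of_eq ?_)
    rw [Real.exp_neg, ENNReal.ofReal_inv_of_pos (Real.exp_pos _), div_eq_mul_inv]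
  have hlim : Tendsto (fun C : ℕ => M * ENNReal.ofReal (Real.exp (-(θ / N * C)))) atTop (𝓝 0) := by
    have h1 : Tendsto (fun C : ℕ => Real.exp (-(θ / N * C))) atTop (𝓝 0) := by
      refine Real.tendsto_exp_neg_atTop_nhds_zero.comp ?_
      exact tendsto_natCast_atTop_atTop.const_mul_atTop (by positivity)
    have h2 := ENNReal.Tendsto.const_mul (a := M) (ENNReal.tendsto_ofReal h1) (Or.inr hM)
    rwa [ENNReal.ofReal_zero, mul_zero] at h2
  refine le_antisymm ?_ zero_le
  rw [← hlim.limsup_eq]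
  refine limsup_le_limsup (Eventually.of_forall fun C => ?_)
  exact limsup_le_of_le (h := Eventually.of_forall fun t => hbound C t)

/-! ### Existence of a stationary law under JBTG. -/

/-- Regular states with a threshold not larger than the queues at the last update can have been. -/
def BoundedPre (T R : ℕ) (z : (Fin N → ℕ) × ThresholdMemory N) : Prop :=
  RegularPre T z ∧
    z.2.threshold ≤ ((∑ n, z.1 n + (T - z.2.countdown) * R : ℕ) : WithBot ℕ)

/-- A new threshold is at most the total queue length at its update, and the total drops by at most
`N * Smax` per slot; `T - countdown` counts the slots since. The sample must be nonempty only for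
the bound on the new threshold. -/
lemma boundedPre_of_mem_support_jbtgStep [NeZero N] (hd1 : 1 ≤ d) (hT : 1 ≤ T)
    (hb : ∀ n, ∀ k ∈ (s n).support, k ≤ Smax) {z z' : (Fin N → ℕ) × ThresholdMemory N}
    (hz : BoundedPre T (N * Smax) z) (h : z' ∈ (jbtgStep μ hμ d T hd a s z).support) :
    BoundedPre T (N * Smax) z' := by
  refine ⟨regularPre_of_mem_support_jbtgStep hz.1 h, ?_⟩
  obtain ⟨q, m⟩ := z
  obtain ⟨m', hm', i, A, -, S, hS, rfl⟩ := exists_of_mem_support_preStep_threshold h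
  have h1 := threshold_le_of_mem_support_refresh hd1 (B := ∑ n, q n)
    (fun n => Finset.single_le_sum (fun _ _ => Nat.zero_le _) (Finset.mem_univ n)) hm'
  have h2 := countdown_of_mem_support_refresh hm'
  have h3 := sum_add_le_sum_nextQueue q i A S
  have h4 := sum_service_le hb hS
  have h5 : m.countdown ≤ T := hz.1.1
  have h6 := hz.2
  simp only [] at h6 ⊢
  rw [h2]
  split_ifs at h1 with hc
  · refine h1.trans ?_
    rw [nextCountdown, if_pos hc, Nat.sub_sub_self hT, one_mul]
    exact_mod_cast (by omega)
  · rw [h1, nextCountdown, if_neg hc]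
    refine h6.trans ?_
    have h7 : T - (m.countdown - 1) = (T - m.countdown) + 1 := by omega
    rw [h7, add_mul, one_mul]
    exact_mod_cast (by omega)

lemma finite_boundedPre (R C : ℕ) :
    {z : (Fin N → ℕ) × ThresholdMemory N | BoundedPre T R z ∧ ∀ n, z.1 n ≤ C}.Finite := by
  have h1 : (Set.Iic (fun _ : Fin N => C)).Finite := Set.finite_Iic _
  have h2 : (Set.univ : Set (Finset (Fin N))).Finite := Set.finite_univ
  have h3 : (Set.Iic ((N * C + T * R : ℕ) : WithBot ℕ)).Finite := Set.finite_Iic _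
  have h4 : (Set.Iic T).Finite := Set.finite_Iic _
  refine ((h1.prod (h2.prod (h3.prod h4))).image
    fun x => (x.1, (⟨x.2.1, x.2.2.1, x.2.2.2⟩ : ThresholdMemory N))).subset ?_
  rintro ⟨q, ids, thr, cd⟩ ⟨⟨hreg, hthr⟩, hq⟩
  refine ⟨(q, ids, thr, cd), ⟨hq, Set.mem_univ _, le_trans hthr ?_, hreg.1⟩, rfl⟩
  have h5 : ∑ n, q n ≤ N * C := by
    have := Finset.sum_le_card_nsmul Finset.univ q C fun n _ => hq n
    simpa using this
  have h6 : (T - cd) * R ≤ T * R := Nat.mul_le_mul_right _ (Nat.sub_le _ _)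
  exact_mod_cast Nat.add_le_add h5 h6

lemma exists_isStationary_JBTG [NeZero N] (hd1 : 1 ≤ d) (hT : 1 ≤ T) {ε : ℝ} (hε : 0 < ε)
    (ha : ArrivalLaw (∑ n, μ n - ε) Amax a) (hs : ServiceLaws μ s) :
    ∃ ν, (JBTG μ hμ d T hd).IsStationary a s ν := by
  classical
  obtain ⟨Smax, hb⟩ := hs.1
  obtain ⟨θ, M, hθ, hM, hmean⟩ := exists_mean_exp_norm_le hμ d hd hT hε ha hs fun _ => 0
  -- Queue lengths alone do not confine the threshold. The value `⊤` off the reachable set makes the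
  -- sublevel sets finite and does not change the means along the chain.
  let V : (Fin N → ℕ) × ThresholdMemory N → ℝ≥0∞ := fun z =>
    if BoundedPre T (N * Smax) z then ENNReal.ofReal (Real.exp (θ * √(quad 0 z.1))) else ⊤
  have hsupp := support_subset_of_recursion (G := {z | BoundedPre T (N * Smax) z})
    (jbtgPre_succ (μ := μ) (hμ := hμ) (d := d) (T := T) (hd := hd) (a := a) (s := s) fun _ => 0)
    (by
      rw [jbtgPre_zero, PMF.support_pure, Set.singleton_subset_iff]
      exact ⟨regularPre_init hT _, bot_le⟩)
    (fun z hz z' hz' => boundedPre_of_mem_support_jbtgStep hd1 hT hb hz hz')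
  have hV : ∀ t, mean (jbtgPre μ hμ d T hd a s (fun _ => 0) t) V ≤ M := fun t =>
    (mean_mono fun z hz => (if_pos (hsupp t hz)).le).trans (hmean t)
  obtain ⟨ν, hν⟩ := exists_stationary
    (jbtgPre_succ (μ := μ) (hμ := hμ) (d := d) (T := T) (hd := hd) (a := a) (s := s) fun _ => 0)
    hM hV fun n => by
      obtain ⟨C, hC⟩ := exists_nat_ge (n / θ)
      refine (finite_boundedPre (T := T) (N * Smax) C).subset fun z hz => ?_
      simp only [Set.mem_ofPred_eq, V] at hz
      split_ifs at hz with hzb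
      · refine ⟨hzb, fun i => ?_⟩
        rw [← ENNReal.ofReal_natCast, ENNReal.ofReal_le_ofReal_iff (Nat.cast_nonneg n)] at hz
        have h1 := Real.add_one_le_exp (θ * √(quad 0 z.1))
        have h2 := mul_le_mul_of_nonneg_left (le_sqrt_quad_zero z.1 i) hθ.le
        have h3 : (z.1 i : ℝ) ≤ n / θ := by
          rw [le_div_iff₀ hθ]
          linarith
        exact_mod_cast h3.trans hC
      · simp at hz
  exact ⟨_, isStationary_bind_report (π := JBTG μ hμ d T hd) hν⟩

end Throughput

variable {N : ℕ}

/-! ### Heavy traffic: balance of the second moments -/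

section Balance

variable {β : Type*} {μ : Fin N → ℝ} {s : Fin N → PMF ℕ} {a : PMF ℕ} {ε : ℝ} {Amax Smax : ℕ}

/-- The law `η` together with independent arrivals and services. -/
def withInputs (η : PMF β) (a : PMF ℕ) (s : Fin N → PMF ℕ) : PMF (β × ℕ × (Fin N → ℕ)) :=
  η.bind fun b => a.bind fun A => (serviceLaw s).map fun S => (b, A, S)

lemma mean_withInputs (η : PMF β) (a : PMF ℕ) (s : Fin N → PMF ℕ)
    (f : β × ℕ × (Fin N → ℕ) → ℝ≥0∞) : mean (withInputs η a s) f =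
      mean η fun b => mean a fun A => mean (serviceLaw s) fun S => f (b, A, S) := by
  simp only [withInputs, mean_bind, mean_map]

lemma mem_support_withInputs {η : PMF β} {w : β × ℕ × (Fin N → ℕ)}
    (h : w ∈ (withInputs η a s).support) : w.2.2 ∈ (serviceLaw s).support := by
  simp only [withInputs, PMF.mem_support_bind_iff, PMF.support_map] at h
  obtain ⟨b, -, A, -, S, hS, rfl⟩ := h
  exact hS

lemma mean_sum_serviceLaw (hb : ∀ n, ∀ k ∈ (s n).support, k ≤ Smax) (hs : ServiceLaws μ s) :
    mean (serviceLaw s) (fun S => ((∑ n, S n : ℕ) : ℝ≥0∞)) = ENNReal.ofReal (∑ n, μ n) := by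
  rw [← ev_sum_serviceLaw hb hs, ofReal_ev_natCast (finite_support_serviceLaw hb)]

/-- Idle capacity of a slot with workload `x` before and `y` after it. -/
def idle (x : β → ℕ) (y : β × ℕ × (Fin N → ℕ) → ℕ) (w : β × ℕ × (Fin N → ℕ)) : ℕ :=
  y w + ∑ n, w.2.2 n - (x w.1 + w.2.1)

/-- Both systems satisfy `y + ∑ S = x + A + idle`, with `x` and `y` equally distributed. Taking
means gives mean idle capacity `ε`; squaring gives the balance. The finite second moment is needed
to cancel the common term. -/
lemma mean_idle_and_balance (ha : ArrivalLaw (∑ n, μ n - ε) Amax a)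
    (hb : ∀ n, ∀ k ∈ (s n).support, k ≤ Smax) (hs : ServiceLaws μ s) (hε : 0 < ε) {η : PMF β}
    {x : β → ℕ} {y : β × ℕ × (Fin N → ℕ) → ℕ}
    (hy : ∀ w, x w.1 + w.2.1 ≤ y w + ∑ n, w.2.2 n)
    (hst : ∀ f : ℕ → ℝ≥0∞, mean (withInputs η a s) (fun w => f (y w)) = mean η fun b => f (x b))
    (hfin : mean η (fun b => ((x b ^ 2 : ℕ) : ℝ≥0∞)) ≠ ⊤) :
    mean η (fun b => (x b : ℝ≥0∞)) ≠ ⊤ ∧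
    mean (withInputs η a s) (fun w => (idle x y w : ℝ≥0∞)) = ENNReal.ofReal ε ∧
    2 * ENNReal.ofReal ε * mean η (fun b => (x b : ℝ≥0∞)) +
        2 * ENNReal.ofReal (∑ n, μ n - ε) * ENNReal.ofReal (∑ n, μ n) +
        mean (withInputs η a s) (fun w => ((idle x y w ^ 2 : ℕ) : ℝ≥0∞)) =
      mean a (fun A => ((A ^ 2 : ℕ) : ℝ≥0∞)) +
        mean (serviceLaw s) (fun S => (((∑ n, S n) ^ 2 : ℕ) : ℝ≥0∞)) +
        2 * mean (withInputs η a s) (fun w => ((y w * idle x y w : ℕ) : ℝ≥0∞)) := by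
  have hX : mean η (fun b => (x b : ℝ≥0∞)) ≠ ⊤ := by
    refine ne_top_of_le_ne_top hfin (mean_mono fun b _ => ?_)
    exact_mod_cast Nat.le_self_pow two_ne_zero _
  have hu : ∀ w, y w + ∑ n, w.2.2 n = x w.1 + w.2.1 + idle x y w := by
    intro w
    have := hy w
    unfold idle
    omega
  have hM : ENNReal.ofReal (∑ n, μ n) = ENNReal.ofReal (∑ n, μ n - ε) + ENNReal.ofReal ε := by
    rw [← ENNReal.ofReal_add ha.nonneg hε.le, sub_add_cancel]
  have mS : mean (withInputs η a s) (fun w => ((∑ n, w.2.2 n : ℕ) : ℝ≥0∞)) =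
      ENNReal.ofReal (∑ n, μ n) := by
    rw [mean_withInputs]
    simp only [mean_sum_serviceLaw hb hs, mean_const]
  have mA : mean (withInputs η a s) (fun w => (w.2.1 : ℝ≥0∞)) = ENNReal.ofReal (∑ n, μ n - ε) := by
    rw [mean_withInputs]
    simp only [mean_const, ha.mean_eq]
  have mX : mean (withInputs η a s) (fun w => (x w.1 : ℝ≥0∞)) = mean η (fun b => (x b : ℝ≥0∞)) := by
    rw [mean_withInputs]
    simp only [mean_const]
  refine ⟨hX, ?_, ?_⟩
  · have h1 : mean (withInputs η a s) (fun w => (y w : ℝ≥0∞) + ((∑ n, w.2.2 n : ℕ) : ℝ≥0∞)) =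
        mean (withInputs η a s) (fun w => ((x w.1 : ℝ≥0∞) + w.2.1) + idle x y w) :=
      mean_congr fun w _ => by exact_mod_cast hu w
    rw [mean_add, mean_add, mean_add, mS, mA, mX, hst fun k => (k : ℝ≥0∞), hM, add_assoc] at h1
    have h2 := (ENNReal.add_right_inj hX).1 h1
    exact ((ENNReal.add_right_inj ENNReal.ofReal_ne_top).1 h2).symm
  · have mXS : mean (withInputs η a s) (fun w => ((x w.1 * ∑ n, w.2.2 n : ℕ) : ℝ≥0∞)) =
        mean η (fun b => (x b : ℝ≥0∞)) * ENNReal.ofReal (∑ n, μ n) := by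
      rw [mean_withInputs]
      simp only [Nat.cast_mul, mean_const_mul, mean_sum_serviceLaw hb hs, mean_const,
        mean_mul_const]
    have mAS : mean (withInputs η a s) (fun w => ((w.2.1 * ∑ n, w.2.2 n : ℕ) : ℝ≥0∞)) =
        ENNReal.ofReal (∑ n, μ n - ε) * ENNReal.ofReal (∑ n, μ n) := by
      rw [mean_withInputs]
      simp only [Nat.cast_mul, mean_const_mul, mean_sum_serviceLaw hb hs, mean_const,
        mean_mul_const, ha.mean_eq]
    have mXA : mean (withInputs η a s) (fun w => ((x w.1 * w.2.1 : ℕ) : ℝ≥0∞)) =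
        mean η (fun b => (x b : ℝ≥0∞)) * ENNReal.ofReal (∑ n, μ n - ε) := by
      rw [mean_withInputs]
      simp only [Nat.cast_mul, mean_const, mean_const_mul, ha.mean_eq, mean_mul_const]
    have mA2 : mean (withInputs η a s) (fun w => ((w.2.1 ^ 2 : ℕ) : ℝ≥0∞)) =
        mean a (fun A => ((A ^ 2 : ℕ) : ℝ≥0∞)) := by
      rw [mean_withInputs]
      simp only [mean_const]
    have mS2 : mean (withInputs η a s) (fun w => (((∑ n, w.2.2 n) ^ 2 : ℕ) : ℝ≥0∞)) =
        mean (serviceLaw s) (fun S => (((∑ n, S n) ^ 2 : ℕ) : ℝ≥0∞)) := by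
      rw [mean_withInputs]
      simp only [mean_const]
    have mX2 : mean (withInputs η a s) (fun w => ((x w.1 ^ 2 : ℕ) : ℝ≥0∞)) =
        mean η (fun b => ((x b ^ 2 : ℕ) : ℝ≥0∞)) := by
      rw [mean_withInputs]
      simp only [mean_const]
    have mY2 : mean (withInputs η a s) (fun w => ((y w ^ 2 : ℕ) : ℝ≥0∞)) =
        mean η (fun b => ((x b ^ 2 : ℕ) : ℝ≥0∞)) := hst fun k => ((k ^ 2 : ℕ) : ℝ≥0∞)
    have h1 : mean (withInputs η a s) (fun w => (((y w ^ 2 : ℕ) : ℝ≥0∞) +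
          2 * ((x w.1 * ∑ n, w.2.2 n : ℕ) : ℝ≥0∞) + 2 * ((w.2.1 * ∑ n, w.2.2 n : ℕ) : ℝ≥0∞)) +
          ((idle x y w ^ 2 : ℕ) : ℝ≥0∞)) =
        mean (withInputs η a s) (fun w => (((x w.1 ^ 2 : ℕ) : ℝ≥0∞) +
          2 * ((x w.1 * w.2.1 : ℕ) : ℝ≥0∞) + ((w.2.1 ^ 2 : ℕ) : ℝ≥0∞) +
          (((∑ n, w.2.2 n) ^ 2 : ℕ) : ℝ≥0∞)) + 2 * ((y w * idle x y w : ℕ) : ℝ≥0∞)) := by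
      refine mean_congr fun w _ => ?_
      have h := hu w
      -- The square of `y - idle = x + A - ∑ S`, with all negative terms moved across so that it
      -- makes sense in `ℝ≥0∞`.
      have h2 : y w ^ 2 + 2 * (x w.1 * ∑ n, w.2.2 n) + 2 * (w.2.1 * ∑ n, w.2.2 n) +
          idle x y w ^ 2 = x w.1 ^ 2 + 2 * (x w.1 * w.2.1) + w.2.1 ^ 2 + (∑ n, w.2.2 n) ^ 2 +
          2 * (y w * idle x y w) := by
        zify at h ⊢
        have h3 : (y w : ℤ) = x w.1 + w.2.1 + idle x y w - ∑ n, (w.2.2 n : ℤ) := by linarith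
        rw [h3]
        ring
      exact_mod_cast h2
    simp only [mean_add, mean_const_mul, mXS, mAS, mXA, mA2, mS2, mX2, mY2] at h1
    rw [hM] at h1 ⊢
    set X := mean η (fun b => (x b : ℝ≥0∞))
    set X2 := mean η (fun b => ((x b ^ 2 : ℕ) : ℝ≥0∞))
    set l := ENNReal.ofReal (∑ n, μ n - ε)
    set e := ENNReal.ofReal ε
    have hc : X2 + 2 * (X * l) ≠ ⊤ := ENNReal.add_ne_top.2 ⟨hfin, ENNReal.mul_ne_top (by simp)
      (ENNReal.mul_ne_top hX ENNReal.ofReal_ne_top)⟩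
    refine (ENNReal.add_right_inj hc).1 ?_
    refine Eq.trans ?_ (h1.trans ?_) <;> ring

/-- The scaled workload up to an error of the order of `ε` and the cross term. -/
lemma abs_workload_sub_le (ha : ArrivalLaw (∑ n, μ n - ε) Amax a)
    (hb : ∀ n, ∀ k ∈ (s n).support, k ≤ Smax) (hs : ServiceLaws μ s) (hε : 0 < ε) {η : PMF β}
    {x : β → ℕ} {y : β × ℕ × (Fin N → ℕ) → ℕ}
    (hy : ∀ w, x w.1 + w.2.1 ≤ y w + ∑ n, w.2.2 n) (hy' : ∀ w, y w ≤ x w.1 + w.2.1)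
    (hst : ∀ f : ℕ → ℝ≥0∞, mean (withInputs η a s) (fun w => f (y w)) = mean η fun b => f (x b))
    (hfin : mean η (fun b => ((x b ^ 2 : ℕ) : ℝ≥0∞)) ≠ ⊤) {g : ℝ} (hg0 : 0 ≤ g)
    (hg : mean (withInputs η a s) (fun w => ((idle x y w ^ 2 : ℕ) : ℝ≥0∞)) ≤
        ENNReal.ofReal (N * Smax * ε) →
      mean (withInputs η a s) (fun w => ((y w * idle x y w : ℕ) : ℝ≥0∞)) ≤ ENNReal.ofReal g) :
    mean η (fun b => (x b : ℝ≥0∞)) ≠ ⊤ ∧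
    |ε * (mean η (fun b => (x b : ℝ≥0∞))).toReal -
      (ProbabilityTheory.variance (fun k : ℕ => (k : ℝ)) a.toMeasure + (∑ n, μ n - ε) ^ 2 +
        ev (serviceLaw s) (fun S => (((∑ n, S n) ^ 2 : ℕ) : ℝ)) -
        2 * (∑ n, μ n - ε) * ∑ n, μ n) / 2| ≤ N * Smax * ε / 2 + g := by
  obtain ⟨hX, hu, hbal⟩ := mean_idle_and_balance ha hb hs hε hy hst hfin
  refine ⟨hX, ?_⟩
  have hU2 : mean (withInputs η a s) (fun w => ((idle x y w ^ 2 : ℕ) : ℝ≥0∞)) ≤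
      ENNReal.ofReal (N * Smax * ε) := by
    -- Idle capacity is at most the offered service, so its second moment is at most `N * Smax`
    -- times its mean `ε`.
    have h1 : ∀ w ∈ (withInputs η a s).support, ((idle x y w ^ 2 : ℕ) : ℝ≥0∞) ≤
        ((N * Smax : ℕ) : ℝ≥0∞) * idle x y w := by
      intro w hw
      have h2 := sum_service_le hb (mem_support_withInputs hw)
      have h3 : idle x y w ≤ N * Smax := by
        have := hy' w
        unfold idle
        omega
      have h4 : idle x y w ^ 2 ≤ N * Smax * idle x y w := by
        rw [sq]
        exact Nat.mul_le_mul_right _ h3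
      exact_mod_cast h4
    refine (mean_mono h1).trans ?_
    rw [mean_const_mul, hu, ← ENNReal.ofReal_natCast, ← ENNReal.ofReal_mul (Nat.cast_nonneg _)]
    push_cast
    exact le_rfl
  have hYU := hg hU2
  have hM0 : 0 ≤ ∑ n, μ n := by linarith [ha.nonneg]
  rw [← ofReal_ev_natCast ha.finite_support, ← ofReal_ev_natCast (finite_support_serviceLaw hb),
    ha.ev_sq_eq] at hbal
  set V := ProbabilityTheory.variance (fun k : ℕ => (k : ℝ)) a.toMeasure
  set σ := ev (serviceLaw s) (fun S => (((∑ n, S n) ^ 2 : ℕ) : ℝ)) with hσ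
  have hσ0 : 0 ≤ σ := ev_nonneg _ fun S => Nat.cast_nonneg _
  have hV0 : 0 ≤ V := ProbabilityTheory.variance_nonneg _ _
  set X := mean η (fun b => (x b : ℝ≥0∞))
  set U2 := mean (withInputs η a s) (fun w => ((idle x y w ^ 2 : ℕ) : ℝ≥0∞))
  set YU := mean (withInputs η a s) (fun w => ((y w * idle x y w : ℕ) : ℝ≥0∞))
  have hU2t : U2 ≠ ⊤ := ne_top_of_le_ne_top ENNReal.ofReal_ne_top hU2
  have hYUt : YU ≠ ⊤ := ne_top_of_le_ne_top ENNReal.ofReal_ne_top hYU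
  have hU2r : U2.toReal ≤ N * Smax * ε := by
    have := ENNReal.toReal_mono ENNReal.ofReal_ne_top hU2
    rwa [ENNReal.toReal_ofReal (by positivity)] at this
  have hYUr : YU.toReal ≤ g := by
    have := ENNReal.toReal_mono ENNReal.ofReal_ne_top hYU
    rwa [ENNReal.toReal_ofReal hg0] at this
  have hU20 : 0 ≤ U2.toReal := ENNReal.toReal_nonneg
  have hYU0 : 0 ≤ YU.toReal := ENNReal.toReal_nonneg
  have hreal := congrArg ENNReal.toReal hbal
  rw [ENNReal.toReal_add (by finiteness) hU2t, ENNReal.toReal_add (by finiteness) (by finiteness),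
    ENNReal.toReal_add (by finiteness) (by finiteness),
    ENNReal.toReal_add (by finiteness) (by finiteness)] at hreal
  simp only [ENNReal.toReal_mul, ENNReal.toReal_ofNat, ENNReal.toReal_ofReal hε.le,
    ENNReal.toReal_ofReal hM0, ENNReal.toReal_ofReal ha.nonneg, ENNReal.toReal_ofReal hσ0,
    ENNReal.toReal_ofReal (add_nonneg hV0 (sq_nonneg (∑ n, μ n - ε)))] at hreal
  rw [abs_le]
  constructor <;> linarith

end Balance

/-- From the balance of the second moments to the limit of the scaled mean workload. -/
lemma tendsto_scaled_workload {X : ℝ → ℝ≥0∞} {V : ℝ → ℝ} {v σ M ε₁ : ℝ} {g : ℝ → ℝ} (hε₁ : 0 < ε₁)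
    (hV : Tendsto V (𝓝[>] 0) (𝓝 v)) (hg : Tendsto g (𝓝[>] 0) (𝓝 0))
    (h : ∀ ε ∈ Set.Ioo 0 ε₁, X ε ≠ ⊤ ∧
      |ε * (X ε).toReal - (V ε + (M - ε) ^ 2 + σ - 2 * (M - ε) * M) / 2| ≤ g ε) :
    Tendsto (fun ε => ENNReal.ofReal ε * X ε) (𝓝[>] 0)
      (𝓝 (ENNReal.ofReal ((v + σ - M ^ 2) / 2))) := by
  have hmem : ∀ᶠ ε in 𝓝[>] (0 : ℝ), ε ∈ Set.Ioo 0 ε₁ := Ioo_mem_nhdsGT hε₁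
  have hid : Tendsto (fun ε : ℝ => ε) (𝓝[>] 0) (𝓝 0) := nhdsWithin_le_nhds
  have hl : Tendsto (fun ε => (V ε + (M - ε) ^ 2 + σ - 2 * (M - ε) * M) / 2) (𝓝[>] 0)
      (𝓝 ((v + σ - M ^ 2) / 2)) := by
    have hM : Tendsto (fun ε : ℝ => M - ε) (𝓝[>] 0) (𝓝 (M - 0)) := tendsto_const_nhds.sub hid
    have h1 := (((hV.add (hM.pow 2)).add (tendsto_const_nhds (x := σ))).sub
      ((hM.const_mul 2).mul_const M)).div_const 2
    convert h1 using 2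
    ring
  have hdiff : Tendsto (fun ε => ε * (X ε).toReal -
      (V ε + (M - ε) ^ 2 + σ - 2 * (M - ε) * M) / 2) (𝓝[>] 0) (𝓝 0) :=
    squeeze_zero_norm' (hmem.mono fun ε hε => (h ε hε).2) hg
  have hreal := hdiff.add hl
  simp only [sub_add_cancel, zero_add] at hreal
  refine (ENNReal.tendsto_ofReal hreal).congr' (hmem.mono fun ε hε => ?_)
  rw [ENNReal.ofReal_mul hε.1.le, ENNReal.ofReal_toReal (h ε hε).1]

variable {N : ℕ}

lemma sq_le_mul_exp {θ x : ℝ} (hθ : 0 < θ) (hx : 0 ≤ x) :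
    x ^ 2 ≤ 2 / θ ^ 2 * Real.exp (θ * x) := by
  have h := Real.quadratic_le_exp_of_nonneg (mul_nonneg hθ.le hx)
  rw [div_mul_eq_mul_div, le_div_iff₀ (by positivity)]
  nlinarith [mul_nonneg hθ.le hx]

lemma expect_eq_mean (ρ : PMF ℕ) : expect ρ = mean ρ fun k => (k : ℝ≥0∞) :=
  lintegral_toMeasure_eq_mean ρ _

/-! ### The resource-pooled system -/

section Pooled

variable {μ : Fin N → ℝ} {s : Fin N → PMF ℕ} {a : PMF ℕ} {ε : ℝ} {Amax Smax : ℕ}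

lemma pooledStep_eq (a : PMF ℕ) (s : Fin N → PMF ℕ) (q : ℕ) : pooledStep a s q =
    a.bind fun A => (serviceLaw s).map fun S => q + A - ∑ n, S n := by
  unfold pooledStep
  simp only [← PMF.bind_pure_comp]
  rfl

lemma mem_support_pooledStep {q q' : ℕ} (h : q' ∈ (pooledStep a s q).support) :
    ∃ A ∈ a.support, ∃ S ∈ (serviceLaw s).support, q' = q + A - ∑ n, S n := by
  simp only [pooledStep, PMF.mem_support_bind_iff, PMF.support_pure,
    Set.mem_singleton_iff] at h
  exact h

/-- From the level `N * Smax` on, no service is wasted and the drift is exactly `-ε`. The summand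
`ε` in the bound on increments only serves to have it dominate the drift. -/
lemma pooled_drift (ha : ArrivalLaw (∑ n, μ n - ε) Amax a)
    (hb : ∀ n, ∀ k ∈ (s n).support, k ≤ Smax) (hs : ServiceLaws μ s) (hε : 0 < ε) (q : ℕ) :
    (pooledStep a s q).support.Finite ∧
    (∀ q' ∈ (pooledStep a s q).support, |(q' : ℝ) - q| ≤ Amax + N * Smax + ε) ∧
    (((N * Smax : ℕ) : ℝ) ≤ q → ev (pooledStep a s q) (fun k => (k : ℝ)) ≤ q - ε) := by
  have hS := finite_support_serviceLaw hb
  refine ⟨?_, fun q' hq' => ?_, fun hq => ?_⟩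
  · rw [pooledStep_eq]
    exact finite_support_bind ha.finite_support fun _ _ => finite_support_map hS _
  · obtain ⟨A, hA, S, hS, rfl⟩ := mem_support_pooledStep hq'
    have h1 := ha.1 A hA
    have h2 := sum_service_le hb hS
    have h3 : q + A - ∑ n, S n ≤ q + Amax := by omega
    have h4 : q ≤ q + A - ∑ n, S n + N * Smax := by omega
    have h3' : ((q + A - ∑ n, S n : ℕ) : ℝ) ≤ q + Amax := by exact_mod_cast h3
    have h4' : (q : ℝ) ≤ ((q + A - ∑ n, S n : ℕ) : ℝ) + N * Smax := by exact_mod_cast h4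
    rw [abs_le]
    have h5 : (0 : ℝ) ≤ N * Smax := by positivity
    have h6 : (0 : ℝ) ≤ Amax := by positivity
    constructor <;> linarith
  · have hq' : N * Smax ≤ q := by exact_mod_cast hq
    rw [pooledStep_eq, ev_bind ha.finite_support fun _ _ => finite_support_map hS _]
    have h1 : ∀ A : ℕ, ev ((serviceLaw s).map fun S => q + A - ∑ n, S n) (fun k => (k : ℝ)) =
        (q + A) - ∑ n, μ n := by
      intro A
      rw [ev_map hS, ← ev_sum_serviceLaw hb hs, ← ev_const (serviceLaw s) ((q : ℝ) + A),
        ← ev_sub hS]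
      refine ev_congr fun S hS => ?_
      have := sum_service_le hb hS
      rw [Nat.cast_sub (by omega), Nat.cast_add]
    simp only [h1]
    rw [ev_sub ha.finite_support, ev_add ha.finite_support, ev_const, ev_const, ha.ev_eq]
    linarith

lemma pooled_const_le : ε ≤ (Amax : ℝ) + N * Smax + ε :=
  le_add_of_nonneg_left (by positivity)

lemma exists_isPooledStationary (ha : ArrivalLaw (∑ n, μ n - ε) Amax a) (hs : ServiceLaws μ s)
    (hε : 0 < ε) : ∃ ρ, IsPooledStationary a s ρ := by
  obtain ⟨Smax, hb⟩ := hs.1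
  have hdrift := pooled_drift ha hb hs hε
  let p : ℕ → PMF ℕ := fun t => (fun r : PMF ℕ => r.bind (pooledStep a s))^[t] (PMF.pure 0)
  have hp : ∀ t, p (t + 1) = (p t).bind (pooledStep a s) := fun t =>
    Function.iterate_succ_apply' _ _ _
  obtain ⟨M, hM, hmean⟩ := exists_mean_exp_le_of_recursion (G := Set.univ) hp
    (z₀ := 0) rfl (Set.mem_univ _) (fun z _ => Set.subset_univ _) (W := fun q : ℕ => (q : ℝ))
    hε (pooled_const_le (N := N) (Amax := Amax) (Smax := Smax)) (fun z _ => (hdrift z).1)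
    (fun z _ => (hdrift z).2.1) (fun z _ => (hdrift z).2.2)
  refine exists_stationary hp hM hmean fun n => ?_
  set θ := ε / (2 * ((Amax : ℝ) + N * Smax + ε) ^ 2) with hθ
  have hθ0 : 0 < θ := by positivity
  obtain ⟨C, hC⟩ := exists_nat_ge (n / θ)
  refine (Set.finite_Iic C).subset fun q hq => ?_
  rw [Set.mem_ofPred_eq, ← ENNReal.ofReal_natCast,
    ENNReal.ofReal_le_ofReal_iff (Nat.cast_nonneg n)] at hq
  have h1 := Real.add_one_le_exp (θ * q)
  have h2 : (q : ℝ) ≤ n / θ := by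
    rw [le_div_iff₀ hθ0]
    linarith
  have h3 : (q : ℝ) ≤ C := h2.trans hC
  exact_mod_cast h3

/-- A single server wastes capacity only if its queue ends the slot empty, so the cross term is
zero; this is the `0` in the error. -/
lemma pooled_workload (ha : ArrivalLaw (∑ n, μ n - ε) Amax a)
    (hb : ∀ n, ∀ k ∈ (s n).support, k ≤ Smax) (hs : ServiceLaws μ s) (hε : 0 < ε) {ρ : PMF ℕ}
    (hρ : IsPooledStationary a s ρ) : expect ρ ≠ ⊤ ∧
    |ε * (expect ρ).toReal -
      (ProbabilityTheory.variance (fun k : ℕ => (k : ℝ)) a.toMeasure + (∑ n, μ n - ε) ^ 2 +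
        ev (serviceLaw s) (fun S => (((∑ n, S n) ^ 2 : ℕ) : ℝ)) -
        2 * (∑ n, μ n - ε) * ∑ n, μ n) / 2| ≤ N * Smax * ε / 2 + 0 := by
  have hdrift := pooled_drift ha hb hs hε
  have hexp := mean_exp_le_of_stationary hρ (W := fun q : ℕ => (q : ℝ)) hε
    (pooled_const_le (N := N) (Amax := Amax) (Smax := Smax)) (fun z _ => (hdrift z).1)
    (fun z _ => (hdrift z).2.1) (fun z _ => (hdrift z).2.2)
  have htop := exp_bound_ne_top hε (pooled_const_le (N := N) (Amax := Amax) (Smax := Smax))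
    (Real.exp (ε / (2 * ((Amax : ℝ) + N * Smax + ε) ^ 2) * (((N * Smax : ℕ) : ℝ) +
      ((Amax : ℝ) + N * Smax + ε))))
  have hfin : mean ρ (fun b => ((b ^ 2 : ℕ) : ℝ≥0∞)) ≠ ⊤ := by
    have hθ0 : 0 < ε / (2 * ((Amax : ℝ) + N * Smax + ε) ^ 2) := by positivity
    refine ne_top_of_le_ne_top (ENNReal.mul_ne_top (ENNReal.ofReal_ne_top
      (r := 2 / (ε / (2 * ((Amax : ℝ) + N * Smax + ε) ^ 2)) ^ 2))
      (ne_top_of_le_ne_top htop hexp)) ?_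
    rw [← mean_const_mul]
    refine mean_mono fun q _ => ?_
    rw [← ENNReal.ofReal_mul (by positivity), ← ENNReal.ofReal_natCast, Nat.cast_pow]
    exact ENNReal.ofReal_le_ofReal (sq_le_mul_exp hθ0 (Nat.cast_nonneg q))
  rw [expect_eq_mean]
  refine abs_workload_sub_le (x := fun q : ℕ => q) (y := fun w => w.1 + w.2.1 - ∑ n, w.2.2 n)
    ha hb hs hε (fun w => by omega) (fun w => by omega) (fun f => ?_) hfin le_rfl fun _ => ?_
  · conv_rhs => rw [← show ρ.bind (pooledStep a s) = ρ from hρ]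
    rw [mean_withInputs, mean_bind]
    refine mean_congr fun q _ => ?_
    simp only [pooledStep_eq, mean_bind, mean_map]
  · refine mean_le_const fun w _ => ?_
    have : (w.1 + w.2.1 - ∑ n, w.2.2 n) * idle (fun q : ℕ => q)
        (fun w => w.1 + w.2.1 - ∑ n, w.2.2 n) w = 0 := by
      rw [mul_eq_zero]
      simp only [idle]
      omega
    rw [this]
    simp

end Pooled

/-! ### The load balancing system in heavy traffic -/

section HeavyTraffic

variable {μ : Fin N → ℝ} {hμ : ∀ n, 0 < μ n} {d T : ℕ} {hd : d ≤ N}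
  {s : Fin N → PMF ℕ} {a : PMF ℕ} {ε : ℝ} {Amax Smax : ℕ} {π : Policy N}

lemma Policy.IsStationary.mean_bind_slot {ν : PMF π.State} (h : π.IsStationary a s ν)
    (f : (Fin N → ℕ) → ℝ≥0∞) :
    mean (ν.bind (π.slot a s)) (fun z => f z.1) = mean ν fun z => f z.1 := by
  rw [← mean_bind_report, h.bind_slot_bind_report]

/-- State and chosen server in a stationary slot. -/
def withServer (ν : PMF π.State) : PMF (π.State × Fin N) :=
  ν.bind fun z => (π.dispatch z.1 z.2).map fun i => (z, i)

lemma mean_withServer (ν : PMF π.State) (f : (Fin N → ℕ) → ℝ≥0∞) :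
    mean (withServer ν) (fun b => f b.1.1) = mean ν fun z => f z.1 := by
  simp only [withServer, mean_bind, mean_map, mean_const]

lemma Policy.IsStationary.mean_nextQueue {ν : PMF π.State} (h : π.IsStationary a s ν)
    (f : (Fin N → ℕ) → ℝ≥0∞) : mean (withInputs (withServer ν) a s)
      (fun w => f (nextQueue w.1.1.1 w.1.2 w.2.1 w.2.2)) = mean ν fun z => f z.1 := by
  rw [← h.mean_bind_slot, mean_withInputs, withServer, mean_bind, mean_bind]
  refine mean_congr fun z _ => ?_
  simp only [Policy.slot, mean_bind, mean_map, mean_pure]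
  rfl

lemma sum_nextQueue_le (q : Fin N → ℕ) (i : Fin N) (A : ℕ) (S : Fin N → ℕ) :
    ∑ n, nextQueue q i A S n ≤ ∑ n, q n + A := by
  have h : ∑ n, (if n = i then A else 0) = A := by simp
  nth_rewrite 2 [← h]
  rw [← Finset.sum_add_distrib]
  refine Finset.sum_le_sum fun n _ => ?_
  unfold nextQueue
  omega

/-- A queue at which capacity is wasted is empty, so that the workload is bounded by the imbalance
in such a slot. -/
lemma sum_nextQueue_mul_idle_le (q : Fin N → ℕ) (i : Fin N) (A : ℕ) (S : Fin N → ℕ) :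
    ((∑ n, nextQueue q i A S n : ℕ) : ℝ) *
        ((∑ n, nextQueue q i A S n + ∑ n, S n - (∑ n, q n + A) : ℕ) : ℝ) ≤
      N * √(quad 1 (nextQueue q i A S)) *
        ((∑ n, nextQueue q i A S n + ∑ n, S n - (∑ n, q n + A) : ℕ) : ℝ) := by
  set q' := nextQueue q i A S with hq'
  -- Idle capacity of server `n`; it is zero unless `q' n = 0`, so `q' n * U j` may be replaced by
  -- `(q' n - q' j) * U j`.
  let U : Fin N → ℕ := fun n => q' n + S n - (q n + if n = i then A else 0)
  have hU : ∀ n, q' n + S n = q n + (if n = i then A else 0) + U n := by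
    intro n
    have h : q' n = q n + (if n = i then A else 0) - S n := rfl
    simp only [U]
    omega
  have hU0 : ∀ n, q' n * U n = 0 := by
    intro n
    have h : q' n = q n + (if n = i then A else 0) - S n := rfl
    rw [mul_eq_zero]
    simp only [U]
    omega
  have hsum : ∑ n, q' n + ∑ n, S n - (∑ n, q n + A) = ∑ n, U n := by
    have h : ∑ n, (if n = i then A else 0) = A := by simp
    have h2 : ∑ n, q' n + ∑ n, S n = ∑ n, q n + A + ∑ n, U n := by
      rw [← Finset.sum_add_distrib, Finset.sum_congr rfl fun n _ => hU n,
        Finset.sum_add_distrib, Finset.sum_add_distrib, h]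
    omega
  rw [hsum]
  push_cast
  rw [Finset.mul_sum, Finset.mul_sum]
  refine Finset.sum_le_sum fun j _ => ?_
  have h1 : (∑ n, (q' n : ℝ)) * U j = ∑ n, ((q' n : ℝ) - q' j) * U j := by
    rw [Finset.sum_mul]
    refine Finset.sum_congr rfl fun n _ => ?_
    have : (q' j : ℝ) * U j = 0 := by exact_mod_cast hU0 j
    rw [sub_mul, this, sub_zero]
  rw [h1]
  have h2 := Finset.sum_le_card_nsmul Finset.univ (fun n => ((q' n : ℝ) - q' j) * U j)
    (√(quad 1 q') * U j) fun n _ => mul_le_mul_of_nonneg_right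
      ((le_abs_self _).trans (abs_sub_le_sqrt_quad_one q' n j)) (Nat.cast_nonneg _)
  refine h2.trans (le_of_eq ?_)
  simp
  ring

/-- With imbalance `r` and idle capacity `u` the cross term is at most `N * r * u`. Since `r ^ 2`
has bounded mean and `u ^ 2` has mean of order `ε`, the inequality of means with weights `√ε` and `1
/ √ε` bounds it by a multiple of `√ε`. -/
lemma jbtg_workload (ha : ArrivalLaw (∑ n, μ n - ε) Amax a)
    (hb : ∀ n, ∀ k ∈ (s n).support, k ≤ Smax) (hs : ServiceLaws μ s) (hε : 0 < ε)
    {ν : PMF π.State} (hν : π.IsStationary a s ν)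
    (hfin : mean ν (fun z => (((∑ n, z.1 n) ^ 2 : ℕ) : ℝ≥0∞)) ≠ ⊤) {Q : ℝ} (hQ0 : 0 ≤ Q)
    (hQ : mean ν (fun z => ENNReal.ofReal (quad 1 z.1)) ≤ ENNReal.ofReal Q) :
    expect (ν.map π.total) ≠ ⊤ ∧
    |ε * (expect (ν.map π.total)).toReal -
      (ProbabilityTheory.variance (fun k : ℕ => (k : ℝ)) a.toMeasure + (∑ n, μ n - ε) ^ 2 +
        ev (serviceLaw s) (fun S => (((∑ n, S n) ^ 2 : ℕ) : ℝ)) -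
        2 * (∑ n, μ n - ε) * ∑ n, μ n) / 2| ≤
      N * Smax * ε / 2 + N / 2 * (Q + N * Smax) * √ε := by
  have hX : expect (ν.map π.total) =
      mean (withServer ν) fun b => ((∑ n, b.1.1 n : ℕ) : ℝ≥0∞) := by
    rw [expect_eq_mean, mean_map, mean_withServer ν fun q => ((∑ n, q n : ℕ) : ℝ≥0∞)]
    rfl
  have hε' : 0 < √ε := Real.sqrt_pos.2 hε
  rw [hX]
  refine abs_workload_sub_le (x := fun b : π.State × Fin N => ∑ n, b.1.1 n)
    (y := fun w => ∑ n, nextQueue w.1.1.1 w.1.2 w.2.1 w.2.2 n) ha hb hs hε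
    (fun w => sum_add_le_sum_nextQueue _ _ _ _) (fun w => sum_nextQueue_le _ _ _ _)
    (fun f => ?_) ?_ (by positivity) fun hU2 => ?_
  · rw [hν.mean_nextQueue fun q => f (∑ n, q n), mean_withServer ν fun q => f (∑ n, q n)]
  · rwa [mean_withServer ν fun q => (((∑ n, q n) ^ 2 : ℕ) : ℝ≥0∞)]
  · set x : π.State × Fin N → ℕ := fun b => ∑ n, b.1.1 n
    set y : (π.State × Fin N) × ℕ × (Fin N → ℕ) → ℕ :=
      fun w => ∑ n, nextQueue w.1.1.1 w.1.2 w.2.1 w.2.2 n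
    have h1 : ∀ w, ((y w * idle x y w : ℕ) : ℝ≥0∞) ≤ ENNReal.ofReal (N * √ε / 2) *
        ENNReal.ofReal (quad 1 (nextQueue w.1.1.1 w.1.2 w.2.1 w.2.2)) +
        ENNReal.ofReal (N / (2 * √ε)) * ((idle x y w ^ 2 : ℕ) : ℝ≥0∞) := by
      intro w
      have h2 := sum_nextQueue_mul_idle_le w.1.1.1 w.1.2 w.2.1 w.2.2
      change (y w : ℝ) * (idle x y w : ℝ) ≤ _ * (idle x y w : ℝ) at h2
      have h3 := Real.sq_sqrt (quad_nonneg 1 (nextQueue w.1.1.1 w.1.2 w.2.1 w.2.2))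
      rw [← ENNReal.ofReal_natCast, ← ENNReal.ofReal_natCast, ← ENNReal.ofReal_mul (by positivity),
        ← ENNReal.ofReal_mul (by positivity),
        ← ENNReal.ofReal_add (mul_nonneg (by positivity) (quad_nonneg _ _)) (by positivity)]
      refine ENNReal.ofReal_le_ofReal ?_
      push_cast
      refine h2.trans ?_
      set r := √(quad 1 (nextQueue w.1.1.1 w.1.2 w.2.1 w.2.2))
      set u : ℝ := (idle x y w : ℝ)
      rw [← h3]
      have h4 : N * √ε / 2 * r ^ 2 + N / (2 * √ε) * u ^ 2 - N * r * u =
          N / (2 * √ε) * (√ε * r - u) ^ 2 := by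
        field_simp
        ring
      have h5 : 0 ≤ N / (2 * √ε) * (√ε * r - u) ^ 2 := by positivity
      linarith
    refine (mean_mono fun w _ => h1 w).trans ?_
    rw [mean_add, mean_const_mul, mean_const_mul,
      hν.mean_nextQueue fun q => ENNReal.ofReal (quad 1 q)]
    refine (add_le_add (mul_le_mul_right hQ _) (mul_le_mul_right hU2 _)).trans ?_
    rw [← ENNReal.ofReal_mul (by positivity), ← ENNReal.ofReal_mul (by positivity),
      ← ENNReal.ofReal_add (by positivity) (by positivity)]
    refine ENNReal.ofReal_le_ofReal (le_of_eq ?_)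
    have h6 : ε = √ε * √ε := (Real.mul_self_sqrt hε.le).symm
    have h7 : N / (2 * √ε) * (N * Smax * ε) = N / 2 * (N * Smax) * √ε := by
      nth_rewrite 2 [h6]
      field_simp
    rw [h7]
    ring

/-- Second moments of the stationary workload are finite. -/
lemma mean_sq_total_ne_top [NeZero N] (ha : ArrivalLaw (∑ n, μ n - ε) Amax a)
    (hs : ServiceLaws μ s) (hε : 0 < ε) {ν : PMF (JBTG μ hμ d T hd).State}
    (hν : (JBTG μ hμ d T hd).IsStationary a s ν) :
    mean ν (fun z => (((∑ n, z.1 n) ^ 2 : ℕ) : ℝ≥0∞)) ≠ ⊤ := by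
  obtain ⟨Smax, hb⟩ := hs.1
  obtain ⟨c, K, B, hc, hcK, h⟩ := exists_drift_norm hμ (d := d) hd T hε ha hb hs
  have hK := hc.trans_le hcK
  have hst : (ν.bind ((JBTG μ hμ d T hd).slot a s)).bind (jbtgStep μ hμ d T hd a s) = _ :=
    hν.bind_slot
  have hreg := regularPre_of_stationary (ch := weightedChoice μ hμ) hst
  have hexp := mean_exp_le_of_stationary hst (W := fun z => √(quad 0 z.1)) hc hcK
    (fun z _ => finite_support_jbtgStep ha hb z) (fun z hz => (h z (hreg hz)).1)
    fun z hz => (h z (hreg hz)).2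
  have htop := ne_top_of_le_ne_top (exp_bound_ne_top hc hcK _) hexp
  set θ := c / (2 * K ^ 2) with hθ
  have hθ0 : 0 < θ := by positivity
  rw [← hν.mean_bind_slot fun q => (((∑ n, q n) ^ 2 : ℕ) : ℝ≥0∞)]
  refine ne_top_of_le_ne_top (ENNReal.mul_ne_top (ENNReal.ofReal_ne_top
    (r := N ^ 2 * (2 / θ ^ 2))) htop) ?_
  rw [← mean_const_mul]
  refine mean_mono fun z _ => ?_
  rw [← ENNReal.ofReal_mul (by positivity), ← ENNReal.ofReal_natCast, Nat.cast_pow]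
  refine ENNReal.ofReal_le_ofReal ?_
  have h1 := pow_le_pow_left₀ (Nat.cast_nonneg _) (sum_le_mul_sqrt_quad_zero z.1) 2
  have h2 := sq_le_mul_exp hθ0 (Real.sqrt_nonneg (quad 0 z.1))
  rw [mul_pow] at h1
  refine h1.trans ?_
  rw [mul_assoc]
  exact mul_le_mul_of_nonneg_left h2 (by positivity)

/-- State space collapse: the stationary imbalance has bounded second moment, uniformly in heavy
traffic. -/
lemma exists_mean_imbalance_le [NeZero N] (hN : 2 ≤ N) (hμ : ∀ n, 0 < μ n) (hd1 : 1 ≤ d)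
    (hd : d ≤ N) (hT : 1 ≤ T) (hs : ServiceLaws μ s) (Amax : ℕ) :
    ∃ ε₁ Q : ℝ, 0 < ε₁ ∧ 0 ≤ Q ∧ ∀ ε ∈ Set.Ioo 0 ε₁, ∀ a : PMF ℕ,
      ArrivalLaw (∑ n, μ n - ε) Amax a → ∀ ν : PMF (JBTG μ hμ d T hd).State,
      (JBTG μ hμ d T hd).IsStationary a s ν →
      mean ν (fun z => ENNReal.ofReal (quad 1 z.1)) ≤ ENNReal.ofReal Q := by
  obtain ⟨Smax, hb⟩ := hs.1
  obtain ⟨ε₁, η, c, K, B, hε₁, hη, hc, hcK, h⟩ :=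
    exists_drift_imbalance hN hμ hd1 hd hT hb hs Amax
  have hK := hc.trans_le hcK
  have hbt := exp_bound_ne_top hc hcK (Real.exp (c / (2 * K ^ 2) * (B + K)))
  set θ := c / (2 * K ^ 2) with hθ
  have hθ0 : 0 < θ := by positivity
  set b := (1 - ENNReal.ofReal (1 - c ^ 2 / (4 * K ^ 2)))⁻¹ *
    ENNReal.ofReal (Real.exp (θ * (B + K)))
  -- From `r ^ 2 ≤ 2 / θ ^ 2 * exp (θ * r)`; the bound `b` on the exponential moment depends neither
  -- on `ε` nor on the arrival law.
  refine ⟨ε₁, 2 / θ ^ 2 * b.toReal, hε₁, by positivity, fun ε hε a ha ν hν => ?_⟩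
  have hst : (ν.bind ((JBTG μ hμ d T hd).slot a s)).bind (jbtgStep μ hμ d T hd a s) = _ :=
    hν.bind_slot
  have hreg := regularPre_of_stationary (ch := weightedChoice μ hμ) hst
  have hexp := mean_exp_le_of_stationary hst (W := fun z => √(quad 1 z.1) + η * z.2.countdown)
    hc hcK (fun z _ => finite_support_jbtgStep ha hb z) (fun z hz => (h ε hε a ha z (hreg hz)).1)
    fun z hz => (h ε hε a ha z (hreg hz)).2
  rw [← hν.mean_bind_slot fun q => ENNReal.ofReal (quad 1 q),
    ENNReal.ofReal_mul (by positivity), ENNReal.ofReal_toReal hbt]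
  refine le_trans ?_ (mul_le_mul_right hexp _)
  rw [← mean_const_mul]
  refine mean_mono fun z _ => ?_
  rw [← ENNReal.ofReal_mul (by positivity)]
  refine ENNReal.ofReal_le_ofReal ?_
  have h1 := sq_le_mul_exp hθ0 (Real.sqrt_nonneg (quad 1 z.1))
  rw [Real.sq_sqrt (quad_nonneg 1 z.1)] at h1
  refine h1.trans (mul_le_mul_of_nonneg_left (Real.exp_le_exp.2 ?_) (by positivity))
  exact mul_le_mul_of_nonneg_left (le_add_of_nonneg_right (by positivity)) hθ0.le

lemma heavyTrafficDelayOptimal_JBTG [NeZero N] (hN : 2 ≤ N) (hd1 : 1 ≤ d) (hT : 1 ≤ T) :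
    (JBTG μ hμ d T hd).HeavyTrafficDelayOptimal μ := by
  rintro s hs Amax a ε₀ hε₀ ha ⟨v, hv⟩
  refine ⟨fun ε hε => ⟨exists_isStationary_JBTG hd1 hT hε.1 (ha ε hε) hs,
    exists_isPooledStationary (ha ε hε) hs hε.1⟩, ?_⟩
  obtain ⟨Smax, hb⟩ := hs.1
  obtain ⟨ε₁, Q, hε₁, hQ0, hQ⟩ := exists_mean_imbalance_le hN hμ hd1 hd hT hs Amax
  set σ := ev (serviceLaw s) (fun S => (((∑ n, S n) ^ 2 : ℕ) : ℝ))
  have hid : Tendsto (fun ε : ℝ => ε) (𝓝[>] 0) (𝓝 0) := nhdsWithin_le_nhds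
  have hsqrt : Tendsto (fun ε : ℝ => √ε) (𝓝[>] 0) (𝓝 0) := by
    have := (Real.continuous_sqrt.tendsto 0).mono_left (nhdsWithin_le_nhds (s := Set.Ioi 0))
    rwa [Real.sqrt_zero] at this
  have hg : ∀ k : ℝ, Tendsto (fun ε : ℝ => N * Smax * ε / 2 + k * √ε) (𝓝[>] 0) (𝓝 0) := by
    intro k
    have h1 := ((hid.const_mul ((N : ℝ) * Smax)).div_const 2).add (hsqrt.const_mul k)
    simpa using h1
  refine ⟨ENNReal.ofReal ((v + σ - (∑ n, μ n) ^ 2) / 2), ENNReal.ofReal_ne_top,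
    fun ν hν => ?_, fun ρ hρ => ?_⟩
  · refine tendsto_scaled_workload (lt_min hε₀ hε₁) hv (hg (N / 2 * (Q + N * Smax)))
      fun ε hε => ?_
    have hε0 : ε ∈ Set.Ioo 0 ε₀ := ⟨hε.1, hε.2.trans_le (min_le_left _ _)⟩
    have hε1 : ε ∈ Set.Ioo 0 ε₁ := ⟨hε.1, hε.2.trans_le (min_le_right _ _)⟩
    exact jbtg_workload (ha ε hε0) hb hs hε.1 (hν ε hε0)
      (mean_sq_total_ne_top (ha ε hε0) hs hε.1 (hν ε hε0)) hQ0
      (hQ ε hε1 (a ε) (ha ε hε0) (ν ε) (hν ε hε0))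
  · have hg0 := hg 0
    simp only [zero_mul] at hg0
    exact tendsto_scaled_workload hε₀ hv hg0 fun ε hε =>
      pooled_workload (ha ε hε) hb hs hε.1 (hρ ε hε)

end HeavyTraffic

/-! ### Homogeneous servers -/

lemma JBT_eq_JBTG [NeZero N] {μ : Fin N → ℝ} (hμ : ∀ n, 0 < μ n) (h : ∀ n n', μ n = μ n')
    (d T : ℕ) (hd : d ≤ N) : JBT d T hd = JBTG μ hμ d T hd := by
  have hw : ∀ (I : Finset (Fin N)) (hI : I.Nonempty) (i : Fin N),
      rateWeighted μ hμ I hI i = if i ∈ I then (I.card : ℝ≥0∞)⁻¹ else 0 := by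
    intro I hI i
    have hc : (I.card : ℝ) ≠ 0 := by exact_mod_cast hI.card_ne_zero
    rw [← ENNReal.toReal_eq_toReal_iff' (PMF.apply_ne_top _ _) (by
      split_ifs
      · exact ENNReal.inv_ne_top.2 (by exact_mod_cast hI.card_ne_zero)
      · exact ENNReal.zero_ne_top), toReal_rateWeighted]
    split_ifs
    · rw [Finset.sum_congr rfl fun j _ => h j i, Finset.sum_const, nsmul_eq_mul,
        ENNReal.toReal_inv, ENNReal.toReal_natCast]
      have := (hμ i).ne'
      field_simp
    · rfl
  have hch : (uniformChoice : Finset (Fin N) → PMF (Fin N)) = weightedChoice μ hμ := by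
    funext I
    unfold uniformChoice weightedChoice
    split_ifs with hI
    · ext i
      rw [hw, PMF.uniformOfFinset_apply]
      congr
    · ext i
      rw [hw, PMF.uniformOfFintype_apply, if_pos (Finset.mem_univ i), Finset.card_univ]
  rw [JBT, JBTG, hch]

lemma updateTilt_of_homogeneous [NeZero N] {μ : Fin N → ℝ} (hμ : ∀ n, 0 < μ n)
    (h : ∀ n n', μ n = μ n') (d : ℕ) :
    updateTilt μ d = min ((d : ℝ) / N * (1 - 1 / N)) (1 / N) := by
  have hN : (0 : ℝ) < N := by exact_mod_cast Nat.pos_of_ne_zero (NeZero.ne N)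
  have h1 : (⨅ n, μ n) / ∑ n, μ n = 1 / N := by
    have h2 : ⨅ n, μ n = μ 0 := by
      rw [show μ = fun _ => μ 0 from funext fun n => h n 0]
      exact ciInf_const
    rw [h2, Finset.sum_congr rfl fun j _ => h j 0, Finset.sum_const, nsmul_eq_mul,
      Finset.card_univ, Fintype.card_fin]
    have := (hμ 0).ne'
    field_simp
  rw [updateTilt, h1, min_mul_of_nonneg _ _ (by positivity), one_mul, min_comm]
  congr 1
  ring

end LoadBalancing

end

open LoadBalancing in
theorem mainTheorem5 {N : ℕ} [NeZero N] (hN : 2 ≤ N) (μ : Fin N → ℝ) (hμ : ∀ n, 0 < μ n)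
    (d T : ℕ) (hd : 1 ≤ d) (hdN : d ≤ N) (hT : 1 ≤ T) :
    ((∀ n n', μ n = μ n') →
      (JBT d T hdN).InClassPi μ ∧
      (JBT d T hdN).ThroughputOptimal μ ∧
      (JBT d T hdN).HeavyTrafficDelayOptimal μ ∧
      ∀ r : ℕ, ∀ z ∈ (JBT d T hdN).possiblePre μ (r * T + 1),
        DeltaTiltedUpToEquiv
          (min ((d : ℝ) / N * (1 - 1 / N)) (1 / N)) μ z.1 ((JBT d T hdN).meanDispatch z)) ∧
    ((JBTG μ hμ d T hdN).InClassPi μ ∧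
      (JBTG μ hμ d T hdN).ThroughputOptimal μ ∧
      (JBTG μ hμ d T hdN).HeavyTrafficDelayOptimal μ ∧
      ∀ r : ℕ, ∀ z ∈ (JBTG μ hμ d T hdN).possiblePre μ (r * T + 1),
        DeltaTiltedUpToEquiv
          (min 1 ((d : ℝ) * (1 - 1 / N)) * ((⨅ n, μ n) / ∑ n, μ n)) μ z.1
          ((JBTG μ hμ d T hdN).meanDispatch z)) := by
  refine ⟨fun h => ?_, inClassPi_JBTG hN hd hT, throughputOptimal_JBTG hT,
    heavyTrafficDelayOptimal_JBTG hN hd hT, deltaTilted_meanDispatch hN hd hT⟩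
  rw [← updateTilt_of_homogeneous hμ h, JBT_eq_JBTG hμ h]
  exact ⟨inClassPi_JBTG hN hd hT, throughputOptimal_JBTG hT,
    heavyTrafficDelayOptimal_JBTG hN hd hT, deltaTilted_meanDispatch hN hd hT⟩
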